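/- Let $P$ be a path with vertices $v_0,\dots,v_n$ ($n\ge 1$), edges $e_k=(v_k,v_{k+1})$ of length $d_k>0$ and capacity $c_k>0$ $(0\le k<n)$, and a weight range $[w_k^-,w_k^+]$ with $0\le w_k^-\le w_k^+$ for every vertex. Put $x_k=\sum_{t<k}d_t$ and identify $P$ with the segment $[x_0,x_n]$. For $x\le x'$ in $P$ let $c(x,x')$ be the minimum capacity of the edges on the path from $x$ to $x'$ (with $c(x,x)=+\infty$ when $x$ is a vertex). For a scenario $s=(w_0(s),\dots,w_n(s))$ of nonnegative weights let $W_{a,b}(s)=\sum_{t=a}^b w_t(s)$, $$g_t(x:s)=\begin{cases}(x-x_t)+\frac{W_{0,t}(s)}{c(x_t,x)}&W_{0,t}(s)>0\\0&W_{0,t}(s)=0\end{cases}\ (x_t\le x),\qquad h_t(x:s)=\begin{cases}(x_t-x)+\frac{W_{t,n}(s)}{c(x,x_t)}&W_{t,n}(s)>0\\0&W_{t,n}(s)=0\end{cases}\ (x\le x_t),$$ and let $\Theta(P,x:s)=\max\{\max_{t:x_t<x}g_t(x:s),\ \max_{t:x_t>x}h_t(x:s)\}$, where a maximum over the empty set is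 $0$. For $i\le j$ let $S_{i,j}$ be the set of scenarios with $w_t(s)=w_t^-$ for $t<i$ or $t>j$, $w_t(s)=w_t^+$ for $i<t<j$, and $w_t(s)\in[w_t^-,w_t^+]$ for $t\in\{i,j\}$. Define $$G_j(x)=\sup_{s\in S_{j,j}}\Bigl\{g_j(x:s)-\min_{x_j\le y\le x_n}\Theta(P,y:s)\Bigr\},\qquad H_i(x)=\sup_{s\in S_{i,i}}\Bigl\{h_i(x:s)-\min_{x_0\le y\le x_i}\Theta(P,y:s)\Bigr\},$$ and, for $i<j$, $$G_{i,j}(x)=\sup_{s\in S_{i,j},\,w_j(s)=w_j^+}\Bigl\{g_j(x:s)-\min_{x_j\le y\le x_n}\Theta(P,y:s)\Bigr\},\qquad \bar G_{i,j}(x)=\sup_{s\in S_{i,j}}\Bigl\{\max_{t:\,x_j\le x_t\le x}g_t(x:s)-\min_{x_i\le y\le x_j}\Theta(P,y:s)\Bigr\},$$ $$H_{i,j}(x)=\sup_{s\in S_{i,j},\,w_i(s)=w_i^+}\Bigl\{h_i(x:s)-\min_{x_0\le y\le x_i}\Theta(P,y:s)\Bigr\},\qquad \bar H_{i,j}(x)=\sup_{s\in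 S_{i,j}}\Bigl\{\max_{t:\,x\le x_t\le x_i}h_t(x:s)-\min_{x_i\le y\le x_j}\Theta(P,y:s)\Bigr\}.$$ **Theorem.** Given the path (its $n$, $d_k$, $c_k$, $w_k^-$, $w_k^+$), a point $x\in P$ and the indices, each of $G_j(x)$, $G_{i,j}(x)$, $\bar G_{i,j}(x)$ (for $x_j\le x$, and $i<j$ in the last two) and each of $H_i(x)$, $H_{i,j}(x)$, $\bar H_{i,j}(x)$ (for $x\le x_i$, and $i<j$ in the last two) can be evaluated in $O(n^2)$ time on a real RAM, that is, for each of the six functions there are one program (using $+,-,\times,\div$ and comparisons of reals, addition, subtraction and comparison of indices, and arrays, all at unit cost) and one constant $C$ such that the program outputs the exact value after at most $Cn^2$ steps on every input. -/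

import Mathlib

/-! ## Real random access machine

Programs are structured (sequence, branch, loop) over finitely many index registers, real
registers, index arrays and real arrays, each named by a numeral written in the program; array
entries are addressed by computed indices.  Indices may be added, subtracted and compared; reals
may be added, subtracted, multiplied, divided and compared; there is no conversion between the two
kinds.  Every operation, register access, array access and test costs one step. -/

namespace RealRAM

/-- Memory contents. -/
structure State where
  /-- index registers -/
  nreg : ℕ → ℕ
  /-- real registers -/
  rreg : ℕ → ℝ
  /-- `narr a k` is entry `k` of index array `a` -/
  narr : ℕ → ℕ → ℕ
  /-- `rarr a k` is entry `k` of real array `a` -/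
  rarr : ℕ → ℕ → ℝ

/-- Index expressions. -/
inductive NExpr where
  | const (k : ℕ)
  | reg (r : ℕ)
  | read (a : ℕ) (e : NExpr)
  | add (e f : NExpr)
  | sub (e f : NExpr)

/-- Value of an index expression (subtraction is truncated at `0`). -/
def NExpr.eval (σ : State) : NExpr → ℕ
  | .const k => k
  | .reg r => σ.nreg r
  | .read a e => σ.narr a (e.eval σ)
  | .add e f => e.eval σ + f.eval σ
  | .sub e f => e.eval σ - f.eval σ

/-- Number of steps for evaluating an index expression. -/
def NExpr.cost : NExpr → ℕ
  | .const _ => 1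
  | .reg _ => 1
  | .read _ e => e.cost + 1
  | .add e f => e.cost + f.cost + 1
  | .sub e f => e.cost + f.cost + 1

/-- Real expressions; the only constants are rational. -/
inductive RExpr where
  | const (q : ℚ)
  | reg (r : ℕ)
  | read (a : ℕ) (e : NExpr)
  | add (e f : RExpr)
  | sub (e f : RExpr)
  | mul (e f : RExpr)
  | div (e f : RExpr)

/-- Value of a real expression (a division by `0` returns `0`). -/
noncomputable def RExpr.eval (σ : State) : RExpr → ℝ
  | .const q => (q : ℝ)
  | .reg r => σ.rreg r
  | .read a e => σ.rarr a (e.eval σ)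
  | .add e f => e.eval σ + f.eval σ
  | .sub e f => e.eval σ - f.eval σ
  | .mul e f => e.eval σ * f.eval σ
  | .div e f => e.eval σ / f.eval σ

/-- Number of steps for evaluating a real expression. -/
def RExpr.cost : RExpr → ℕ
  | .const _ => 1
  | .reg _ => 1
  | .read _ e => e.cost + 1
  | .add e f => e.cost + f.cost + 1
  | .sub e f => e.cost + f.cost + 1
  | .mul e f => e.cost + f.cost + 1
  | .div e f => e.cost + f.cost + 1

/-- Tests. -/
inductive Test where
  | nle (e f : NExpr)
  | rle (e f : RExpr)
  | not (b : Test)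
  | and (b c : Test)

/-- Truth of a test. -/
def Test.holds (σ : State) : Test → Prop
  | .nle e f => e.eval σ ≤ f.eval σ
  | .rle e f => e.eval σ ≤ f.eval σ
  | .not b => ¬ b.holds σ
  | .and b c => b.holds σ ∧ c.holds σ

/-- Number of steps for evaluating a test. -/
def Test.cost : Test → ℕ
  | .nle e f => e.cost + f.cost + 1
  | .rle e f => e.cost + f.cost + 1
  | .not b => b.cost + 1
  | .and b c => b.cost + c.cost + 1

/-- Programs. -/
inductive Prog where
  | nop
  | setN (r : ℕ) (e : NExpr)
  | setR (r : ℕ) (e : RExpr)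
  | storeN (a : ℕ) (k e : NExpr)
  | storeR (a : ℕ) (k : NExpr) (e : RExpr)
  | seq (p q : Prog)
  | branch (b : Test) (p q : Prog)
  | loop (b : Test) (p : Prog)

/-- `Exec p σ σ' t`: started in `σ`, the program `p` halts in `σ'` after exactly `t` steps.
`loop b p` runs `p` as long as `b` holds. -/
inductive Exec : Prog → State → State → ℕ → Prop where
  | nop (σ : State) : Exec .nop σ σ 1
  | setN (σ : State) (r : ℕ) (e : NExpr) :
      Exec (.setN r e) σ { σ with nreg := Function.update σ.nreg r (e.eval σ) } (e.cost + 1)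
  | setR (σ : State) (r : ℕ) (e : RExpr) :
      Exec (.setR r e) σ { σ with rreg := Function.update σ.rreg r (e.eval σ) } (e.cost + 1)
  | storeN (σ : State) (a : ℕ) (k e : NExpr) :
      Exec (.storeN a k e) σ
        { σ with narr := Function.update σ.narr a
                    (Function.update (σ.narr a) (k.eval σ) (e.eval σ)) }
        (k.cost + e.cost + 1)
  | storeR (σ : State) (a : ℕ) (k : NExpr) (e : RExpr) :
      Exec (.storeR a k e) σ
        { σ with rarr := Function.update σ.rarr a
                    (Function.update (σ.rarr a) (k.eval σ) (e.eval σ)) }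
        (k.cost + e.cost + 1)
  | seq {p q : Prog} {σ σ' σ'' : State} {t t' : ℕ} :
      Exec p σ σ' t → Exec q σ' σ'' t' → Exec (.seq p q) σ σ'' (t + t')
  | branchTrue {b : Test} {p q : Prog} {σ σ' : State} {t : ℕ} :
      b.holds σ → Exec p σ σ' t → Exec (.branch b p q) σ σ' (b.cost + t)
  | branchFalse {b : Test} {p q : Prog} {σ σ' : State} {t : ℕ} :
      ¬ b.holds σ → Exec q σ σ' t → Exec (.branch b p q) σ σ' (b.cost + t)
  | loopDone {b : Test} {p : Prog} {σ : State} :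
      ¬ b.holds σ → Exec (.loop b p) σ σ b.cost
  | loopStep {b : Test} {p : Prog} {σ σ' σ'' : State} {t t' : ℕ} :
      b.holds σ → Exec p σ σ' t → Exec (.loop b p) σ' σ'' t' →
      Exec (.loop b p) σ σ'' (b.cost + t + t')

/-- Started in `σ`, the program halts after at most `T` steps with `v` in real register `0`. -/
def Prog.EvaluatesWithin (p : Prog) (σ : State) (v : ℝ) (T : ℕ) : Prop :=
  ∃ (σ' : State) (t : ℕ), Exec p σ σ' t ∧ t ≤ T ∧ σ'.rreg 0 = v

end RealRAM

/-! ## Evacuation on a path -/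

/-- A path with vertices `0, …, n` and edges `k = (k, k + 1)` for `k < n`.  Only `len k`, `cap k`
for `k < n` and `wmin k`, `wmax k` for `k ≤ n` are meaningful. -/
structure PathNetwork where
  /-- number of edges -/
  n : ℕ
  /-- edge lengths -/
  len : ℕ → ℝ
  /-- edge capacities -/
  cap : ℕ → ℝ
  /-- smallest possible vertex weights -/
  wmin : ℕ → ℝ
  /-- largest possible vertex weights -/
  wmax : ℕ → ℝ
  len_pos : ∀ k < n, 0 < len k
  cap_pos : ∀ k < n, 0 < cap k
  wmin_nonneg : ∀ k ≤ n, 0 ≤ wmin k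
  wmin_le_wmax : ∀ k ≤ n, wmin k ≤ wmax k

namespace PathNetwork

/-- Location `x_k` of vertex `k`. -/
noncomputable def pos (P : PathNetwork) (k : ℕ) : ℝ := ∑ t ∈ Finset.range k, P.len t

/-- `c(x, x')` for `x ≤ x'`: the minimum capacity of the edges on the path from `x` to `x'`.
With `a = max {a | x_a ≤ x}` and `b = min {b | x' ≤ x_b}`, these are the edges `t` with
`a ≤ t < b`, because `a ≤ t ↔ x < x_{t+1}` and `t < b ↔ x_t < x'`. -/
noncomputable def minCap (P : PathNetwork) (x x' : ℝ) : ℝ :=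
  sInf (P.cap '' {t | t < P.n ∧ x < P.pos (t + 1) ∧ P.pos t < x'})

/-- `W_{a,b}`: total weight of the vertices `a, …, b` in scenario `s`. -/
noncomputable def weight (s : ℕ → ℝ) (a b : ℕ) : ℝ := ∑ t ∈ Finset.Icc a b, s t

/-- `g_t(x : s)` for `x_t ≤ x`.  If `x_t = x` there is no edge to cross and the value is `0`
(the minimum capacity over no edges is infinite). -/
noncomputable def g (P : PathNetwork) (s : ℕ → ℝ) (t : ℕ) (x : ℝ) : ℝ :=
  open Classical in
  if 0 < weight s 0 t ∧ P.pos t < x then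
    (x - P.pos t) + weight s 0 t / P.minCap (P.pos t) x
  else 0

/-- `h_t(x : s)` for `x ≤ x_t`, with value `0` if `x_t = x`. -/
noncomputable def h (P : PathNetwork) (s : ℕ → ℝ) (t : ℕ) (x : ℝ) : ℝ :=
  open Classical in
  if 0 < weight s t P.n ∧ x < P.pos t then
    (P.pos t - x) + weight s t P.n / P.minCap x (P.pos t)
  else 0

/-- Time to evacuate everything on the left of `x` to `x`; it is `0` (the value of `sSup ∅`) if
there is no vertex on the left of `x`. -/
noncomputable def evacLeft (P : PathNetwork) (s : ℕ → ℝ) (x : ℝ) : ℝ :=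
  sSup ((fun t => P.g s t x) '' {t | t ≤ P.n ∧ P.pos t < x})

/-- Time to evacuate everything on the right of `x` to `x`. -/
noncomputable def evacRight (P : PathNetwork) (s : ℕ → ℝ) (x : ℝ) : ℝ :=
  sSup ((fun t => P.h s t x) '' {t | t ≤ P.n ∧ x < P.pos t})

/-- Evacuation time `Θ(P, x : s)`. -/
noncomputable def evac (P : PathNetwork) (s : ℕ → ℝ) (x : ℝ) : ℝ :=
  max (P.evacLeft s x) (P.evacRight s x)

/-- The minimum of `Θ(P, y : s)` over `a ≤ y ≤ b`. -/
noncomputable def minEvac (P : PathNetwork) (s : ℕ → ℝ) (a b : ℝ) : ℝ :=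
  sInf ((fun y => P.evac s y) '' Set.Icc a b)

/-- The scenario `s_{i,j}(α, β)` (used with `α = β` if `i = j`). -/
noncomputable def scenario (P : PathNetwork) (i j : ℕ) (α β : ℝ) : ℕ → ℝ := fun t =>
  if t = i then α
  else if t = j then β
  else if i < t ∧ t < j then P.wmax t
  else P.wmin t

/-- The set `S_{i,j}` of two-varying scenarios. -/
def twoVarying (P : PathNetwork) (i j : ℕ) : Set (ℕ → ℝ) :=
  {s | ∃ α ∈ Set.Icc (P.wmin i) (P.wmax i), ∃ β ∈ Set.Icc (P.wmin j) (P.wmax j),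
    (i = j → α = β) ∧ s = P.scenario i j α β}

/-- `G_j(x)` -/
noncomputable def G₁ (P : PathNetwork) (j : ℕ) (x : ℝ) : ℝ :=
  sSup ((fun s => P.g s j x - P.minEvac s (P.pos j) (P.pos P.n)) '' P.twoVarying j j)

/-- `G_{i,j}(x)` -/
noncomputable def G₂ (P : PathNetwork) (i j : ℕ) (x : ℝ) : ℝ :=
  sSup ((fun s => P.g s j x - P.minEvac s (P.pos j) (P.pos P.n)) ''
    {s ∈ P.twoVarying i j | s j = P.wmax j})

/-- `Ḡ_{i,j}(x)` -/
noncomputable def Gbar (P : PathNetwork) (i j : ℕ) (x : ℝ) : ℝ :=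
  sSup ((fun s => sSup ((fun t => P.g s t x) '' {t | t ≤ P.n ∧ P.pos j ≤ P.pos t ∧ P.pos t ≤ x})
      - P.minEvac s (P.pos i) (P.pos j)) '' P.twoVarying i j)

/-- `H_i(x)` -/
noncomputable def H₁ (P : PathNetwork) (i : ℕ) (x : ℝ) : ℝ :=
  sSup ((fun s => P.h s i x - P.minEvac s (P.pos 0) (P.pos i)) '' P.twoVarying i i)

/-- `H_{i,j}(x)` -/
noncomputable def H₂ (P : PathNetwork) (i j : ℕ) (x : ℝ) : ℝ :=
  sSup ((fun s => P.h s i x - P.minEvac s (P.pos 0) (P.pos i)) ''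
    {s ∈ P.twoVarying i j | s i = P.wmax i})

/-- `H̄_{i,j}(x)` -/
noncomputable def Hbar (P : PathNetwork) (i j : ℕ) (x : ℝ) : ℝ :=
  sSup ((fun s => sSup ((fun t => P.h s t x) '' {t | t ≤ P.n ∧ x ≤ P.pos t ∧ P.pos t ≤ P.pos i})
      - P.minEvac s (P.pos i) (P.pos j)) '' P.twoVarying i j)

/-- The machine's memory at the start: `n`, `i`, `j` in the first index registers, `x` in real
register `0`, the lengths, capacities, lower and upper weights in the first real arrays, and `0`
everywhere else. -/
noncomputable def input (P : PathNetwork) (i j : ℕ) (x : ℝ) : RealRAM.State where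
  nreg r := if r = 0 then P.n else if r = 1 then i else if r = 2 then j else 0
  rreg r := if r = 0 then x else 0
  narr _ _ := 0
  rarr a k :=
    if a = 0 ∧ k < P.n then P.len k
    else if a = 1 ∧ k < P.n then P.cap k
    else if a = 2 ∧ k ≤ P.n then P.wmin k
    else if a = 3 ∧ k ≤ P.n then P.wmax k
    else 0

end PathNetwork

/-! Each of the six values is a supremum over at most two free weights, an excess α at one vertex
and β at another, and, since minus a minimum over y is a maximum, also over a location y. Let L_m(α)
be the upper envelope of the lines α ↦ -x_t + (W_t + [i ≤ t] α)/c_e with t ≤ e < m. Because W / min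
c = max W / c, the left evacuation time at y is max(0, y + L_m(α)), where m edges start before y.
The right one is max(0, x_n - y + R_{n-k}(β)) with the envelopes R of the reversed path, and the
objective at x is max(0, x + M(α + β)) with one more envelope M (`sSup_g_eq`, `evac_vertex`,
`evac_edge`, `objective_eq`).

An edge e adds only two lines to L, a constant one and one of slope 1/c_e. A convex function and a
line cross at most twice, so inserting a line into a list of breakpoints takes linear time and adds
at most two points (`insertProg_runs`). Hence the lists of all L_0, …, L_n have O(n) points each and
are built in O(n²) time (`buildProg_runs`); the same holds for R and M.

It remains to maximize the objective minus max(0, y + L(α), x_n - y + R(β)). The objective is convex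
and nondecreasing in α + β, hence a maximum of supporting lines a(α + β) + b with a ≥ 0, and for a
single line the problem is concave. The point is to find O(n) candidates for each vertex and each
edge that serve all a at once.

At a vertex, the weight on the lower side is raised until both sides agree or the weight is
exhausted; then both weights move, keeping the sides equal, until one of them is a breakpoint. So
the candidates pair a breakpoint of one side with the largest weight for which the other side is not
higher (`vertex_complete`). On an edge, the best y balances the sides at height (L(α) + R(β) +
x_n)/2 and the problem separates: α maximizes 2aα - L(α) and β maximizes 2aβ - R(β). The maximizers
are breakpoints at which the slopes pass 2a, and the pairs arising for all a are met in a merge of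
the two slope sequences (`exists_pair`). If the balancing location is off the edge, a convex
combination moves the solution to an end of the edge, which is a vertex (`edge_complete`). Both
weights are nondecreasing along a scan, so M is evaluated with a pointer that only moves forward,
and a scan takes O(n) time (`scanProg_runs`).

Vertices with no accumulated weight do not count, so the values jump when α or β becomes positive.
The box of weights is therefore cut into four pieces by the signs of α and β, on each of which the
formulas are continuous up to the border (`pieceProg_runs`, `le_of_inner`). Finally, the H functions
are the G functions of the reversed path, which the machine writes down in linear time
(`Runs.reversed`). -/

namespace RealRAM

/-! ### Reasoning about programs -/

namespace State

/-- Overwrite an index register. -/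
def setN (σ : State) (r v : ℕ) : State := { σ with nreg := Function.update σ.nreg r v }

/-- Overwrite a real register. -/
def setR (σ : State) (r : ℕ) (v : ℝ) : State := { σ with rreg := Function.update σ.rreg r v }

/-- Overwrite an entry of an index array. -/
def putN (σ : State) (a k v : ℕ) : State :=
  { σ with narr := Function.update σ.narr a (Function.update (σ.narr a) k v) }

/-- Overwrite an entry of a real array. -/
def putR (σ : State) (a k : ℕ) (v : ℝ) : State :=
  { σ with rarr := Function.update σ.rarr a (Function.update (σ.rarr a) k v) }

variable (σ : State) (r r' v a a' k k' : ℕ) (u : ℝ)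

@[simp] theorem setN_nreg : (σ.setN r v).nreg r' = if r' = r then v else σ.nreg r' := by
  simp [setN, Function.update_apply]
@[simp] theorem setN_rreg : (σ.setN r v).rreg = σ.rreg := rfl
@[simp] theorem setN_narr : (σ.setN r v).narr = σ.narr := rfl
@[simp] theorem setN_rarr : (σ.setN r v).rarr = σ.rarr := rfl
@[simp] theorem setR_nreg : (σ.setR r u).nreg = σ.nreg := rfl
@[simp] theorem setR_rreg : (σ.setR r u).rreg r' = if r' = r then u else σ.rreg r' := by
  simp [setR, Function.update_apply]
@[simp] theorem setR_narr : (σ.setR r u).narr = σ.narr := rfl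
@[simp] theorem setR_rarr : (σ.setR r u).rarr = σ.rarr := rfl
@[simp] theorem putN_nreg : (σ.putN a k v).nreg = σ.nreg := rfl
@[simp] theorem putN_rreg : (σ.putN a k v).rreg = σ.rreg := rfl
@[simp] theorem putN_narr : (σ.putN a k v).narr a' =
    if a' = a then Function.update (σ.narr a) k v else σ.narr a' := by
  simp only [putN, Function.update_apply]
@[simp] theorem putN_rarr : (σ.putN a k v).rarr = σ.rarr := rfl
@[simp] theorem putR_nreg : (σ.putR a k u).nreg = σ.nreg := rfl
@[simp] theorem putR_rreg : (σ.putR a k u).rreg = σ.rreg := rfl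
@[simp] theorem putR_narr : (σ.putR a k u).narr = σ.narr := rfl
@[simp] theorem putR_rarr : (σ.putR a k u).rarr a' =
    if a' = a then Function.update (σ.rarr a) k u else σ.rarr a' := by
  simp only [putR, Function.update_apply]

end State

attribute [simp] NExpr.eval RExpr.eval Test.holds

/-- No loops. -/
def Prog.loopFree : Prog → Bool
  | .seq p q => p.loopFree && q.loopFree
  | .branch _ p q => p.loopFree && q.loopFree
  | .loop _ _ => false
  | _ => true

/-- The effect of a loop-free program. -/
noncomputable def Prog.run : Prog → State → State
  | .nop, σ => σ
  | .setN r e, σ => σ.setN r (e.eval σ)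
  | .setR r e, σ => σ.setR r (e.eval σ)
  | .storeN a k e, σ => σ.putN a (k.eval σ) (e.eval σ)
  | .storeR a k e, σ => σ.putR a (k.eval σ) (e.eval σ)
  | .seq p q, σ => q.run (p.run σ)
  | .branch b p q, σ => open Classical in if b.holds σ then p.run σ else q.run σ
  | .loop _ _, σ => σ

theorem Prog.run_branch_pos {b : Test} {p q : Prog} {σ : State} (h : b.holds σ) :
    (Prog.branch b p q).run σ = p.run σ := by rw [run, if_pos h]

theorem Prog.run_branch_neg {b : Test} {p q : Prog} {σ : State} (h : ¬ b.holds σ) :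
    (Prog.branch b p q).run σ = q.run σ := by rw [run, if_neg h]

/-- A bound for the running time of a loop-free program. -/
def Prog.size : Prog → ℕ
  | .nop => 1
  | .setN _ e => e.cost + 1
  | .setR _ e => e.cost + 1
  | .storeN _ k e => k.cost + e.cost + 1
  | .storeR _ k e => k.cost + e.cost + 1
  | .seq p q => p.size + q.size
  | .branch b p q => b.cost + p.size + q.size
  | .loop _ _ => 0

/-- The cost bound does not depend on the memory. Each loop-free block can thus be simulated by
rewriting with `Prog.run` and charged a constant. -/
theorem Prog.exec_run (p : Prog) (hp : p.loopFree = true) (σ : State) :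
    ∃ t ≤ p.size, Exec p σ (p.run σ) t := by
  induction p generalizing σ with
  | nop => exact ⟨1, le_rfl, .nop σ⟩
  | setN r e => exact ⟨_, le_rfl, .setN σ r e⟩
  | setR r e => exact ⟨_, le_rfl, .setR σ r e⟩
  | storeN a k e => exact ⟨_, le_rfl, .storeN σ a k e⟩
  | storeR a k e => exact ⟨_, le_rfl, .storeR σ a k e⟩
  | seq p q ihp ihq =>
    simp only [loopFree, Bool.and_eq_true] at hp
    obtain ⟨t, ht, h⟩ := ihp hp.1 σ
    obtain ⟨t', ht', h'⟩ := ihq hp.2 (p.run σ)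
    exact ⟨t + t', Nat.add_le_add ht ht', h.seq h'⟩
  | branch b p q ihp ihq =>
    simp only [loopFree, Bool.and_eq_true] at hp
    by_cases hb : b.holds σ
    · obtain ⟨t, ht, h⟩ := ihp hp.1 σ
      refine ⟨b.cost + t, by simp only [size]; omega, ?_⟩
      simp only [run, hb, if_true]
      exact .branchTrue hb h
    · obtain ⟨t, ht, h⟩ := ihq hp.2 σ
      refine ⟨b.cost + t, by simp only [size]; omega, ?_⟩
      simp only [run, hb, if_false]
      exact .branchFalse hb h
  | loop b p _ => simp [loopFree] at hp

/-- Index registers that may be written. -/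
def Prog.writesN : Prog → ℕ → Bool
  | .setN r _, r' => Nat.beq r r'
  | .seq p q, r' => p.writesN r' || q.writesN r'
  | .branch _ p q, r' => p.writesN r' || q.writesN r'
  | .loop _ p, r' => p.writesN r'
  | _, _ => false

/-- Real registers that may be written. -/
def Prog.writesR : Prog → ℕ → Bool
  | .setR r _, r' => Nat.beq r r'
  | .seq p q, r' => p.writesR r' || q.writesR r'
  | .branch _ p q, r' => p.writesR r' || q.writesR r'
  | .loop _ p, r' => p.writesR r'
  | _, _ => false

/-- Index arrays that may be written. -/
def Prog.storesN : Prog → ℕ → Bool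
  | .storeN a _ _, r' => Nat.beq a r'
  | .seq p q, r' => p.storesN r' || q.storesN r'
  | .branch _ p q, r' => p.storesN r' || q.storesN r'
  | .loop _ p, r' => p.storesN r'
  | _, _ => false

/-- Real arrays that may be written. -/
def Prog.storesR : Prog → ℕ → Bool
  | .storeR a _ _, r' => Nat.beq a r'
  | .seq p q, r' => p.storesR r' || q.storesR r'
  | .branch _ p q, r' => p.storesR r' || q.storesR r'
  | .loop _ p, r' => p.storesR r'
  | _, _ => false

/-- `σ'` differs from `σ` only where `p` may write. -/
structure Frame (p : Prog) (σ σ' : State) : Prop where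
  nreg : ∀ r, p.writesN r = false → σ'.nreg r = σ.nreg r
  rreg : ∀ r, p.writesR r = false → σ'.rreg r = σ.rreg r
  narr : ∀ a, p.storesN a = false → σ'.narr a = σ.narr a
  rarr : ∀ a, p.storesR a = false → σ'.rarr a = σ.rarr a

/-- What a program may write can be read off its text, so the side conditions of the frame are
closed by `rfl` and untouched memory is carried through loops without simulating them. -/
theorem Exec.frame {p : Prog} {σ σ' : State} {t : ℕ} (h : Exec p σ σ' t) : Frame p σ σ' := by
  have key : ∀ {r r' : ℕ}, Nat.beq r r' = false → r' ≠ r := by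
    intro r r' h e
    simp [e] at h
  induction h with
  | nop σ => exact ⟨fun _ _ => rfl, fun _ _ => rfl, fun _ _ => rfl, fun _ _ => rfl⟩
  | setN σ r e =>
    exact ⟨fun r' h => Function.update_of_ne (key h) _ _,
      fun _ _ => rfl, fun _ _ => rfl, fun _ _ => rfl⟩
  | setR σ r e =>
    exact ⟨fun _ _ => rfl, fun r' h => Function.update_of_ne (key h) _ _,
      fun _ _ => rfl, fun _ _ => rfl⟩
  | storeN σ a k e =>
    exact ⟨fun _ _ => rfl, fun _ _ => rfl, fun r' h => Function.update_of_ne (key h) _ _,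
      fun _ _ => rfl⟩
  | storeR σ a k e =>
    exact ⟨fun _ _ => rfl, fun _ _ => rfl, fun _ _ => rfl,
      fun r' h => Function.update_of_ne (key h) _ _⟩
  | seq _ _ ih ih' =>
    constructor <;> intro r hr <;>
      simp only [Prog.writesN, Prog.writesR, Prog.storesN, Prog.storesR, Bool.or_eq_false_iff] at hr
    · exact (ih'.nreg r hr.2).trans (ih.nreg r hr.1)
    · exact (ih'.rreg r hr.2).trans (ih.rreg r hr.1)
    · exact (ih'.narr r hr.2).trans (ih.narr r hr.1)
    · exact (ih'.rarr r hr.2).trans (ih.rarr r hr.1)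
  | branchTrue _ _ ih =>
    constructor <;> intro r hr <;>
      simp only [Prog.writesN, Prog.writesR, Prog.storesN, Prog.storesR, Bool.or_eq_false_iff] at hr
    · exact ih.nreg r hr.1
    · exact ih.rreg r hr.1
    · exact ih.narr r hr.1
    · exact ih.rarr r hr.1
  | branchFalse _ _ ih =>
    constructor <;> intro r hr <;>
      simp only [Prog.writesN, Prog.writesR, Prog.storesN, Prog.storesR, Bool.or_eq_false_iff] at hr
    · exact ih.nreg r hr.2
    · exact ih.rreg r hr.2
    · exact ih.narr r hr.2
    · exact ih.rarr r hr.2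
  | loopDone _ => exact ⟨fun _ _ => rfl, fun _ _ => rfl, fun _ _ => rfl, fun _ _ => rfl⟩
  | loopStep _ _ _ ih ih' =>
    exact ⟨fun r hr => (ih'.nreg r hr).trans (ih.nreg r hr),
      fun r hr => (ih'.rreg r hr).trans (ih.rreg r hr),
      fun r hr => (ih'.narr r hr).trans (ih.narr r hr),
      fun r hr => (ih'.rarr r hr).trans (ih.rarr r hr)⟩

theorem Prog.frame_run (p : Prog) (hp : p.loopFree = true) (σ : State) : Frame p σ (p.run σ) := by
  obtain ⟨t, -, h⟩ := p.exec_run hp σ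
  exact h.frame

/-- Started in `σ`, the program `p` halts after at most `T` steps in a state satisfying `Q`. -/
def Runs (p : Prog) (σ : State) (T : ℕ) (Q : State → Prop) : Prop :=
  ∃ (σ' : State) (t : ℕ), Exec p σ σ' t ∧ t ≤ T ∧ Q σ'

theorem Runs.mono {p : Prog} {σ : State} {T T' : ℕ} {Q Q' : State → Prop} (h : Runs p σ T Q)
    (hT : T ≤ T') (hQ : ∀ σ', Frame p σ σ' → Q σ' → Q' σ') : Runs p σ T' Q' := by
  obtain ⟨σ', t, h, ht, hq⟩ := h
  exact ⟨σ', t, h, ht.trans hT, hQ σ' h.frame hq⟩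

/-- The second program also receives the frame of the first one, so postconditions need only
describe what changes. -/
theorem Runs.seq {p q : Prog} {σ : State} {T T' : ℕ} {Q Q' : State → Prop} (h : Runs p σ T Q)
    (h' : ∀ σ', Frame p σ σ' → Q σ' → Runs q σ' T' Q') : Runs (.seq p q) σ (T + T') Q' := by
  obtain ⟨σ', t, h, ht, hq⟩ := h
  obtain ⟨σ'', t', h'', ht', hq'⟩ := h' σ' h.frame hq
  exact ⟨σ'', _, h.seq h'', Nat.add_le_add ht ht', hq'⟩

theorem Runs.of_loopFree {p : Prog} {σ : State} {Q : State → Prop} (hp : p.loopFree = true)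
    (hQ : Q (p.run σ)) : Runs p σ p.size Q := by
  obtain ⟨t, ht, h⟩ := p.exec_run hp σ
  exact ⟨_, t, h, ht, hQ⟩

theorem Runs.branch {b : Test} {p q : Prog} {σ : State} {T : ℕ} {Q : State → Prop}
    (hp : b.holds σ → Runs p σ T Q) (hq : ¬ b.holds σ → Runs q σ T Q) :
    Runs (.branch b p q) σ (b.cost + T) Q := by
  by_cases hb : b.holds σ
  · obtain ⟨σ', t, h, ht, hQ⟩ := hp hb
    exact ⟨σ', _, .branchTrue hb h, by omega, hQ⟩
  · obtain ⟨σ', t, h, ht, hQ⟩ := hq hb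
    exact ⟨σ', _, .branchFalse hb h, by omega, hQ⟩

/-- Loop rule with a bounded potential that grows in every iteration. -/
theorem Runs.loop {b : Test} {p : Prog} {I : State → Prop} {φ : State → ℕ} {N T : ℕ}
    (hφ : ∀ σ, I σ → φ σ ≤ N)
    (hp : ∀ σ, I σ → b.holds σ → Runs p σ T (fun σ' => I σ' ∧ φ σ < φ σ')) {σ : State} (h : I σ) :
    Runs (.loop b p) σ ((N - φ σ) * (T + b.cost) + b.cost) (fun σ' => I σ' ∧ ¬ b.holds σ') := by
  generalize hm : N - φ σ = m
  induction m using Nat.strong_induction_on generalizing σ with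
  | _ m ih =>
    by_cases hb : b.holds σ
    · obtain ⟨σ', t, he, ht, hI, hlt⟩ := hp σ h hb
      have h1 := hφ σ h
      have h2 := hφ σ' hI
      obtain ⟨σ'', t', he', ht', hq⟩ := ih (N - φ σ') (by omega) hI rfl
      refine ⟨σ'', _, .loopStep hb he he', ?_, hq⟩
      -- The potential may grow by more than one in an iteration; `d` is the surplus.
      obtain ⟨d, hd⟩ : ∃ d, m = (N - φ σ') + 1 + d := ⟨m - (N - φ σ') - 1, by omega⟩
      rw [hd]
      nlinarith [Nat.zero_le (d * (T + b.cost))]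
    · exact ⟨σ, _, .loopDone hb, Nat.le_add_left _ _, h, hb⟩

/-- Loop rule for counting loops. -/
theorem Runs.for_loop {b : Test} {p : Prog} {I : ℕ → State → Prop} {N T : ℕ}
    (hb : ∀ k σ, k ≤ N → I k σ → (b.holds σ ↔ k < N))
    (hp : ∀ k σ, k < N → I k σ → Runs p σ T (I (k + 1))) {k : ℕ} {σ : State} (hk : k ≤ N)
    (h : I k σ) : Runs (.loop b p) σ ((N - k) * (T + b.cost) + b.cost) (I N) := by
  generalize hm : N - k = m
  induction m generalizing k σ with
  | zero =>
    have : k = N := by omega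
    subst this
    exact ⟨σ, _, .loopDone (by simp [hb k σ le_rfl h]), by simp, h⟩
  | succ m ih =>
    have hlt : k < N := by omega
    obtain ⟨σ', t, he, ht, hI⟩ := hp k σ hlt h
    obtain ⟨σ'', t', he', ht', hq⟩ := ih hlt hI (by omega)
    exact ⟨σ'', _, .loopStep ((hb k σ hk h).2 hlt) he he', by nlinarith, hq⟩

end RealRAM

namespace PathNetwork

/-! ### Positions, capacities and evacuation times -/

variable (P : PathNetwork)

theorem pos_succ (k : ℕ) : P.pos (k + 1) = P.pos k + P.len k := Finset.sum_range_succ _ _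

@[simp] theorem pos_zero : P.pos 0 = 0 := by simp [pos]

theorem pos_lt {a b : ℕ} (h : a < b) (hb : b ≤ P.n) : P.pos a < P.pos b := by
  induction b with
  | zero => omega
  | succ b ih =>
    have := P.len_pos b (by omega)
    rw [pos_succ]
    rcases Nat.lt_succ_iff_lt_or_eq.1 h with h | rfl
    · linarith [ih h (by omega)]
    · linarith

theorem pos_le {a b : ℕ} (h : a ≤ b) (hb : b ≤ P.n) : P.pos a ≤ P.pos b := by
  rcases h.lt_or_eq with h | rfl
  · exact (P.pos_lt h hb).le
  · rfl

theorem pos_lt_iff {a b : ℕ} (ha : a ≤ P.n) (hb : b ≤ P.n) : P.pos a < P.pos b ↔ a < b :=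
  ⟨fun h => by
    by_contra hab
    exact absurd (P.pos_le (not_lt.1 hab) ha) (not_le.2 h), fun h => P.pos_lt h hb⟩

theorem pos_le_iff {a b : ℕ} (ha : a ≤ P.n) (hb : b ≤ P.n) : P.pos a ≤ P.pos b ↔ a ≤ b := by
  rw [← not_lt, P.pos_lt_iff hb ha, not_lt]

/-- Dividing by a minimum means taking the maximum of the quotients, as the minimum over the finite
set of edges is attained. Without an edge the infimum would be the junk value 0, hence `hne`. -/
theorem div_minCap_le_iff {x x' w z : ℝ} (hw : 0 ≤ w)
    (hne : ∃ e < P.n, x < P.pos (e + 1) ∧ P.pos e < x') :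
    w / P.minCap x x' ≤ z ↔ ∀ e < P.n, x < P.pos (e + 1) → P.pos e < x' → w / P.cap e ≤ z := by
  set S := {t | t < P.n ∧ x < P.pos (t + 1) ∧ P.pos t < x'} with hS
  have hfin : (P.cap '' S).Finite :=
    ((Set.finite_lt_nat P.n).subset fun t ht => ht.1).image _
  have hSne : (P.cap '' S).Nonempty := by
    obtain ⟨e, he, h⟩ := hne
    exact ⟨_, e, ⟨he, h⟩, rfl⟩
  obtain ⟨e₀, he₀, h₀⟩ := hSne.csInf_mem hfin
  have hcap : P.minCap x x' = P.cap e₀ := h₀.symm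
  rw [hcap]
  constructor
  · intro h e he h1 h2
    have hle : P.cap e₀ ≤ P.cap e := by
      rw [h₀]
      exact csInf_le hfin.bddBelow ⟨e, ⟨he, h1, h2⟩, rfl⟩
    exact (div_le_div_of_nonneg_left hw (P.cap_pos _ he₀.1) hle).trans h
  · intro h
    exact h e₀ he₀.1 he₀.2.1 he₀.2.2

variable {P} {s : ℕ → ℝ}

theorem weight_nonneg (hs : ∀ t ≤ P.n, 0 ≤ s t) {a b : ℕ} (hb : b ≤ P.n) :
    0 ≤ weight s a b :=
  Finset.sum_nonneg fun t ht => hs t ((Finset.mem_Icc.1 ht).2.trans hb)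

/-- The edges between x_t and x are the e ≥ t with x_e < x. The bound splits into one inequality per
edge, in which x is separated from a quantity that depends on t and e only. -/
theorem g_le_iff {t : ℕ} {x z : ℝ} (hW : 0 < weight s 0 t) (htx : P.pos t < x)
    (hx : x ≤ P.pos P.n) (ht : t ≤ P.n) :
    P.g s t x ≤ z ↔ ∀ e < P.n, t ≤ e → P.pos e < x →
      x + (-P.pos t + weight s 0 t / P.cap e) ≤ z := by
  have htn : t < P.n := (P.pos_lt_iff ht le_rfl).1 (htx.trans_le hx)
  have hg : P.g s t x = (x - P.pos t) + weight s 0 t / P.minCap (P.pos t) x := by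
    rw [g, if_pos ⟨hW, htx⟩]
  have hne : ∃ e < P.n, P.pos t < P.pos (e + 1) ∧ P.pos e < x :=
    ⟨t, htn, P.pos_lt (Nat.lt_succ_self t) htn, htx⟩
  have : P.g s t x ≤ z ↔ weight s 0 t / P.minCap (P.pos t) x ≤ z - (x - P.pos t) := by
    rw [hg]; constructor <;> intro h <;> linarith
  rw [this, P.div_minCap_le_iff hW.le hne]
  constructor
  · intro h e he hte hex
    linarith [h e he (P.pos_lt (Nat.lt_succ_of_le hte) he) hex]
  · intro h e he hte hex
    linarith [h e he (Nat.lt_succ_iff.1 ((P.pos_lt_iff ht he).1 hte)) hex]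

theorem g_nonneg {t : ℕ} {x : ℝ} (hx : x ≤ P.pos P.n) (ht : t ≤ P.n) : 0 ≤ P.g s t x := by
  by_cases h : 0 < weight s 0 t ∧ P.pos t < x
  · have htn : t < P.n := (P.pos_lt_iff ht le_rfl).1 (h.2.trans_le hx)
    have := (g_le_iff h.1 h.2 hx ht).1 le_rfl t htn le_rfl h.2
    have h2 : 0 ≤ weight s 0 t / P.cap t := div_nonneg h.1.le (P.cap_pos _ htn).le
    linarith [h.2]
  · rw [g, if_neg h]

/-- The supremum of finitely many values of `g`. -/
theorem sSup_g_le_iff {S : Set ℕ} {x z : ℝ} (hx : x ≤ P.pos P.n)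
    (hS : ∀ t ∈ S, t ≤ P.n) :
    sSup ((fun t => P.g s t x) '' S) ≤ z ∧ 0 ≤ z ↔
      0 ≤ z ∧ ∀ e < P.n, P.pos e < x → ∀ t ≤ e, t ∈ S → 0 < weight s 0 t →
        x + (-P.pos t + weight s 0 t / P.cap e) ≤ z := by
  have hfin : ((fun t => P.g s t x) '' S).Finite :=
    ((Set.finite_le_nat P.n).subset hS).image _
  -- An empty supremum is 0 and vertices of zero weight contribute 0, so `0 ≤ z` has to be carried
  -- along.
  have h1 : sSup ((fun t => P.g s t x) '' S) ≤ z ∧ 0 ≤ z ↔ 0 ≤ z ∧ ∀ t ∈ S, P.g s t x ≤ z := by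
    rw [and_comm]
    refine and_congr_right fun hz => ⟨fun h t ht => ?_, fun h => ?_⟩
    · exact (le_csSup hfin.bddAbove ⟨t, ht, rfl⟩).trans h
    · exact Real.sSup_le (by rintro _ ⟨t, ht, rfl⟩; exact h t ht) hz
  rw [h1]
  refine and_congr_right fun hz => ⟨fun h e he hex t hte htS hW => ?_, fun h t htS => ?_⟩
  · exact (g_le_iff hW ((P.pos_le hte he.le).trans_lt hex) hx (hS t htS)).1 (h t htS) e he hte hex
  · by_cases hc : 0 < weight s 0 t ∧ P.pos t < x
    · exact (g_le_iff hc.1 hc.2 hx (hS t htS)).2 fun e he hte hex => h e he hex t hte htS hc.1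
    · rw [g, if_neg hc]; exact hz

theorem sSup_g_nonneg {S : Set ℕ} {x : ℝ} (hx : x ≤ P.pos P.n)
    (hS : ∀ t ∈ S, t ≤ P.n) : 0 ≤ sSup ((fun t => P.g s t x) '' S) :=
  Real.sSup_nonneg (by rintro _ ⟨t, ht, rfl⟩; exact g_nonneg hx (hS t ht))

/-! ### Reversal -/

/-- The same path read from the other end. -/
def rev (P : PathNetwork) : PathNetwork where
  n := P.n
  len k := P.len (P.n - 1 - k)
  cap k := P.cap (P.n - 1 - k)
  wmin k := P.wmin (P.n - k)
  wmax k := P.wmax (P.n - k)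
  len_pos k hk := P.len_pos _ (by omega)
  cap_pos k hk := P.cap_pos _ (by omega)
  wmin_nonneg k hk := P.wmin_nonneg _ (by omega)
  wmin_le_wmax k hk := P.wmin_le_wmax _ (by omega)

/-- A scenario read from the other end. -/
def revScenario (P : PathNetwork) (s : ℕ → ℝ) : ℕ → ℝ := fun t => s (P.n - t)

@[simp] theorem rev_n : P.rev.n = P.n := rfl

theorem pos_rev {k : ℕ} (hk : k ≤ P.n) : P.rev.pos k = P.pos P.n - P.pos (P.n - k) := by
  induction k with
  | zero => simp
  | succ k ih =>
    rw [pos_succ, ih (by omega)]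
    have h : P.n - k = (P.n - (k + 1)) + 1 := by omega
    rw [h, pos_succ]
    have : P.rev.len k = P.len (P.n - (k + 1)) := by
      simp only [rev]; congr 1; omega
    rw [this]; ring

theorem pos_rev_n : P.rev.pos P.n = P.pos P.n := by simp [pos_rev]

/-- Edge e becomes edge n - 1 - e, and the two strict inequalities that select the edges change
roles. -/
theorem minCap_rev {a b : ℝ} :
    P.rev.minCap (P.pos P.n - b) (P.pos P.n - a) = P.minCap a b := by
  unfold minCap
  congr 1
  ext c
  simp only [Set.mem_image, Set.mem_ofPred_eq, rev_n]
  constructor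
  · rintro ⟨e, ⟨he, h1, h2⟩, rfl⟩
    rw [pos_rev (by omega)] at h1 h2
    refine ⟨P.n - 1 - e, ⟨by omega, ?_, ?_⟩, rfl⟩
    · have : P.n - 1 - e + 1 = P.n - e := by omega
      rw [this]; linarith
    · have : P.n - 1 - e = P.n - (e + 1) := by omega
      rw [this]; linarith
  · rintro ⟨e, ⟨he, h1, h2⟩, rfl⟩
    refine ⟨P.n - 1 - e, ⟨by omega, ?_, ?_⟩, ?_⟩
    · rw [pos_rev (by omega)]
      have : P.n - (P.n - 1 - e + 1) = e := by omega
      rw [this]; linarith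
    · rw [pos_rev (by omega)]
      have : P.n - (P.n - 1 - e) = e + 1 := by omega
      rw [this]; linarith
    · simp only [rev]; congr 1; omega

theorem weight_revScenario {a b : ℕ} (ha : a ≤ P.n) (hb : b ≤ P.n) :
    weight (P.revScenario s) a b = weight s (P.n - b) (P.n - a) := by
  unfold weight revScenario
  refine Finset.sum_bij' (fun t _ => P.n - t) (fun t _ => P.n - t) ?_ ?_ ?_ ?_ ?_ <;>
    intro t ht <;> simp only [Finset.mem_Icc] at * <;> omega

/-- Reversal turns `h` into `g`, so the right side needs no theory of its own. -/
theorem g_rev {t : ℕ} {x : ℝ} (ht : t ≤ P.n) :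
    P.rev.g (P.revScenario s) t (P.pos P.n - x) = P.h s (P.n - t) x := by
  have h1 : weight (P.revScenario s) 0 t = weight s (P.n - t) P.n :=
    weight_revScenario (Nat.zero_le _) ht
  have h2 : P.pos P.n - P.pos (P.n - t) < P.pos P.n - x ↔ x < P.pos (P.n - t) := by
    constructor <;> intro h <;> linarith
  rw [g, h, h1, pos_rev ht, minCap_rev]
  simp only [h2]
  congr 2
  ring

theorem h_rev {t : ℕ} {x : ℝ} (ht : t ≤ P.n) :
    P.rev.h (P.revScenario s) t (P.pos P.n - x) = P.g s (P.n - t) x := by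
  have h1 : weight (P.revScenario s) t P.n = weight s 0 (P.n - t) := by
    rw [weight_revScenario ht le_rfl, Nat.sub_self]
  have h2 : P.pos P.n - x < P.pos P.n - P.pos (P.n - t) ↔ P.pos (P.n - t) < x := by
    constructor <;> intro h <;> linarith
  rw [g, h, rev_n, h1, pos_rev ht, minCap_rev]
  simp only [h2]
  congr 2
  ring

theorem image_rev {f f' : ℕ → ℝ} {p p' : ℕ → Prop} {n : ℕ}
    (hf : ∀ t ≤ n, f t = f' (n - t)) (hp : ∀ t ≤ n, p t ↔ p' (n - t)) :
    f '' {t | t ≤ n ∧ p t} = f' '' {t | t ≤ n ∧ p' t} := by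
  ext v
  constructor
  · rintro ⟨t, ⟨ht, h⟩, rfl⟩
    exact ⟨n - t, ⟨by omega, (hp t ht).1 h⟩, (hf t ht).symm⟩
  · rintro ⟨t, ⟨ht, h⟩, rfl⟩
    have e : n - (n - t) = t := by omega
    refine ⟨n - t, ⟨by omega, (hp _ (by omega)).2 (by simpa [e] using h)⟩, ?_⟩
    simpa [e] using hf (n - t) (by omega)

theorem evacLeft_rev (x : ℝ) :
    P.rev.evacLeft (P.revScenario s) (P.pos P.n - x) = P.evacRight s x := by
  unfold evacLeft evacRight
  congr 1
  refine image_rev (n := P.n) (fun t ht => g_rev ht) fun t ht => ?_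
  rw [pos_rev ht]
  constructor <;> intro h <;> linarith

theorem evacRight_rev (x : ℝ) :
    P.rev.evacRight (P.revScenario s) (P.pos P.n - x) = P.evacLeft s x := by
  unfold evacLeft evacRight
  congr 1
  refine image_rev (n := P.n) (fun t ht => h_rev ht) fun t ht => ?_
  rw [pos_rev ht]
  constructor <;> intro h <;> linarith

theorem evac_rev (x : ℝ) :
    P.rev.evac (P.revScenario s) (P.pos P.n - x) = P.evac s x := by
  rw [evac, evac, evacLeft_rev, evacRight_rev, max_comm]

theorem minEvac_rev (a b : ℝ) :
    P.rev.minEvac (P.revScenario s) (P.pos P.n - b) (P.pos P.n - a) = P.minEvac s a b := by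
  unfold minEvac
  congr 1
  ext v
  constructor
  · rintro ⟨y, ⟨h1, h2⟩, rfl⟩
    refine ⟨P.pos P.n - y, ⟨by linarith, by linarith⟩, ?_⟩
    have := P.evac_rev (s := s) (P.pos P.n - y)
    simpa using this.symm
  · rintro ⟨y, ⟨h1, h2⟩, rfl⟩
    exact ⟨P.pos P.n - y, ⟨by linarith, by linarith⟩, P.evac_rev y⟩

theorem image_revScenario {f f' : (ℕ → ℝ) → ℝ} {S S' : Set (ℕ → ℝ)}
    (hS : ∀ s ∈ S, ∃ s' ∈ S', f s = f' s') (hS' : ∀ s' ∈ S', ∃ s ∈ S, f s = f' s') :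
    f '' S = f' '' S' := by
  ext v
  constructor
  · rintro ⟨s, hs, rfl⟩
    obtain ⟨s', h, e⟩ := hS s hs
    exact ⟨s', h, e.symm⟩
  · rintro ⟨s, hs, rfl⟩
    obtain ⟨s', h, e⟩ := hS' s hs
    exact ⟨s', h, e⟩

end PathNetwork

/-! ### The envelope functions -/

/-- Data of a family of upper envelopes: positions `x` and weights `W` of the vertices, edge
capacities `c`; the vertices from `i` on carry the additional weight `α`; only the vertices
between `lo` and `hi` count, and of these the ones with positive weight, where the vertices from
`i` on count in any case if `1 ≤ f`. -/
structure Envelope where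
  n : ℕ
  x : ℕ → ℝ
  c : ℕ → ℝ
  W : ℕ → ℝ
  i : ℕ
  lo : ℕ
  hi : ℕ
  f : ℕ

namespace Envelope

variable (B : Envelope)

/-- The vertex `t` counts. -/
def Act (t : ℕ) : Prop := B.lo ≤ t ∧ t ≤ B.hi ∧ (0 < B.W t ∨ (1 ≤ B.f ∧ B.i ≤ t))

open Classical in
/-- Contribution to edge `e` of the vertices before `min T i`. -/
noncomputable def level (e : ℕ) : ℕ → ℝ
  | 0 => -B.x B.n
  | T + 1 => if B.Act T ∧ T < B.i then max (level e T) (-B.x T + B.W T / B.c e) else level e T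

open Classical in
/-- Contribution to edge `e` of the vertices from `i` on and before `T`, for `α = 0`. -/
noncomputable def intercept (e : ℕ) : ℕ → ℝ
  | 0 => -B.x B.n
  | T + 1 => if B.Act T ∧ B.i ≤ T then max (intercept e T) (-B.x T + B.W T / B.c e)
      else intercept e T

open Classical in
/-- Rate at which `α` contributes to edge `e`. -/
noncomputable def slope (e : ℕ) : ℕ → ℝ
  | 0 => 0
  | T + 1 => if B.Act T ∧ B.i ≤ T then 1 / B.c e else slope e T

/-- The upper envelope of the lines belonging to the edges before `m`. -/
noncomputable def env : ℕ → ℝ → ℝ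
  | 0, _ => -B.x B.n
  | m + 1, α => max (max (env m α) (0 * α + B.level m (m + 1)))
      (B.slope m (m + 1) * α + B.intercept m (m + 1))

/-- The additional weight at `t`. -/
noncomputable def shift (α : ℝ) (t : ℕ) : ℝ := if B.i ≤ t then α else 0

/-- Conditions on the data. -/
structure Good : Prop where
  c_pos : ∀ e < B.n, 0 < B.c e
  x_mono : ∀ a b, a ≤ b → b ≤ B.n → B.x a ≤ B.x b
  W_nonneg : ∀ t ≤ B.n, 0 ≤ B.W t

variable {B}

/-- The start value -x_n replaces -∞. It is harmless because y - x_n ≤ 0 at every location y of the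
path, where it is absorbed by the maximum with 0. -/
theorem level_le_iff {e T : ℕ} {z : ℝ} : B.level e T ≤ z ↔
    -B.x B.n ≤ z ∧ ∀ t < T, B.Act t → t < B.i → -B.x t + B.W t / B.c e ≤ z := by
  induction T with
  | zero => simp [level]
  | succ T ih =>
    rw [level]
    have aux : (∀ t < T + 1, B.Act t → t < B.i → -B.x t + B.W t / B.c e ≤ z) ↔
        (∀ t < T, B.Act t → t < B.i → -B.x t + B.W t / B.c e ≤ z) ∧
          (B.Act T ∧ T < B.i → -B.x T + B.W T / B.c e ≤ z) := by
      constructor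
      · exact fun h => ⟨fun t ht => h t (by omega), fun h' => h T (by omega) h'.1 h'.2⟩
      · rintro ⟨h1, h2⟩ t ht ha hi
        rcases Nat.lt_succ_iff_lt_or_eq.1 ht with ht | rfl
        · exact h1 t ht ha hi
        · exact h2 ⟨ha, hi⟩
    rw [aux]
    split_ifs with h
    · rw [max_le_iff, ih]; tauto
    · rw [ih]; tauto

/-- The vertices from `i` on contribute lines of equal slope 1/c_e, so their maximum is one line and
only the largest intercept matters. The first conjunct is the invariant of the induction. When the
first such vertex T counts, the slope jumps from 0 to 1/c_e while the old intercept -x_n stays in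
the maximum; this changes nothing, as -x_n ≤ -x_T + W_T/c_e. -/
theorem slope_intercept (hB : B.Good) {e T : ℕ} (he : e < B.n) (hT : T ≤ B.n + 1) :
    (B.slope e T = 1 / B.c e ∨ B.slope e T = 0 ∧ B.intercept e T = -B.x B.n) ∧
    ∀ z α, -B.x B.n ≤ z → (B.slope e T * α + B.intercept e T ≤ z ↔
      ∀ t < T, B.Act t → B.i ≤ t → -B.x t + (B.W t + α) / B.c e ≤ z) := by
  induction T with
  | zero =>
    refine ⟨Or.inr ⟨rfl, rfl⟩, fun z α hz => ?_⟩
    simp [slope, intercept, hz]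
  | succ T ih =>
    obtain ⟨h1, h2⟩ := ih (by omega)
    have aux : ∀ z α, (∀ t < T + 1, B.Act t → B.i ≤ t → -B.x t + (B.W t + α) / B.c e ≤ z) ↔
        (∀ t < T, B.Act t → B.i ≤ t → -B.x t + (B.W t + α) / B.c e ≤ z) ∧
          (B.Act T ∧ B.i ≤ T → -B.x T + (B.W T + α) / B.c e ≤ z) := by
      intro z α
      constructor
      · exact fun h => ⟨fun t ht => h t (by omega), fun h' => h T (by omega) h'.1 h'.2⟩
      · rintro ⟨h1, h2⟩ t ht ha hi
        rcases Nat.lt_succ_iff_lt_or_eq.1 ht with ht | rfl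
        · exact h1 t ht ha hi
        · exact h2 ⟨ha, hi⟩
    have hc := hB.c_pos e he
    have hW : 0 ≤ B.W T / B.c e := div_nonneg (hB.W_nonneg T (by omega)) hc.le
    have hx := hB.x_mono T B.n (by omega) le_rfl
    rw [slope, intercept]
    by_cases h : B.Act T ∧ B.i ≤ T
    · simp only [if_pos h]
      refine ⟨by simp, fun z α hz => ?_⟩
      rw [aux, ← h2 z α hz]
      have e1 : -B.x T + (B.W T + α) / B.c e = 1 / B.c e * α + (-B.x T + B.W T / B.c e) := by
        ring
      rw [e1, ← max_add_add_left, max_le_iff]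
      rcases h1 with h1 | ⟨h1, h1'⟩
      · rw [h1]; tauto
      · rw [h1, h1']
        constructor
        · rintro ⟨_, h⟩; exact ⟨by simpa using hz, fun _ => h⟩
        · rintro ⟨_, h'⟩
          have := h' h
          exact ⟨by linarith, this⟩
    · simp only [if_neg h]
      refine ⟨h1, fun z α hz => ?_⟩
      rw [aux, h2 z α hz]; tauto

theorem slope_nonneg (hB : B.Good) {e T : ℕ} (he : e < B.n) (hT : T ≤ B.n + 1) :
    0 ≤ B.slope e T := by
  rcases (slope_intercept hB he hT).1 with h | h
  · rw [h]; exact one_div_nonneg.2 (hB.c_pos e he).le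
  · rw [h.1]

/-- Upper bounds of the envelope take the same form, edge by edge and vertex by vertex, as in
`sSup_g_le_iff`, so that the two can be matched term by term. -/
theorem env_le_iff (hB : B.Good) {m : ℕ} (hm : m ≤ B.n) {α z : ℝ} : B.env m α ≤ z ↔
    -B.x B.n ≤ z ∧ ∀ e < m, ∀ t ≤ e, B.Act t →
      -B.x t + (B.W t + B.shift α t) / B.c e ≤ z := by
  induction m with
  | zero => simp [env]
  | succ m ih =>
    rw [env, max_le_iff, max_le_iff, ih (by omega), zero_mul, zero_add, level_le_iff]
    constructor
    · rintro ⟨⟨⟨hz, h1⟩, -, h2⟩, h3⟩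
      refine ⟨hz, fun e he t hte ha => ?_⟩
      rcases Nat.lt_succ_iff_lt_or_eq.1 he with he | rfl
      · exact h1 e he t hte ha
      · by_cases hi : B.i ≤ t
        · rw [shift, if_pos hi]
          exact ((slope_intercept hB (by omega) (by omega)).2 z α hz).1 h3 t (by omega) ha hi
        · rw [shift, if_neg hi, add_zero]
          exact h2 t (by omega) ha (not_le.1 hi)
    · rintro ⟨hz, h⟩
      refine ⟨⟨⟨hz, fun e he => h e (by omega)⟩, hz, fun t ht ha hi => ?_⟩, ?_⟩
      · have := h m (by omega) t (by omega) ha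
        rwa [shift, if_neg (not_le.2 hi), add_zero] at this
      · refine ((slope_intercept hB (by omega) (by omega)).2 z α hz).2 fun t ht ha hi => ?_
        have := h m (by omega) t (by omega) ha
        rwa [shift, if_pos hi] at this

theorem env_ge (hB : B.Good) {m : ℕ} (hm : m ≤ B.n) (α : ℝ) : -B.x B.n ≤ B.env m α :=
  ((env_le_iff hB hm).1 le_rfl).1

theorem env_mono_left {m m' : ℕ} (h : m ≤ m') (α : ℝ) : B.env m α ≤ B.env m' α := by
  induction m', h using Nat.le_induction with
  | base => exact le_rfl
  | succ m' _ ih => rw [env]; exact ih.trans ((le_max_left _ _).trans (le_max_left _ _))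

theorem env_monotone (hB : B.Good) {m : ℕ} (hm : m ≤ B.n) : Monotone (B.env m) := by
  induction m with
  | zero => exact fun _ _ _ => le_rfl
  | succ m ih =>
    intro α β h
    have := slope_nonneg hB (e := m) (T := m + 1) (by omega) (by omega)
    simp only [env, zero_mul]
    gcongr
    exact ih (by omega) h

theorem convexOn_line (a b : ℝ) : ConvexOn ℝ Set.univ fun α : ℝ => a * α + b := by
  refine ⟨convex_univ, fun x _ y _ p q _ _ h => ?_⟩
  simp only [smul_eq_mul]
  have : q = 1 - p := by linarith
  subst this
  exact le_of_eq (by ring)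

theorem env_convex (m : ℕ) : ConvexOn ℝ Set.univ (B.env m) := by
  induction m with
  | zero => exact convexOn_const _ convex_univ
  | succ m ih => exact (ih.sup (convexOn_line 0 _)).sup (convexOn_line _ _)

theorem env_continuous (m : ℕ) : Continuous (B.env m) := by
  induction m with
  | zero => exact continuous_const
  | succ m ih => simp only [env]; fun_prop

/-- Every value of the envelope is attained by a supporting line of nonnegative slope. -/
theorem env_support (hB : B.Good) {m : ℕ} (hm : m ≤ B.n) (α₀ : ℝ) :
    ∃ a b : ℝ, 0 ≤ a ∧ (∀ α, a * α + b ≤ B.env m α) ∧ a * α₀ + b = B.env m α₀ := by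
  induction m with
  | zero => exact ⟨0, -B.x B.n, le_rfl, fun α => by simp [env], by simp [env]⟩
  | succ m ih =>
    obtain ⟨a, b, ha, h1, h2⟩ := ih (by omega)
    have hs := slope_nonneg hB (e := m) (T := m + 1) (by omega) (by omega)
    rw [env]
    rcases max_choice (max (B.env m α₀) (0 * α₀ + B.level m (m + 1)))
      (B.slope m (m + 1) * α₀ + B.intercept m (m + 1)) with h | h
    · rw [h]
      rcases max_choice (B.env m α₀) (0 * α₀ + B.level m (m + 1)) with h' | h'
      · rw [h']
        exact ⟨a, b, ha, fun α => (h1 α).trans ((le_max_left _ _).trans (le_max_left _ _)), h2⟩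
      · rw [h']
        exact ⟨0, _, le_rfl, fun α => (le_max_right _ _).trans (le_max_left _ _), rfl⟩
    · rw [h]
      exact ⟨_, _, hs, fun α => le_max_right _ _, rfl⟩

/-- Either no vertex counts, or the envelope is not too low. -/
theorem env_dichotomy (hB : B.Good) {m : ℕ} (hm : m ≤ B.n) :
    (∀ α, B.env m α = -B.x B.n) ∨
      ∃ k < m, ∀ α, 0 ≤ α → 0 ≤ B.x k + B.env m α := by
  -- A single counting vertex t ≤ e already forces the envelope above -x_t ≥ -x_e, so k = e works.
  by_cases h : ∃ e < m, ∃ t ≤ e, B.Act t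
  · obtain ⟨e, he, t, hte, ha⟩ := h
    refine Or.inr ⟨e, he, fun α hα => ?_⟩
    have h1 := ((env_le_iff hB hm).1 (le_refl (B.env m α))).2 e he t hte ha
    have h2 : 0 ≤ (B.W t + B.shift α t) / B.c e := by
      refine div_nonneg (add_nonneg (hB.W_nonneg t (by omega)) ?_) (hB.c_pos e (by omega)).le
      rw [shift]; split_ifs <;> simp [hα]
    have h3 := hB.x_mono t e hte (by omega)
    linarith
  · push Not at h
    refine Or.inl fun α => le_antisymm ((env_le_iff hB hm).2 ⟨le_rfl, ?_⟩) (env_ge hB hm α)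
    intro e he t hte ha
    exact absurd ha (h e he t hte)

end Envelope

/-! ### Piecewise linear functions given by points -/

/-- The points `(X k, Y k)` with `b ≤ k < b + N` interpolate `f` on `[0, D]`. -/
structure PointList (X Y : ℕ → ℝ) (b N : ℕ) (f : ℝ → ℝ) (D : ℝ) : Prop where
  pos : 0 < N
  first : X b = 0
  last : X (b + (N - 1)) = D
  step : ∀ a, a + 1 < N → X (b + a) < X (b + a + 1)
  val : ∀ a < N, Y (b + a) = f (X (b + a))
  aff : ∀ a, a + 1 < N → ∀ z, X (b + a) ≤ z → z ≤ X (b + a + 1) →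
    (X (b + a + 1) - X (b + a)) * f z =
      (X (b + a + 1) - z) * f (X (b + a)) + (z - X (b + a)) * f (X (b + a + 1))

/-- Slope of the segment after point `k`. -/
noncomputable def segSlope (X Y : ℕ → ℝ) (k : ℕ) : ℝ := (Y (k + 1) - Y k) / (X (k + 1) - X k)

namespace PointList

variable {X Y X' Y' : ℕ → ℝ} {b N : ℕ} {f : ℝ → ℝ} {D : ℝ}

/-- Only entries below `b + N` matter, so a list survives whatever is written behind it. -/
theorem congr (h : PointList X Y b N f D) (hX : ∀ k < b + N, X' k = X k)
    (hY : ∀ k < b + N, Y' k = Y k) : PointList X' Y' b N f D := by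
  have hp := h.pos
  have e0 : X' b = X b := hX b (by omega)
  refine ⟨hp, by rw [e0, h.first], by rw [hX _ (by omega), h.last], ?_, ?_, ?_⟩
  · intro a ha
    rw [hX _ (by omega), hX _ (by omega)]; exact h.step a ha
  · intro a ha
    rw [hX _ (by omega), hY _ (by omega)]; exact h.val a ha
  · intro a ha
    rw [hX (b + a) (by omega), hX (b + a + 1) (by omega)]; exact h.aff a ha

theorem strictMono (h : PointList X Y b N f D) {a a' : ℕ} (haa : a < a') (ha : a' < N) :
    X (b + a) < X (b + a') := by
  induction a', haa using Nat.le_induction with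
  | base => exact h.step a ha
  | succ m hm ih => exact (ih (by omega)).trans (h.step m ha)

theorem mono (h : PointList X Y b N f D) {a a' : ℕ} (haa : a ≤ a') (ha : a' < N) :
    X (b + a) ≤ X (b + a') := by
  rcases haa.lt_or_eq with h' | rfl
  · exact (h.strictMono h' ha).le
  · rfl

theorem mem (h : PointList X Y b N f D) {a : ℕ} (ha : a < N) : X (b + a) ∈ Set.Icc 0 D := by
  refine ⟨?_, ?_⟩
  · have := h.mono (Nat.zero_le a) ha
    rwa [Nat.add_zero, h.first] at this
  · rw [← h.last]; exact h.mono (by omega) (by omega)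

theorem nonneg (h : PointList X Y b N f D) : 0 ≤ D := (h.mem h.pos).1.trans (h.mem h.pos).2

/-- If z lay in no segment, induction would put every point to the left of z. The first alternative
covers lists with a single point, which have no segment. -/
theorem locate (h : PointList X Y b N f D) {z : ℝ} (hz : z ∈ Set.Icc 0 D) :
    z = X (b + (N - 1)) ∨ ∃ a, a + 1 < N ∧ X (b + a) ≤ z ∧ z ≤ X (b + a + 1) := by
  by_contra hcon
  push Not at hcon
  have key : ∀ a < N, X (b + a) ≤ z := by
    intro a
    induction a with
    | zero => intro _; rw [Nat.add_zero, h.first]; exact hz.1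
    | succ a ih => intro ha; exact (hcon.2 a ha (ih (by omega))).le
  have := key (N - 1) (by have := h.pos; omega)
  refine hcon.1 (le_antisymm ?_ this)
  rw [h.last]; exact hz.2

/-- On a segment the function is affine. -/
theorem segment (h : PointList X Y b N f D) {a : ℕ} (ha : a + 1 < N) :
    ∀ z z', X (b + a) ≤ z → z ≤ X (b + a + 1) → X (b + a) ≤ z' → z' ≤ X (b + a + 1) →
      f z' = f z + segSlope X Y (b + a) * (z' - z) := by
  intro z z' h1 h2 h3 h4
  have hs := h.step a ha
  have e1 := h.aff a ha z h1 h2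
  have e2 := h.aff a ha z' h3 h4
  have hd : X (b + a + 1) - X (b + a) ≠ 0 := by linarith
  rw [segSlope, h.val a (by omega), show b + a + 1 = b + (a + 1) from rfl, h.val (a + 1) ha]
  simp only [← Nat.add_assoc]
  apply mul_left_cancel₀ hd
  rw [mul_add, e1, e2]
  field_simp
  ring

theorem segSlope_nonneg (h : PointList X Y b N f D) (hf : Monotone f) {a : ℕ} (ha : a + 1 < N) :
    0 ≤ segSlope X Y (b + a) := by
  have hs := h.step a ha
  rw [segSlope, h.val a (by omega), show b + a + 1 = b + (a + 1) from rfl, h.val (a + 1) ha]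
  exact div_nonneg (sub_nonneg.2 (hf hs.le)) (sub_nonneg.2 hs.le)

theorem segSlope_step (h : PointList X Y b N f D) (hf : ConvexOn ℝ Set.univ f) {a : ℕ}
    (ha : a + 2 < N) : segSlope X Y (b + a) ≤ segSlope X Y (b + (a + 1)) := by
  have h1 := h.step a (by omega)
  have h2 := h.step (a + 1) ha
  have := hf.slope_mono_adjacent (Set.mem_univ _) (Set.mem_univ _) h1 h2
  rw [segSlope, segSlope, h.val a (by omega), show b + a + 1 = b + (a + 1) from rfl,
    h.val (a + 1) (by omega), show b + (a + 1) + 1 = b + (a + 2) from rfl,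
    h.val (a + 2) ha]
  exact this

theorem segSlope_mono (h : PointList X Y b N f D) (hf : ConvexOn ℝ Set.univ f) {a a' : ℕ}
    (haa : a ≤ a') (ha : a' + 1 < N) : segSlope X Y (b + a) ≤ segSlope X Y (b + a') := by
  induction a', haa using Nat.le_induction with
  | base => rfl
  | succ m hm ih => exact (ih (by omega)).trans (h.segSlope_step hf ha)

/-- The maximum of `μ z - f z` is attained at the first point followed by a slope `≥ μ`. -/
theorem exists_argmax (h : PointList X Y b N f D) (hf : ConvexOn ℝ Set.univ f) (μ : ℝ) :
    ∃ a < N, (∀ a' < a, segSlope X Y (b + a') < μ) ∧ (a + 1 < N → μ ≤ segSlope X Y (b + a)) ∧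
      ∀ z ∈ Set.Icc 0 D, μ * z - f z ≤ μ * X (b + a) - f (X (b + a)) := by
  classical
  -- The guard `a + 1 < N` lets the search end at the last point when all slopes are below μ.
  have hex : ∃ a, a + 1 < N → μ ≤ segSlope X Y (b + a) := ⟨N, by omega⟩
  set a := Nat.find hex with ha
  have hp := h.pos
  have haN : a < N := by
    have : a ≤ N - 1 := Nat.find_min' hex (by omega)
    omega
  have hlt : ∀ a' < a, segSlope X Y (b + a') < μ := by
    intro a' ha'
    have := Nat.find_min hex ha'
    push Not at this
    exact this.2
  have hge : a + 1 < N → μ ≤ segSlope X Y (b + a) := Nat.find_spec hex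
  have step : ∀ c, c + 1 < N → f (X (b + (c + 1))) =
      f (X (b + c)) + segSlope X Y (b + c) * (X (b + (c + 1)) - X (b + c)) := fun c hc =>
    h.segment hc _ _ le_rfl (h.step c hc).le (h.step c hc).le le_rfl
  -- Before `a` the slopes are below μ and the function μz - f z increases; from `a` on, convexity
  -- keeps them at least μ and it does not increase.
  have up : ∀ d c, c + d = a → μ * X (b + c) - f (X (b + c)) ≤ μ * X (b + a) - f (X (b + a)) := by
    intro d
    induction d with
    | zero => rintro c rfl; exact le_rfl
    | succ d ih =>
      intro c hc
      have h1 := ih (c + 1) (by omega)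
      have h2 := step c (by omega)
      have h3 := hlt c (by omega)
      have h4 := h.step c (by omega)
      rw [← Nat.add_assoc] at h1 h2
      nlinarith
  have down : ∀ c, a ≤ c → c < N →
      μ * X (b + c) - f (X (b + c)) ≤ μ * X (b + a) - f (X (b + a)) := by
    intro c hc
    induction c, hc using Nat.le_induction with
    | base => exact fun _ => le_rfl
    | succ c hc ih =>
      intro hcN
      have h1 := ih (by omega)
      have h2 := step c hcN
      have h3 := (hge (by omega)).trans (h.segSlope_mono hf hc hcN)
      have h4 := h.step c hcN
      rw [← Nat.add_assoc] at h2 ⊢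
      nlinarith
  have pts : ∀ c < N, μ * X (b + c) - f (X (b + c)) ≤ μ * X (b + a) - f (X (b + a)) := by
    intro c hc
    rcases le_total a c with hac | hac
    · exact down c hac hc
    · exact up (a - c) c (by omega)
  refine ⟨a, haN, hlt, hge, fun z hz => ?_⟩
  rcases h.locate hz with rfl | ⟨c, hc, h1, h2⟩
  · exact pts _ (by omega)
  · have p1 := pts c (by omega)
    have p2 := pts (c + 1) hc
    have hs := h.step c hc
    have e := h.aff c hc z h1 h2
    rw [← Nat.add_assoc] at p2
    have hd : 0 < X (b + c + 1) - X (b + c) := by linarith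
    refine le_of_mul_le_mul_left ?_ hd
    have q1 := mul_le_mul_of_nonneg_left p1 (sub_nonneg.2 h2)
    have q2 := mul_le_mul_of_nonneg_left p2 (sub_nonneg.2 h1)
    nlinarith

end PointList

/-! ### Candidates suffice -/

/-- Moving until the border of a box is hit. -/
theorem exists_exit {α β x z d e : ℝ} (hα : α ≤ x) (hβ : β ≤ z) (hd : 0 ≤ d) (he : 0 ≤ e)
    (hde : 0 < d + e) :
    ∃ τ, 0 ≤ τ ∧ α + τ * d ≤ x ∧ β + τ * e ≤ z ∧ (α + τ * d = x ∨ β + τ * e = z) := by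
  rcases hd.eq_or_lt with rfl | hd'
  · have he' : 0 < e := by linarith
    refine ⟨(z - β) / e, div_nonneg (by linarith) he, by simpa using hα, ?_, Or.inr ?_⟩ <;>
      field_simp <;> linarith
  rcases he.eq_or_lt with rfl | he'
  · refine ⟨(x - α) / d, div_nonneg (by linarith) hd, ?_, by simpa using hβ, Or.inl ?_⟩ <;>
      field_simp <;> linarith
  rcases le_total ((x - α) / d) ((z - β) / e) with h | h
  · refine ⟨(x - α) / d, div_nonneg (by linarith) hd, ?_, ?_, Or.inl ?_⟩
    · field_simp; linarith
    · have := mul_le_mul_of_nonneg_right h he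
      rw [div_mul_cancel₀ _ he'.ne'] at this
      linarith
    · field_simp; linarith
  · refine ⟨(z - β) / e, div_nonneg (by linarith) he, ?_, ?_, Or.inr ?_⟩
    · have := mul_le_mul_of_nonneg_right h hd
      rw [div_mul_cancel₀ _ hd'.ne'] at this
      linarith
    · field_simp; linarith
    · field_simp; linarith

/-- In a box, `a (α + β) - (p α + const)` can be improved along the line `p α - q β = const`
until the border of the box is hit. -/
theorem exists_border {α β x₀ x₁ z₀ z₁ a p q : ℝ} (h1 : x₀ ≤ α) (h2 : α ≤ x₁) (h3 : z₀ ≤ β)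
    (h4 : β ≤ z₁) (hp : 0 ≤ p) (hq : 0 ≤ q) :
    ∃ α' β', x₀ ≤ α' ∧ α' ≤ x₁ ∧ z₀ ≤ β' ∧ β' ≤ z₁ ∧
      (α' = x₀ ∨ α' = x₁ ∨ β' = z₀ ∨ β' = z₁) ∧ p * (α' - α) = q * (β' - β) ∧
      0 ≤ a * ((α' - α) + (β' - β)) - p * (α' - α) := by
  -- The direction (q, p) keeps pα - qβ constant. If p = q = 0, every direction does, and (1, 1) is
  -- taken.
  obtain ⟨d, e, hd, he, hde, hpq⟩ : ∃ d e : ℝ, 0 ≤ d ∧ 0 ≤ e ∧ 0 < d + e ∧ p * d = q * e := by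
    by_cases h : p + q = 0
    · have : p = 0 := by linarith
      have : q = 0 := by linarith
      exact ⟨1, 1, by norm_num, by norm_num, by norm_num, by simp [*]⟩
    · refine ⟨q, p, hq, hp, ?_, mul_comm _ _⟩
      exact lt_of_le_of_ne (by linarith) (by rw [add_comm]; exact Ne.symm h)
  -- The gain is linear in the step length, so one of the two orientations does not lose.
  rcases le_total 0 (a * (d + e) - p * d) with hg | hg
  · obtain ⟨τ, hτ, t1, t2, t3⟩ := exists_exit h2 h4 hd he hde
    have hτd := mul_nonneg hτ hd
    have hτe := mul_nonneg hτ he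
    refine ⟨α + τ * d, β + τ * e, by linarith, t1, by linarith, t2, ?_, ?_, ?_⟩
    · tauto
    · simp only [add_sub_cancel_left]; linear_combination τ * hpq
    · have := mul_nonneg hτ hg
      simp only [add_sub_cancel_left]
      linarith
  · obtain ⟨τ, hτ, t1, t2, t3⟩ := exists_exit (neg_le_neg h1) (neg_le_neg h3) hd he hde
    have hτd := mul_nonneg hτ hd
    have hτe := mul_nonneg hτ he
    refine ⟨α - τ * d, β - τ * e, by linarith, by linarith, by linarith, by linarith, ?_, ?_, ?_⟩
    · rcases t3 with t3 | t3
      · left; linarith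
      · right; right; left; linarith
    · linear_combination (-τ) * hpq
    · have := mul_nonneg hτ (neg_nonneg.2 hg)
      nlinarith

section Candidates

variable {X Y : ℕ → ℝ} {bx nx bz nz : ℕ} {l r : ℝ → ℝ} {A B : ℝ}

/-- The case in which the left side is slack or exhausted. -/
theorem vertex_slack (hl : PointList X Y bx nx l A) (hr : PointList X Y bz nz r B)
    (mr : Monotone r) (rc : Continuous r) {cX cY a b V : ℝ}
    (h1 : ∀ i < nx, ∀ β ∈ Set.Icc 0 B, cY + r β ≤ cX + l (X (bx + i)) →
      a * (X (bx + i) + β) + b - max 0 (cX + l (X (bx + i))) ≤ V)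
    (h2 : ∀ i < nz, ∀ α ∈ Set.Icc 0 A, cX + l α ≤ cY + r (X (bz + i)) →
      a * (α + X (bz + i)) + b - max 0 (cY + r (X (bz + i))) ≤ V)
    (hpos : ∀ α ∈ Set.Icc 0 A, ∀ β ∈ Set.Icc 0 B, 0 ≤ max (cX + l α) (cY + r β))
    {β : ℝ} (hβ : β ∈ Set.Icc 0 B) (hs : cX + l A ≤ cY + r β) :
    a * (A + β) + b - (cY + r β) ≤ V := by
  have hA : A ∈ Set.Icc 0 A := ⟨hl.nonneg, le_rfl⟩
  have hxl : X (bx + (nx - 1)) = A := hl.last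
  have hnx := hl.pos
  have hnz := hr.pos
  have hK := (hpos A hA β hβ).trans (max_le hs le_rfl)
  rcases hr.locate hβ with rfl | ⟨c, hc, g1, g2⟩
  · have := h2 (nz - 1) (by omega) A hA hs
    rwa [max_eq_right hK] at this
  have hseg := hr.segment hc
  have hstep := (hr.step c hc).le
  have e1 := hseg _ _ g1 g2 hstep le_rfl
  have e0 := hseg _ _ g1 g2 le_rfl hstep
  have m1 : r β ≤ r (X (bz + c + 1)) := mr g2
  -- If r rises at rate at most a, moving β to the right end of its segment does not lose. Otherwise
  -- β moves left, up to the left end or, if that comes first, to the point where r has sunk to the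
  -- level of the left side; there both sides agree and α = A is a breakpoint.
  rcases le_total (segSlope X Y (bz + c)) a with hsl | hsl
  · have := h2 (c + 1) hc A hA (hs.trans (by rw [← Nat.add_assoc]; linarith))
    rw [← Nat.add_assoc, max_eq_right (by linarith)] at this
    nlinarith
  · rcases le_total (cX + l A) (cY + r (X (bz + c))) with h | h
    · have := h2 c (by omega) A hA h
      rw [max_eq_right ((hpos A hA _ (hr.mem (by omega))).trans (max_le h le_rfl))] at this
      nlinarith
    · have hivt := intermediate_value_Icc g1 rc.continuousOn
      obtain ⟨β', ⟨b1, b2⟩, hb⟩ : cX + l A - cY ∈ r '' Set.Icc (X (bz + c)) β :=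
        hivt ⟨by linarith, by linarith⟩
      have hβ' : β' ∈ Set.Icc 0 B := ⟨(hr.mem (show c < nz by omega)).1.trans b1, b2.trans hβ.2⟩
      have hb' : cY + r β' = cX + l A := by rw [hb]; ring
      have := h1 (nx - 1) (by omega) β' hβ' (by rw [hxl, hb'])
      rw [hxl, max_eq_right ((hpos A hA β' hβ').trans (max_le le_rfl hb'.le))] at this
      have e2 := hseg _ _ g1 g2 b1 (b2.trans g2)
      nlinarith

/-- The case in which both sides are equally high. -/
theorem vertex_tight (hl : PointList X Y bx nx l A) (hr : PointList X Y bz nz r B)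
    (ml : Monotone l) (mr : Monotone r) {cX cY a b V : ℝ}
    (h1 : ∀ i < nx, ∀ β ∈ Set.Icc 0 B, cY + r β ≤ cX + l (X (bx + i)) →
      a * (X (bx + i) + β) + b - max 0 (cX + l (X (bx + i))) ≤ V)
    (h2 : ∀ i < nz, ∀ α ∈ Set.Icc 0 A, cX + l α ≤ cY + r (X (bz + i)) →
      a * (α + X (bz + i)) + b - max 0 (cY + r (X (bz + i))) ≤ V)
    (hpos : ∀ α ∈ Set.Icc 0 A, ∀ β ∈ Set.Icc 0 B, 0 ≤ max (cX + l α) (cY + r β))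
    {α β : ℝ} (hα : α ∈ Set.Icc 0 A) (hβ : β ∈ Set.Icc 0 B) (ht : cX + l α = cY + r β) :
    a * (α + β) + b - (cY + r β) ≤ V := by
  have hnx := hl.pos
  have hnz := hr.pos
  have left : ∀ i < nx, ∀ β ∈ Set.Icc 0 B, cX + l (X (bx + i)) = cY + r β →
      a * (X (bx + i) + β) + b - (cY + r β) ≤ V := by
    intro i hi β hβ ht
    have := h1 i hi β hβ ht.ge
    rwa [max_eq_right ((hpos _ (hl.mem hi) β hβ).trans (max_le le_rfl ht.ge)), ht] at this
  have right : ∀ i < nz, ∀ α ∈ Set.Icc 0 A, cX + l α = cY + r (X (bz + i)) →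
      a * (α + X (bz + i)) + b - (cY + r (X (bz + i))) ≤ V := by
    intro i hi α hα ht
    have := h2 i hi α hα ht.le
    rwa [max_eq_right ((hpos α hα _ (hr.mem hi)).trans (max_le ht.le le_rfl))] at this
  rcases hl.locate hα with rfl | ⟨c, hc, g1, g2⟩
  · exact left _ (by omega) β hβ ht
  rcases hr.locate hβ with rfl | ⟨d, hd, g3, g4⟩
  · exact right _ (by omega) α hα ht
  -- On the product of the two segments both sides are affine, and the movement keeps them equal
  -- until one weight reaches a breakpoint.
  obtain ⟨α', β', a1, a2, a3, a4, hb, hpq, hg⟩ := exists_border (a := a) g1 g2 g3 g4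
    (hl.segSlope_nonneg ml hc) (hr.segSlope_nonneg mr hd)
  have e1 := hl.segment hc _ _ g1 g2 a1 a2
  have e2 := hr.segment hd _ _ g3 g4 a3 a4
  have ht' : cX + l α' = cY + r β' := by rw [e1, e2]; linarith
  have hα' : α' ∈ Set.Icc 0 A :=
    ⟨(hl.mem (show c < nx by omega)).1.trans a1, a2.trans (hl.mem hc).2⟩
  have hβ' : β' ∈ Set.Icc 0 B :=
    ⟨(hr.mem (show d < nz by omega)).1.trans a3, a4.trans (hr.mem hd).2⟩
  have hle : a * (α + β) + b - (cY + r β) ≤ a * (α' + β') + b - (cY + r β') := by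
    rw [e2]; linarith
  refine hle.trans ?_
  rcases hb with rfl | rfl | rfl | rfl
  · exact left c (by omega) β' hβ' ht'
  · exact left (c + 1) hc β' hβ' ht'
  · exact right d (by omega) α' hα' ht'
  · exact right (d + 1) hd α' hα' ht'

/-- Raising the lower side. -/
theorem exists_raise (lc : Continuous l) {α K : ℝ} (hα : α ∈ Set.Icc 0 A) (h : l α ≤ K) :
    ∃ α' ∈ Set.Icc 0 A, α ≤ α' ∧ (l α' = K ∨ (α' = A ∧ l A ≤ K)) := by
  rcases le_total (l A) K with hK | hK
  · exact ⟨A, ⟨hα.1.trans hα.2, le_rfl⟩, hα.2, Or.inr ⟨rfl, hK⟩⟩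
  · obtain ⟨α', ⟨h1, h2⟩, e⟩ := intermediate_value_Icc hα.2 lc.continuousOn ⟨h, hK⟩
    exact ⟨α', ⟨hα.1.trans h1, h2⟩, h1, Or.inl e⟩

/-- The optimum for a fixed location is attained where one of the two weights is a breakpoint
that determines the other one. -/
theorem vertex_complete (hl : PointList X Y bx nx l A) (hr : PointList X Y bz nz r B)
    (ml : Monotone l) (mr : Monotone r) (lc : Continuous l) (rc : Continuous r)
    {cX cY a b V : ℝ} (ha : 0 ≤ a)
    (h1 : ∀ i < nx, ∀ β ∈ Set.Icc 0 B, cY + r β ≤ cX + l (X (bx + i)) →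
      a * (X (bx + i) + β) + b - max 0 (cX + l (X (bx + i))) ≤ V)
    (h2 : ∀ i < nz, ∀ α ∈ Set.Icc 0 A, cX + l α ≤ cY + r (X (bz + i)) →
      a * (α + X (bz + i)) + b - max 0 (cY + r (X (bz + i))) ≤ V)
    (hsign : (∀ α ∈ Set.Icc 0 A, ∀ β ∈ Set.Icc 0 B, 0 ≤ max (cX + l α) (cY + r β)) ∨
      (∀ α ∈ Set.Icc 0 A, ∀ β ∈ Set.Icc 0 B, max (cX + l α) (cY + r β) ≤ 0))
    {α β : ℝ} (hα : α ∈ Set.Icc 0 A) (hβ : β ∈ Set.Icc 0 B) :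
    a * (α + β) + b - max 0 (max (cX + l α) (cY + r β)) ≤ V := by
  have hA : A ∈ Set.Icc 0 A := ⟨hl.nonneg, le_rfl⟩
  have hB : B ∈ Set.Icc 0 B := ⟨hr.nonneg, le_rfl⟩
  have hnx := hl.pos
  have hnz := hr.pos
  rcases hsign with hpos | hneg
  · rw [max_eq_right (hpos α hα β hβ)]
    -- As a ≥ 0, raising the weight on the lower side does not lose while that side stays below the
    -- other one. It ends with equal sides (`vertex_tight`) or with the whole weight used up
    -- (`vertex_slack`).
    rcases le_total (cX + l α) (cY + r β) with h | h
    · rw [max_eq_right h]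
      obtain ⟨α', hα', hle, hc⟩ := exists_raise lc hα (K := cY + r β - cX) (by linarith)
      have h0 : a * (α + β) ≤ a * (α' + β) := by gcongr
      rcases hc with hc | ⟨rfl, hc⟩
      · have := vertex_tight hl hr ml mr h1 h2 hpos hα' hβ (by linarith)
        linarith
      · have := vertex_slack hl hr mr rc h1 h2 hpos hβ (by linarith)
        linarith
    · rw [max_eq_left h]
      obtain ⟨β', hβ', hle, hc⟩ := exists_raise rc hβ (K := cX + l α - cY) (by linarith)
      have h0 : a * (α + β) ≤ a * (α + β') := by gcongr
      rcases hc with hc | ⟨rfl, hc⟩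
      · have := vertex_tight hl hr ml mr h1 h2 hpos hα hβ' (by linarith)
        linarith
      · have := vertex_slack hr hl ml lc
          (fun i hi α hα h => by rw [add_comm (X _)]; exact h2 i hi α hα h)
          (fun i hi β hβ h => by rw [add_comm β]; exact h1 i hi β hβ h)
          (fun β hβ α hα => by rw [max_comm]; exact hpos α hα β hβ) hα (by linarith)
        linarith
  -- If the height is 0 throughout, the largest weights are best. A and B are the last points of
  -- their lists, so the higher side supplies the candidate.
  · rw [max_eq_left (hneg α hα β hβ), sub_zero]
    have hω : a * (α + β) ≤ a * (A + B) := by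
      have := hα.2; have := hβ.2; gcongr
    have hAB := hneg A hA B hB
    rw [max_le_iff] at hAB
    rcases le_total (cX + l A) (cY + r B) with h | h
    · have := h2 (nz - 1) (by omega) A hA (by rw [hr.last]; exact h)
      rw [hr.last, max_eq_left hAB.2] at this
      linarith
    · have := h1 (nx - 1) (by omega) B hB (by rw [hl.last]; exact h)
      rw [hl.last, max_eq_left hAB.1] at this
      linarith

/-- The merge of the two lists by slopes contains, for every `μ`, a pair of points that maximize
`μ α - l α` and `μ β - r β`. -/
theorem exists_pair (hl : PointList X Y bx nx l A) (hr : PointList X Y bz nz r B)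
    (cl : ConvexOn ℝ Set.univ l) (cr : ConvexOn ℝ Set.univ r) {Q : ℕ → ℕ → Prop}
    (h1 : ∀ i < nx, ∃ j < nz,
      (∀ j' < j, 1 ≤ i ∧ segSlope X Y (bz + j') ≤ segSlope X Y (bx + (i - 1))) ∧
      (j + 1 < nz → 1 ≤ i → segSlope X Y (bx + (i - 1)) < segSlope X Y (bz + j)) ∧ Q i j)
    (h2 : ∀ j < nz, ∃ i < nx,
      (∀ i' < i, 1 ≤ j ∧ segSlope X Y (bx + i') ≤ segSlope X Y (bz + (j - 1))) ∧
      (i + 1 < nx → 1 ≤ j → segSlope X Y (bz + (j - 1)) < segSlope X Y (bx + i)) ∧ Q i j)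
    (μ : ℝ) :
    ∃ i < nx, ∃ j < nz, Q i j ∧
      (∀ z ∈ Set.Icc 0 A, μ * z - l z ≤ μ * X (bx + i) - l (X (bx + i))) ∧
      (∀ z ∈ Set.Icc 0 B, μ * z - r z ≤ μ * X (bz + j) - r (X (bz + j))) := by
  obtain ⟨i, hi, i1, i2, i3⟩ := hl.exists_argmax cl μ
  obtain ⟨j, hj, j1, j2, j3⟩ := hr.exists_argmax cr μ
  refine ⟨i, hi, j, hj, ?_, i3, j3⟩
  -- The pair is met by the scan over that list whose segment before the maximizer is the steeper
  -- one: all earlier slopes of the other list have been passed, and its next slope is at least μ.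
  -- Ties and the pair (0, 0) go to the first scan.
  by_cases hij : (i = 0 ∧ j = 0) ∨
      (1 ≤ i ∧ (j = 0 ∨ segSlope X Y (bz + (j - 1)) ≤ segSlope X Y (bx + (i - 1))))
  · obtain ⟨j', hj', k1, k2, hQ⟩ := h1 i hi
    have : j' = j := by
      rcases hij with ⟨rfl, rfl⟩ | ⟨hi1, hij⟩
      · by_contra hne
        exact absurd (k1 0 (by omega)).1 (by omega)
      rcases lt_trichotomy j' j with h | h | h
      · have q1 := k2 (by omega) hi1
        have q2 := hr.segSlope_mono cr (show j' ≤ j - 1 by omega) (by omega)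
        rcases hij with rfl | hij
        · omega
        · linarith
      · exact h
      · have q1 := (k1 j h).2
        have q2 := j2 (by omega)
        have q3 := i1 (i - 1) (by omega)
        linarith
    exact this ▸ hQ
  · obtain ⟨i', hi', k1, k2, hQ⟩ := h2 j hj
    push Not at hij
    have hj1 : 1 ≤ j := by
      by_contra hj0
      have hj0 : j = 0 := by omega
      by_cases hi0 : i = 0
      · exact hij.1 hi0 hj0
      · exact (hij.2 (by omega)).1 hj0
    have : i' = i := by
      rcases lt_trichotomy i' i with h | h | h
      · have q1 := k2 (by omega) hj1
        have q2 := hl.segSlope_mono cl (show i' ≤ i - 1 by omega) (by omega)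
        have q3 := (hij.2 (by omega)).2
        linarith
      · exact h
      · have q1 := (k1 i h).2
        have q2 := i2 (by omega)
        have q3 := j1 (j - 1) (by omega)
        linarith
    exact this ▸ hQ

/-- The optimum over the locations in `[u, v]` is attained at a pair of points found by merging
the slopes, or at `u` or `v`. -/
theorem edge_complete (cl : ConvexOn ℝ Set.univ l) (cr : ConvexOn ℝ Set.univ r)
    {u v s a b V : ℝ} {α₀ β₀ : ℝ} (hα₀ : α₀ ∈ Set.Icc 0 A) (hβ₀ : β₀ ∈ Set.Icc 0 B)
    (mα : ∀ z ∈ Set.Icc 0 A, 2 * a * z - l z ≤ 2 * a * α₀ - l α₀)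
    (mβ : ∀ z ∈ Set.Icc 0 B, 2 * a * z - r z ≤ 2 * a * β₀ - r β₀)
    (h0 : a * (α₀ + β₀) + b -
      max (max 0 (max (u + l α₀) (s - v + r β₀))) ((l α₀ + r β₀ + s) / 2) ≤ V)
    (hu : ∀ α ∈ Set.Icc 0 A, ∀ β ∈ Set.Icc 0 B,
      a * (α + β) + b - max 0 (max (u + l α) (s - u + r β)) ≤ V)
    (hv : ∀ α ∈ Set.Icc 0 A, ∀ β ∈ Set.Icc 0 B,
      a * (α + β) + b - max 0 (max (v + l α) (s - v + r β)) ≤ V)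
    (hsign : (∀ α ∈ Set.Icc 0 A, ∀ β ∈ Set.Icc 0 B, ∀ y ∈ Set.Icc u v,
        0 ≤ max (y + l α) (s - y + r β)) ∨
      (∀ α ∈ Set.Icc 0 A, ∀ β ∈ Set.Icc 0 B, max (u + l α) (s - u + r β) ≤ 0))
    {α β y : ℝ} (hα : α ∈ Set.Icc 0 A) (hβ : β ∈ Set.Icc 0 B) (hy : y ∈ Set.Icc u v) :
    a * (α + β) + b - max 0 (max (y + l α) (s - y + r β)) ≤ V := by
  have huv : u ≤ v := hy.1.trans hy.2
  rcases hsign with hpos | hneg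
  swap
  · have h1 := hu α hα β hβ
    rw [max_eq_left (hneg α hα β hβ)] at h1
    have := le_max_left 0 (max (y + l α) (s - y + r β))
    linarith
  rw [max_eq_right (hpos α hα β hβ y hy)]
  set T := max (y + l α) (s - y + r β) with hT
  have T1 : y + l α ≤ T := le_max_left _ _
  have T2 : s - y + r β ≤ T := le_max_right _ _
  -- The height is at least the mean of its two sides, in which y cancels, and `y₀` makes the sides
  -- equal for (α₀, β₀). Comparing with the mean separates the two weights; clearing its denominator
  -- accounts for the slope 2a in `mα` and `mβ`.
  set y₀ := (s + r β₀ - l α₀) / 2 with hy₀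
  have a1 := mα α hα
  have b1 := mβ β hβ
  have best : a * (α + β) - T ≤ a * (α₀ + β₀) - (l α₀ + r β₀ + s) / 2 := by linarith
  -- the convex combination at location `w`
  have comb : ∀ w ∈ Set.Icc u v, ∀ τ, 0 ≤ τ → τ ≤ 1 → (1 - τ) * y + τ * y₀ = w →
      (∀ α ∈ Set.Icc 0 A, ∀ β ∈ Set.Icc 0 B,
        a * (α + β) + b - max 0 (max (w + l α) (s - w + r β)) ≤ V) →
      (∀ α ∈ Set.Icc 0 A, ∀ β ∈ Set.Icc 0 B, 0 ≤ max (w + l α) (s - w + r β)) →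
      a * (α + β) + b - T ≤ V := by
    intro w hw τ h0 h1 hwτ hV hp
    have hα' : (1 - τ) * α + τ * α₀ ∈ Set.Icc 0 A := by
      have := (convex_Icc (0 : ℝ) A) hα hα₀ (sub_nonneg.2 h1) h0 (by ring)
      simpa using this
    have hβ' : (1 - τ) * β + τ * β₀ ∈ Set.Icc 0 B := by
      have := (convex_Icc (0 : ℝ) B) hβ hβ₀ (sub_nonneg.2 h1) h0 (by ring)
      simpa using this
    have l1 := cl.2 (Set.mem_univ α) (Set.mem_univ α₀) (sub_nonneg.2 h1) h0 (by ring)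
    have r1 := cr.2 (Set.mem_univ β) (Set.mem_univ β₀) (sub_nonneg.2 h1) h0 (by ring)
    simp only [smul_eq_mul] at l1 r1
    have q := hV _ hα' _ hβ'
    rw [max_eq_right (hp _ hα' _ hβ')] at q
    have q1 := mul_le_mul_of_nonneg_left T1 (sub_nonneg.2 h1)
    have q2 := mul_le_mul_of_nonneg_left T2 (sub_nonneg.2 h1)
    have q3 := mul_le_mul_of_nonneg_left best h0
    have m : max (w + l ((1 - τ) * α + τ * α₀)) (s - w + r ((1 - τ) * β + τ * β₀)) ≤
        (1 - τ) * T + τ * ((l α₀ + r β₀ + s) / 2) := by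
      apply max_le
      · have : τ * y₀ + τ * l α₀ = τ * ((l α₀ + r β₀ + s) / 2) := by rw [hy₀]; ring
        linarith
      · have : τ * s - τ * y₀ + τ * r β₀ = τ * ((l α₀ + r β₀ + s) / 2) := by rw [hy₀]; ring
        linarith
    linarith
  -- If `y₀` lies outside [u, v], the segment from y to `y₀` leaves the interval through an end. The
  -- convex combination there is no worse than (α, β, y), because the height is jointly convex in
  -- weights and location; τ solves for that end.
  rcases lt_or_ge y₀ u with h | h
  · have hd : 0 < y - y₀ := by linarith [hy.1]
    refine comb u ⟨le_rfl, huv⟩ ((y - u) / (y - y₀)) (div_nonneg (by linarith [hy.1]) hd.le)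
      ((div_le_one hd).2 (by linarith)) (by field_simp; ring) hu
      fun α hα β hβ => hpos α hα β hβ u ⟨le_rfl, huv⟩
  rcases lt_or_ge v y₀ with h' | h'
  · have hd : 0 < y₀ - y := by linarith [hy.2]
    refine comb v ⟨huv, le_rfl⟩ ((v - y) / (y₀ - y)) (div_nonneg (by linarith [hy.2]) hd.le)
      ((div_le_one hd).2 (by linarith)) (by field_simp; ring) hv
      fun α hα β hβ => hpos α hα β hβ v ⟨huv, le_rfl⟩
  · have h2 := hpos α₀ hα₀ β₀ hβ₀ y₀ ⟨h, h'⟩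
    have e1 : y₀ + l α₀ = (l α₀ + r β₀ + s) / 2 := by rw [hy₀]; ring
    have e2 : s - y₀ + r β₀ = (l α₀ + r β₀ + s) / 2 := by rw [hy₀]; ring
    rw [e1, e2, max_self] at h2
    rw [max_eq_right (max_le h2 (max_le (by linarith) (by linarith)))] at h0
    linarith

end Candidates

/-! ### Inserting a line into an envelope -/

/-- `f` is affine on `[p, q]`. -/
def AffOn (f : ℝ → ℝ) (p q : ℝ) : Prop :=
  ∀ z, p ≤ z → z ≤ q → (q - p) * f z = (q - z) * f p + (z - p) * f q

theorem AffOn.of_line {f : ℝ → ℝ} {p q m k : ℝ} (hpq : p ≤ q)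
    (h : ∀ z, p ≤ z → z ≤ q → f z = m * z + k) : AffOn f p q := by
  intro z h1 h2
  rw [h z h1 h2, h p le_rfl hpq, h q hpq le_rfl]
  ring

theorem AffOn.line {f : ℝ → ℝ} {p q : ℝ} (hpq : p < q) (h : AffOn f p q) :
    ∃ m k, ∀ z, p ≤ z → z ≤ q → f z = m * z + k := by
  refine ⟨(f q - f p) / (q - p), f p - (f q - f p) / (q - p) * p, fun z h1 h2 => ?_⟩
  have hd : q - p ≠ 0 := by linarith
  apply mul_left_cancel₀ hd
  rw [h z h1 h2]
  field_simp
  ring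

section Max

variable {f : ℝ → ℝ} {p q s K : ℝ}

/-- An affine difference whose end values do not have opposite signs keeps its sign in between, so
the maximum is one of the two lines on the whole segment. -/
theorem affOn_max_of_nonneg (hpq : p < q) (h : AffOn f p q)
    (hD : 0 ≤ (f p - (s * p + K)) * (f q - (s * q + K))) :
    AffOn (fun z => max (f z) (s * z + K)) p q := by
  obtain ⟨m, k, hl⟩ := h.line hpq
  have ep := hl p le_rfl hpq.le
  have eq := hl q hpq.le le_rfl
  rw [ep, eq] at hD
  by_cases hc : 0 ≤ m * p + k - (s * p + K) ∧ 0 ≤ m * q + k - (s * q + K)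
  · refine AffOn.of_line (m := m) (k := k) hpq.le fun z h1 h2 => ?_
    rw [← hl z h1 h2]
    refine max_eq_left ?_
    rw [hl z h1 h2]
    by_contra hlt
    push Not at hlt
    nlinarith
  · have hc' : m * p + k - (s * p + K) ≤ 0 ∧ m * q + k - (s * q + K) ≤ 0 := by
      by_contra hc'
      rw [not_and_or] at hc hc'
      push Not at hc hc'
      rcases hc with hc | hc <;> rcases hc' with hc' | hc' <;> nlinarith
    refine AffOn.of_line (m := s) (k := K) hpq.le fun z h1 h2 => ?_
    refine max_eq_right ?_
    rw [hl z h1 h2]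
    by_contra hlt
    push Not at hlt
    nlinarith

/-- An affine difference with end values d and e of opposite signs vanishes at the fraction d/(d -
e) of the segment, the only new breakpoint. On either half one end value is 0, which is the case of
`affOn_max_of_nonneg`. -/
theorem affOn_max_of_neg (hpq : p < q) (h : AffOn f p q)
    (hD : (f p - (s * p + K)) * (f q - (s * q + K)) < 0) {x : ℝ}
    (hx : x = p + (q - p) * ((f p - (s * p + K)) /
      ((f p - (s * p + K)) - (f q - (s * q + K))))) :
    p < x ∧ x < q ∧ f x = s * x + K ∧ AffOn (fun z => max (f z) (s * z + K)) p x ∧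
      AffOn (fun z => max (f z) (s * z + K)) x q := by
  obtain ⟨m, k, hl⟩ := h.line hpq
  have ep := hl p le_rfl hpq.le
  have eq := hl q hpq.le le_rfl
  set d := f p - (s * p + K) with hd
  set e := f q - (s * q + K) with he
  clear_value d e
  have hde : 0 < d / (d - e) ∧ d / (d - e) < 1 := by
    rcases mul_neg_iff.1 hD with ⟨h1, h2⟩ | ⟨h1, h2⟩
    · exact ⟨div_pos h1 (by linarith), (div_lt_one (by linarith)).2 (by linarith)⟩
    · refine ⟨div_pos_of_neg_of_neg h1 (by linarith), ?_⟩
      rw [div_lt_one_of_neg (by linarith)]; linarith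
  have hne : d - e ≠ 0 := by
    rcases mul_neg_iff.1 hD with ⟨h1, h2⟩ | ⟨h1, h2⟩ <;> intro h0 <;> linarith
  have hpx : p < x := by rw [hx]; nlinarith
  have hxq : x < q := by rw [hx]; nlinarith
  have hfx : f x = s * x + K := by
    rw [hl x hpx.le hxq.le, hx]
    have e1 : d = (m - s) * p + (k - K) := by rw [hd, ep]; ring
    have e2 : e = (m - s) * q + (k - K) := by rw [he, eq]; ring
    have e3 : (m - s) * (q - p) = -(d - e) := by rw [e1, e2]; ring
    have : (m - s) * ((q - p) * (d / (d - e))) = -d := by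
      rw [← mul_assoc, e3]; field_simp
    linear_combination this - e1
  refine ⟨hpx, hxq, hfx, affOn_max_of_nonneg hpx ?_ ?_, affOn_max_of_nonneg hxq ?_ ?_⟩
  · exact AffOn.of_line hpx.le fun z h1 h2 => hl z h1 (by linarith)
  · rw [hfx]; simp
  · exact AffOn.of_line hxq.le fun z h1 h2 => hl z (by linarith) h2
  · rw [hfx]; simp

end Max

namespace PointList

variable {X Y : ℕ → ℝ} {b N : ℕ} {f : ℝ → ℝ} {D : ℝ}

theorem single (X Y : ℕ → ℝ) (b : ℕ) (f : ℝ → ℝ) :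
    PointList (Function.update X b 0) (Function.update Y b (f 0)) b 1 f 0 :=
  ⟨by omega, by simp, by simp, by omega, by rintro a ha; simp [show a = 0 by omega], by omega⟩

theorem push (h : PointList X Y b N f D) {z : ℝ} (hz : D < z) (ha : AffOn f D z) :
    PointList (Function.update X (b + N) z) (Function.update Y (b + N) (f z)) b (N + 1) f z := by
  have hp := h.pos
  have ne : ∀ a < N, b + a ≠ b + N := by omega
  have hl := h.last
  refine ⟨by omega, ?_, by simp, ?_, ?_, ?_⟩
  · rw [Function.update_of_ne (by omega), h.first]
  · intro a haN
    rw [Function.update_of_ne (ne a (by omega))]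
    by_cases e : a + 1 = N
    · rw [show b + a + 1 = b + N by omega, Function.update_self, show b + a = b + (N - 1) by omega,
        hl]
      exact hz
    · rw [Function.update_of_ne (by omega)]; exact h.step a (by omega)
  · intro a haN
    by_cases e : a = N
    · rw [e, Function.update_self, Function.update_self]
    · rw [Function.update_of_ne (by omega), Function.update_of_ne (by omega), h.val a (by omega)]
  · intro a haN
    rw [Function.update_of_ne (ne a (by omega))]
    by_cases e : a + 1 = N
    · rw [show b + a + 1 = b + N by omega, Function.update_self, show b + a = b + (N - 1) by omega,
        hl]
      exact ha
    · rw [Function.update_of_ne (by omega)]; exact h.aff a (by omega)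

end PointList

/-- Bookkeeping for the sign changes of a sequence. -/
def SignChanges (d : ℕ → ℝ) (N m a : ℕ) : Prop :=
  m ≤ 2 ∧ (1 ≤ m → ∃ p q, p < q ∧ q ≤ a ∧ q < N ∧ d p * d q < 0) ∧
    (2 ≤ m → ∃ p q, p < q ∧ q ≤ a ∧ q < N ∧ d p < 0 ∧ 0 < d q)

theorem SignChanges.mono {d : ℕ → ℝ} {N m a : ℕ} (h : SignChanges d N m a) :
    SignChanges d N m (a + 1) := by
  obtain ⟨h0, h1, h2⟩ := h
  refine ⟨h0, fun hm => ?_, fun hm => ?_⟩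
  · obtain ⟨p, q, h⟩ := h1 hm; exact ⟨p, q, h.1, by omega, h.2.2⟩
  · obtain ⟨p, q, h⟩ := h2 hm; exact ⟨p, q, h.1, by omega, h.2.2⟩

/-- A sequence that is never positive between two negative entries can change sign only from + to -
and then from - to +. After two changes, a negative entry has been followed by a positive one, and a
third change would put another negative entry behind it. This is why a list grows by at most two
points per inserted line. -/
theorem SignChanges.succ {d : ℕ → ℝ} {N m a : ℕ} (h : SignChanges d N m a) (ha : a + 1 < N)
    (hd : d a * d (a + 1) < 0)
    (hconv : ∀ p q r, p < q → q < r → r < N → d p < 0 → d r < 0 → d q ≤ 0) :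
    SignChanges d N (m + 1) (a + 1) := by
  obtain ⟨h0, h1, h2⟩ := h
  refine ⟨?_, fun _ => ⟨a, a + 1, by omega, le_rfl, ha, hd⟩, fun hm => ?_⟩
  · by_contra hm
    obtain ⟨p, q, hpq, hqa, hqN, dp, dq⟩ := h2 (by omega)
    rcases mul_neg_iff.1 hd with ⟨-, hr⟩ | ⟨hr, -⟩
    · exact absurd (hconv p q (a + 1) hpq (by omega) ha dp hr) (not_le.2 dq)
    · have : q ≠ a := by rintro rfl; linarith
      exact absurd (hconv p q a hpq (by omega) (by omega) dp hr) (not_le.2 dq)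
  · obtain ⟨p, q, hpq, hqa, hqN, hneg⟩ := h1 (by omega)
    rcases mul_neg_iff.1 hneg with ⟨dp, dq⟩ | ⟨dp, dq⟩
    · rcases mul_neg_iff.1 hd with ⟨hr, -⟩ | ⟨hr, hr'⟩
      · have : q ≠ a := by rintro rfl; linarith
        exact ⟨q, a, by omega, by omega, by omega, dq, hr⟩
      · exact ⟨a, a + 1, by omega, le_rfl, ha, hr, hr'⟩
    · exact ⟨p, q, hpq, by omega, hqN, dp, dq⟩

/-! ### The insertion program: one pass over the list, at most two new points -/

namespace RealRAM

/-- `rreg r := max (rreg r) e` -/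
def maxR (r : ℕ) (e : RExpr) : Prog := .branch (.rle (.reg r) e) (.setR r e) .nop

@[simp] theorem maxR_run (r : ℕ) (e : RExpr) (σ : State) :
    (maxR r e).run σ = σ.setR r (max (σ.rreg r) (e.eval σ)) := by
  rw [maxR, Prog.run]
  by_cases h : (Test.rle (.reg r) e).holds σ
  · have h' : σ.rreg r ≤ e.eval σ := h
    rw [if_pos h, max_eq_right h']; rfl
  · have h' : ¬ σ.rreg r ≤ e.eval σ := h
    rw [if_neg h, max_eq_left (le_of_not_ge h')]
    simp [State.setR, Prog.run]

/-- Append the point `(rreg 7, rreg 8)` to the list under construction, which starts at `nreg 7`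
and has length `nreg 13`. -/
def pushProg : Prog :=
  .seq (.storeR 8 (.add (.reg 7) (.reg 13)) (.reg 7)) <|
  .seq (.storeR 9 (.add (.reg 7) (.reg 13)) (.reg 8)) <|
  .setN 13 (.add (.reg 13) (.const 1))

/-- `rreg 2 * x + rreg 3` -/
def lineExpr (x : RExpr) : RExpr := .add (.mul (.reg 2) x) (.reg 3)

/-- Point `nreg 12` of the list at `nreg 10`. -/
def curIdx : NExpr := .add (.reg 10) (.reg 12)

/-- One step of the insertion: copy a point, and insert the crossing on the following segment. -/
def insertBody : Prog :=
  .seq (.setR 7 (.read 8 curIdx)) <|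
  .seq (.setR 8 (.read 9 curIdx)) <|
  .seq (maxR 8 (lineExpr (.reg 7))) <|
  .seq pushProg <|
  .seq (.branch (.nle (.add (.reg 12) (.const 2)) (.reg 11))
    (.seq (.setR 9 (.sub (.read 9 curIdx) (lineExpr (.read 8 curIdx)))) <|
     .seq (.setR 23 (.sub (.read 9 (.add curIdx (.const 1)))
        (lineExpr (.read 8 (.add curIdx (.const 1)))))) <|
     .branch (.rle (.const 0) (.mul (.reg 9) (.reg 23))) .nop
      (.seq (.setR 7 (.add (.read 8 curIdx)
          (.mul (.sub (.read 8 (.add curIdx (.const 1))) (.read 8 curIdx))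
            (.div (.reg 9) (.sub (.reg 9) (.reg 23)))))) <|
       .seq (.setR 8 (lineExpr (.reg 7))) pushProg))
    .nop) <|
  .setN 12 (.add (.reg 12) (.const 1))

/-- Insert the line `rreg 2 * z + rreg 3` into the list at `nreg 10` of length `nreg 11`; the
result is written at the end `nreg 7` of the used memory. -/
def insertProg : Prog :=
  .seq (.setN 12 (.const 0)) <|
  .seq (.setN 13 (.const 0)) <|
  .seq (.loop (.nle (.add (.reg 12) (.const 1)) (.reg 11)) insertBody) <|
  .seq (.setN 10 (.reg 7)) <|
  .seq (.setN 11 (.reg 13)) <|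
  .setN 7 (.add (.reg 7) (.reg 13))

/-- Invariant of the insertion. -/
structure InsertInv (X Y : ℕ → ℝ) (b N fp : ℕ) (f : ℝ → ℝ) (s K : ℝ) (a : ℕ) (σ : State) :
    Prop where
  n12 : σ.nreg 12 = a
  n10 : σ.nreg 10 = b
  n11 : σ.nreg 11 = N
  n7 : σ.nreg 7 = fp
  r2 : σ.rreg 2 = s
  r3 : σ.rreg 3 = K
  memX : ∀ k < fp, σ.rarr 8 k = X k
  memY : ∀ k < fp, σ.rarr 9 k = Y k
  count : ∃ m, σ.nreg 13 = a + m ∧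
    SignChanges (fun i => f (X (b + i)) - (s * X (b + i) + K)) N m a
  list : 0 < a → ∃ D, PointList (σ.rarr 8) (σ.rarr 9) fp (σ.nreg 13)
    (fun z => max (f z) (s * z + K)) D ∧
      (a < N → D < X (b + a) ∧ AffOn (fun z => max (f z) (s * z + K)) D (X (b + a))) ∧
      (a = N → D = X (b + (N - 1)))
  zero : a = 0 → σ.nreg 13 = 0

/-- The new list takes over every old abscissa and gets one more point where the line strictly
crosses a segment. It is written from `fp` on, behind the old list, so reading and writing do not
interfere. -/
theorem insertBody_runs {X Y : ℕ → ℝ} {b N fp : ℕ} {f : ℝ → ℝ} {s K D : ℝ}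
    (hf : ConvexOn ℝ Set.univ f) (hL : PointList X Y b N f D) (hfp : b + N ≤ fp) {a : ℕ}
    {σ : State} (ha : a < N) (h : InsertInv X Y b N fp f s K a σ) :
    Runs insertBody σ insertBody.size (InsertInv X Y b N fp f s K (a + 1)) := by
  refine Runs.of_loopFree rfl ?_
  obtain ⟨h12, h10, h11, h7, h2, h3, hX, hY, ⟨m, hm, hc⟩, hlist, hzero⟩ := h
  set g : ℝ → ℝ := fun z => max (f z) (s * z + K) with hg
  have Xa := hX (b + a) (by omega)
  have Ya := hY (b + a) (by omega)
  have va := hL.val a ha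
  -- the list after copying the point
  have hpush : PointList (Function.update (σ.rarr 8) (fp + σ.nreg 13) (X (b + a)))
      (Function.update (σ.rarr 9) (fp + σ.nreg 13) (max (Y (b + a)) (s * X (b + a) + K)))
      fp (σ.nreg 13 + 1) g (X (b + a)) := by
    have e : max (Y (b + a)) (s * X (b + a) + K) = g (X (b + a)) := by rw [hg, va]
    rw [e]
    rcases Nat.eq_zero_or_pos a with rfl | ha0
    · rw [hzero rfl, Nat.add_zero, Nat.add_zero, hL.first]
      exact PointList.single _ _ _ _
    · obtain ⟨D', hl, hl', -⟩ := hlist ha0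
      exact hl.push (hl' ha).1 (hl' ha).2
  have ne1 : b + a ≠ fp + σ.nreg 13 := by omega
  by_cases hN : a + 2 ≤ N
  · have Xa1 := hX (b + a + 1) (by omega)
    have Ya1 := hY (b + a + 1) (by omega)
    have va1 := hL.val (a + 1) hN
    rw [← Nat.add_assoc] at va1
    have ne2 : b + a + 1 ≠ fp + σ.nreg 13 := by omega
    have hstep := hL.step a hN
    have haff : AffOn f (X (b + a)) (X (b + a + 1)) := hL.aff a hN
    by_cases hD : 0 ≤ (Y (b + a) - (s * X (b + a) + K)) *
        (Y (b + a + 1) - (s * X (b + a + 1) + K))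
    · have hga := affOn_max_of_nonneg hstep haff (s := s) (K := K) (by rwa [← va, ← va1])
      constructor <;> simp [insertBody, Prog.run, pushProg, lineExpr, curIdx, h12, h10, h11, h7, h2,
        h3, Xa, Ya, Xa1, Ya1, hN, hD, Function.update_of_ne ne1, Function.update_of_ne ne2]
      · intro k hk
        rw [Function.update_of_ne (by omega), hX k hk]
      · intro k hk
        rw [Function.update_of_ne (by omega), hY k hk]
      · exact ⟨m, by omega, hc.mono⟩
      · refine ⟨X (b + a), hpush, fun _ => ⟨hstep, hga⟩, by omega⟩
    · obtain ⟨c1, c2, c3, c4, c5⟩ := affOn_max_of_neg hstep haff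
        (by rw [← va, ← va1]; exact not_le.1 hD) rfl
      rw [← va, ← va1] at c1 c2 c3 c4 c5
      constructor <;> simp [insertBody, Prog.run, pushProg, lineExpr, curIdx, h12, h10, h11, h7, h2,
        h3, Xa, Ya, Xa1, Ya1, hN, hD, Function.update_of_ne ne1, Function.update_of_ne ne2]
      · intro k hk
        rw [Function.update_of_ne (by omega), Function.update_of_ne (by omega), hX k hk]
      · intro k hk
        rw [Function.update_of_ne (by omega), Function.update_of_ne (by omega), hY k hk]
      · refine ⟨m + 1, by omega, hc.succ hN ?_ ?_⟩
        · simp only [← Nat.add_assoc]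
          rw [← va, ← va1]; exact not_le.1 hD
        -- The entries are values of the convex function f minus a line, so between two negative
        -- ones there is no positive one.
        · intro p q r hpq hqr hr dp dr
          have x1 := hL.strictMono hpq (by omega)
          have x2 := hL.strictMono hqr hr
          have hcv := hf.slope_mono_adjacent (Set.mem_univ _) (Set.mem_univ _) x1 x2
          rw [div_le_div_iff₀ (by linarith) (by linarith)] at hcv
          nlinarith
      · have hp2 := hpush.push c1 c4
        refine ⟨_, ?_, fun _ => ⟨c2, c5⟩, by omega⟩
        have e : g (X (b + a) + (X (b + a + 1) - X (b + a)) *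
            ((Y (b + a) - (s * X (b + a) + K)) /
              (Y (b + a) - (s * X (b + a) + K) - (Y (b + a + 1) - (s * X (b + a + 1) + K))))) =
            s * (X (b + a) + (X (b + a + 1) - X (b + a)) *
            ((Y (b + a) - (s * X (b + a) + K)) /
              (Y (b + a) - (s * X (b + a) + K) - (Y (b + a + 1) - (s * X (b + a + 1) + K))))) + K :=
          max_eq_right c3.le
        rw [e] at hp2
        exact hp2
  · constructor <;> simp [insertBody, Prog.run, pushProg, lineExpr, curIdx, h12, h10, h11, h7, h2,
      h3, Xa, Ya, hN]
    · intro k hk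
      rw [Function.update_of_ne (by omega), hX k hk]
    · intro k hk
      rw [Function.update_of_ne (by omega), hY k hk]
    · exact ⟨m, by omega, hc.mono⟩
    · refine ⟨X (b + a), hpush, by omega, fun _ => ?_⟩
      congr 2; omega

/-- The bound `N + 2` is what matters: with two insertions per edge, the list of envelope m has at
most 2 + 4m points, and linear cost per insertion adds up to a quadratic total. -/
theorem insertProg_runs : ∃ C, ∀ {b N : ℕ} {f : ℝ → ℝ} {D : ℝ} {σ : State},
    ConvexOn ℝ Set.univ f → PointList (σ.rarr 8) (σ.rarr 9) b N f D → σ.nreg 10 = b →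
    σ.nreg 11 = N → b + N ≤ σ.nreg 7 →
    Runs insertProg σ (C * (N + 1)) fun σ' =>
      PointList (σ'.rarr 8) (σ'.rarr 9) (σ'.nreg 10) (σ'.nreg 11)
        (fun z => max (f z) (σ.rreg 2 * z + σ.rreg 3)) D ∧
      (∀ k < σ.nreg 7, σ'.rarr 8 k = σ.rarr 8 k) ∧ (∀ k < σ.nreg 7, σ'.rarr 9 k = σ.rarr 9 k) ∧
      σ'.nreg 10 = σ.nreg 7 ∧ σ'.nreg 7 = σ'.nreg 10 + σ'.nreg 11 ∧ σ'.nreg 11 ≤ N + 2 := by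
  refine ⟨insertBody.size + 100, ?_⟩
  intro b N f D σ hf hL h10 h11 hfp
  have hp := hL.pos
  have hloop := Runs.for_loop (b := .nle (.add (.reg 12) (.const 1)) (.reg 11)) (p := insertBody)
    (T := insertBody.size)
    (I := InsertInv (σ.rarr 8) (σ.rarr 9) b N (σ.nreg 7) f (σ.rreg 2) (σ.rreg 3)) (N := N) (k := 0)
    (σ := (Prog.setN 13 (.const 0)).run ((Prog.setN 12 (.const 0)).run σ))
    (fun k σ _ h => by simp only [Test.holds, NExpr.eval, h.n12, h.n11]; omega)
    (fun k σ hk h => insertBody_runs hf hL hfp hk h) (Nat.zero_le N)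
    (by
      constructor <;> simp [Prog.run, h10, h11]
      exact ⟨Nat.zero_le _, by simp, by simp⟩)
  obtain ⟨σ₁, t₁, e₁, ht₁, hI⟩ := hloop
  obtain ⟨t₂, ht₂, e₂⟩ := (Prog.setN 12 (.const 0)).exec_run rfl σ
  obtain ⟨t₃, ht₃, e₃⟩ := (Prog.setN 13 (.const 0)).exec_run rfl
    ((Prog.setN 12 (.const 0)).run σ)
  set last : Prog := .seq (.setN 10 (.reg 7)) <|
    .seq (.setN 11 (.reg 13)) <| .setN 7 (.add (.reg 7) (.reg 13)) with hlast
  obtain ⟨t₄, ht₄, e₄⟩ := last.exec_run rfl σ₁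
  refine ⟨_, _, e₂.seq (e₃.seq (e₁.seq e₄)), ?_, ?_⟩
  · simp only [Prog.size, NExpr.cost, Test.cost, hlast, Nat.sub_zero] at *
    generalize insertBody.size = S at *
    nlinarith
  · obtain ⟨m, hm, hc⟩ := hI.count
    obtain ⟨D', hl, -, hD⟩ := hI.list hp
    rw [hD rfl, hL.last] at hl
    simp only [hlast, Prog.run, NExpr.eval]
    simp [hI.n7]
    exact ⟨hl, hI.memX, hI.memY, by have := hc.1; omega⟩

/-! ### Building all envelopes -/

/-- The data of the envelopes are in memory. -/
structure BuildInput (B : Envelope) (D : ℝ) (σ : State) : Prop where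
  n : σ.nreg 0 = B.n
  i : σ.nreg 3 = B.i
  lo : σ.nreg 4 = B.lo
  hi : σ.nreg 5 = B.hi
  f : σ.nreg 6 = B.f
  D : σ.rreg 1 = D
  x : ∀ t ≤ B.n, σ.rarr 5 t = B.x t
  W : ∀ t ≤ B.n, σ.rarr 6 t = B.W t
  c : ∀ e < B.n, σ.rarr 7 e = B.c e

/-- The parts of the memory that hold the data are left alone. -/
def Prog.keepsBuild (p : Prog) : Bool :=
  !(p.writesN 0 || p.writesN 3 || p.writesN 4 || p.writesN 5 || p.writesN 6 || p.writesR 1 ||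
    p.storesR 5 || p.storesR 6 || p.storesR 7)

theorem BuildInput.frame {B : Envelope} {D : ℝ} {σ σ' : State} {p : Prog}
    (h : BuildInput B D σ) (F : Frame p σ σ') (hp : p.keepsBuild = true) : BuildInput B D σ' := by
  simp only [Prog.keepsBuild, Bool.not_eq_true', Bool.or_eq_false_iff] at hp
  obtain ⟨⟨⟨⟨⟨⟨⟨⟨h0, h3⟩, h4⟩, h5⟩, h6⟩, h1⟩, a5⟩, a6⟩, a7⟩ := hp
  obtain ⟨e1, e2, e3, e4, e5, e6, e7, e8, e9⟩ := h
  exact ⟨by rw [F.nreg _ h0, e1], by rw [F.nreg _ h3, e2], by rw [F.nreg _ h4, e3],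
    by rw [F.nreg _ h5, e4], by rw [F.nreg _ h6, e5], by rw [F.rreg _ h1, e6],
    by rwa [F.rarr _ a5], by rwa [F.rarr _ a6], by rwa [F.rarr _ a7]⟩

/-- `-x[t] + W[t] / c[e]` -/
def termExpr : RExpr :=
  .add (.sub (.const 0) (.read 5 (.reg 9))) (.div (.read 6 (.reg 9)) (.read 7 (.reg 8)))

/-- The vertex `nreg 9` counts. -/
def actTest : Test :=
  .and (.nle (.reg 4) (.reg 9)) <| .and (.nle (.reg 9) (.reg 5)) <|
    .not (.and (.rle (.read 6 (.reg 9)) (.const 0))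
      (.not (.and (.nle (.const 1) (.reg 6)) (.nle (.reg 3) (.reg 9)))))

/-- Contribution of the vertex `nreg 9` to the lines of the edge `nreg 8`. -/
def lineBody : Prog :=
  .seq (.branch actTest
    (.branch (.nle (.reg 3) (.reg 9))
      (.seq (maxR 5 termExpr) (.setR 6 (.div (.const 1) (.read 7 (.reg 8)))))
      (maxR 4 termExpr))
    .nop) <|
  .setN 9 (.add (.reg 9) (.const 1))

/-- Invariant for the computation of the lines of an edge. -/
structure LineInv (B : Envelope) (D : ℝ) (e T : ℕ) (σ : State) : Prop where
  input : BuildInput B D σ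
  n8 : σ.nreg 8 = e
  n9 : σ.nreg 9 = T
  level : σ.rreg 4 = B.level e T
  intercept : σ.rreg 5 = B.intercept e T
  slope : σ.rreg 6 = B.slope e T

theorem lineBody_runs {B : Envelope} {D : ℝ} {e T : ℕ} {σ : State} (he : e < B.n) (hT : T ≤ e)
    (h : LineInv B D e T σ) : Runs lineBody σ lineBody.size (LineInv B D e (T + 1)) := by
  refine Runs.of_loopFree rfl ?_
  obtain ⟨hI, h8, h9, h4, h5, h6⟩ := h
  have hb := hI
  obtain ⟨e1, e2, e3, e4, e5, e6, e7, e8, e9⟩ := hI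
  have x1 := e7 T (by omega)
  have x2 := e8 T (by omega)
  have x3 := e9 e he
  have hact : actTest.holds σ ↔ B.Act T := by
    simp only [actTest, Test.holds, NExpr.eval, RExpr.eval, e2, e3, e4, e5, h9, x2, Envelope.Act,
      Rat.cast_zero]
    rw [not_and_or, not_not, not_le]
  have hkeep : lineBody.keepsBuild = true := rfl
  have hframe := lineBody.frame_run rfl σ
  have hin := hb.frame hframe hkeep
  refine ⟨hin, (hframe.nreg 8 rfl).trans h8, ?_, ?_, ?_, ?_⟩
  all_goals
    rw [lineBody, Prog.run]
    by_cases ha : B.Act T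
    · have ha' := hact.2 ha
      rw [Prog.run_branch_pos ha']
      by_cases hi : B.i ≤ T
      · have hi' : (Test.nle (.reg 3) (.reg 9)).holds σ := by
          simp only [Test.holds, NExpr.eval, e2, h9, hi]
        rw [Prog.run_branch_pos hi']
        simp [Prog.run, termExpr, h9, h8, x1, x2, x3, h4, h5, Envelope.level,
          Envelope.intercept, Envelope.slope, ha, hi, not_lt.2 hi]
      · have hi' : ¬ (Test.nle (.reg 3) (.reg 9)).holds σ := by
          simp only [Test.holds, NExpr.eval, e2, h9, hi, not_false_eq_true]
        rw [Prog.run_branch_neg hi']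
        simp [Prog.run, termExpr, h9, h8, x1, x2, x3, h4, h5, h6, Envelope.level,
          Envelope.intercept, Envelope.slope, ha, hi, not_le.1 hi]
    · have ha' := mt hact.1 ha
      rw [Prog.run_branch_neg ha']
      simp [Prog.run, h9, h4, h5, h6, Envelope.level,
          Envelope.intercept, Envelope.slope, ha]

/-- Initialize the lines of an edge. -/
def linePre : Prog :=
  .seq (.setR 4 (.sub (.const 0) (.read 5 (.reg 0)))) <|
  .seq (.setR 5 (.sub (.const 0) (.read 5 (.reg 0)))) <|
  .seq (.setR 6 (.const 0)) <|
  .setN 9 (.const 0)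

/-- Compute the two lines of the edge `nreg 8`. -/
def lineProg : Prog := .seq linePre (.loop (.nle (.reg 9) (.reg 8)) lineBody)

theorem lineProg_runs : ∃ C, ∀ {B : Envelope} {D : ℝ} {e : ℕ} {σ : State}, e < B.n →
    BuildInput B D σ → σ.nreg 8 = e →
    Runs lineProg σ (C * (B.n + 1)) (LineInv B D e (e + 1)) := by
  refine ⟨linePre.size + lineBody.size + 10, ?_⟩
  intro B D e σ he hI h8
  have h1 : Runs linePre σ linePre.size (LineInv B D e 0) := by
    refine Runs.of_loopFree rfl ?_
    have hframe := linePre.frame_run rfl σ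
    refine ⟨hI.frame hframe rfl, (hframe.nreg 8 rfl).trans h8, ?_, ?_, ?_, ?_⟩ <;>
      simp [linePre, Prog.run, Envelope.level, Envelope.intercept, Envelope.slope, hI.n,
        hI.x B.n le_rfl]
  have h2 := Runs.seq h1 fun σ' _ h => Runs.for_loop (b := .nle (.reg 9) (.reg 8)) (p := lineBody)
    (T := lineBody.size) (I := LineInv B D e) (N := e + 1) (k := 0)
    (fun k σ _ h => by simp only [Test.holds, NExpr.eval, h.n9, h.n8]; omega)
    (fun k σ hk h => lineBody_runs he (by omega) h) (Nat.zero_le _) h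
  refine h2.mono ?_ fun _ _ h => h
  simp only [Test.cost, NExpr.cost, Nat.sub_zero]
  generalize linePre.size = a
  generalize lineBody.size = b
  obtain ⟨d, hd⟩ : ∃ d, B.n = e + 1 + d := ⟨B.n - (e + 1), by omega⟩
  rw [hd]
  nlinarith [Nat.zero_le (a * d), Nat.zero_le (b * d), Nat.zero_le (a * e)]

/-- Start the memory of lists with the constant function `-x[n]`. -/
def startProg : Prog :=
  .seq (.storeR 8 (.reg 7) (.const 0)) <|
  .seq (.storeR 9 (.reg 7) (.sub (.const 0) (.read 5 (.reg 0)))) <|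
  .seq (.setN 10 (.reg 7)) <|
  .seq (.setN 11 (.const 1)) <|
  .seq (.branch (.rle (.reg 1) (.const 0)) .nop
    (.seq (.storeR 8 (.add (.reg 7) (.const 1)) (.reg 1)) <|
     .seq (.storeR 9 (.add (.reg 7) (.const 1)) (.sub (.const 0) (.read 5 (.reg 0)))) <|
     .setN 11 (.const 2))) <|
  .seq (.setN 7 (.add (.reg 7) (.reg 11))) <|
  .seq (.setN 8 (.const 0)) <|
  .seq (.storeN 0 (.const 0) (.reg 10)) <|
  .storeN 1 (.const 0) (.reg 11)

/-- Add the lines of the next edge. -/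
def edgeBody : Prog :=
  .seq lineProg <|
  .seq (.seq (.setR 2 (.const 0)) (.setR 3 (.reg 4))) <|
  .seq insertProg <|
  .seq (.seq (.setR 2 (.reg 6)) (.setR 3 (.reg 5))) <|
  .seq insertProg <|
  .seq (.setN 8 (.add (.reg 8) (.const 1))) <|
  .seq (.storeN 0 (.reg 8) (.reg 10)) <|
  .storeN 1 (.reg 8) (.reg 11)

/-- Build the lists of all envelopes; list `m` starts at `narr 0 m` and has length `narr 1 m`. -/
def buildProg : Prog :=
  .seq startProg (.loop (.nle (.add (.reg 8) (.const 1)) (.reg 0)) edgeBody)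

/-- The lists of the envelopes up to `e` are in memory, between `fp` and `nreg 7`. -/
structure Built (B : Envelope) (D : ℝ) (fp e : ℕ) (base len : ℕ → ℕ) (σ : State) : Prop where
  list : ∀ m ≤ e, PointList (σ.rarr 8) (σ.rarr 9) (base m) (len m) (B.env m) D
  size : ∀ m ≤ e, len m ≤ 2 + 4 * m
  bound : ∀ m ≤ e, base m + len m ≤ σ.nreg 7
  fp_le : fp ≤ σ.nreg 7

/-- Invariant of the construction. -/
structure BuildInv (B : Envelope) (D : ℝ) (fp : ℕ) (X Y : ℕ → ℝ) (e : ℕ) (σ : State) : Prop where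
  input : BuildInput B D σ
  n8 : σ.nreg 8 = e
  n10 : σ.nreg 10 = σ.narr 0 e
  n11 : σ.nreg 11 = σ.narr 1 e
  built : Built B D fp e (σ.narr 0) (σ.narr 1) σ
  memX : ∀ k < fp, σ.rarr 8 k = X k
  memY : ∀ k < fp, σ.rarr 9 k = Y k

theorem startProg_runs {B : Envelope} {D : ℝ} {σ : State} (hD : 0 ≤ D) (hI : BuildInput B D σ) :
    Runs startProg σ startProg.size
      (BuildInv B D (σ.nreg 7) (σ.rarr 8) (σ.rarr 9) 0) := by
  refine Runs.of_loopFree rfl ?_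
  have hframe := startProg.frame_run rfl σ
  have h1 := PointList.single (σ.rarr 8) (σ.rarr 9) (σ.nreg 7) (B.env 0)
  have hx := hI.x B.n le_rfl
  -- Abscissae increase strictly, so the constant function is given by one point if D = 0 and by two
  -- points otherwise.
  rcases hD.eq_or_lt with rfl | hD'
  · refine ⟨hI.frame hframe rfl, ?_, ?_, ?_, ⟨?_, ?_, ?_, ?_⟩, ?_, ?_⟩ <;>
      simp [startProg, Prog.run, hI.n, hI.D, hx]
    · simpa [Envelope.env] using h1
    · intro k hk; rw [Function.update_of_ne (by omega)]
    · intro k hk; rw [Function.update_of_ne (by omega)]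
  · have h2 := h1.push hD' (AffOn.of_line (m := 0) (k := -B.x B.n) hD'.le (by simp [Envelope.env]))
    have hD'' := not_le.2 hD'
    refine ⟨hI.frame hframe rfl, ?_, ?_, ?_, ⟨?_, ?_, ?_, ?_⟩, ?_, ?_⟩ <;>
      simp [startProg, Prog.run, hI.n, hI.D, hx, hD'']
    · simpa [Envelope.env] using h2
    · intro k hk; rw [Function.update_of_ne (by omega), Function.update_of_ne (by omega)]
    · intro k hk; rw [Function.update_of_ne (by omega), Function.update_of_ne (by omega)]

/-- Finding the two lines of the edge and inserting them into a list of O(n) points is linear in n.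
Each new list is appended behind the old ones and its place recorded, so the envelopes of all
initial sets of edges stay available. -/
theorem edgeBody_runs : ∃ C, ∀ {B : Envelope} {D : ℝ} {fp : ℕ} {X Y : ℕ → ℝ} {e : ℕ} {σ : State},
    e < B.n → BuildInv B D fp X Y e σ →
    Runs edgeBody σ (C * (B.n + 1)) (BuildInv B D fp X Y (e + 1)) := by
  obtain ⟨C₁, hC₁⟩ := lineProg_runs
  obtain ⟨C₂, hC₂⟩ := insertProg_runs
  refine ⟨C₁ + 20 * C₂ + 100, ?_⟩
  intro B D fp X Y e σ he h
  obtain ⟨hI, h8, h10, h11, ⟨hlist, hsize, hbound, hfp⟩, hX, hY⟩ := h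
  have hs0 := hsize e le_rfl
  have key : Runs edgeBody σ (C₁ * (B.n + 1) + (4 + (C₂ * (4 * B.n + 10) + (4 +
      (C₂ * (4 * B.n + 10) + 10))))) (BuildInv B D fp X Y (e + 1)) := by
    refine (hC₁ he hI h8).seq fun σ₁ F₁ L₁ => ?_
    refine (Runs.of_loopFree (Q := fun σ' => σ'.rreg 2 = 0 ∧ σ'.rreg 3 = B.level e (e + 1)) rfl
      (by simp [Prog.run, L₁.level])).seq fun σ₂ F₂ L₂ => ?_
    have f2 : ∀ r, σ₂.nreg r = σ₁.nreg r := fun r => F₂.nreg r rfl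
    have g2 : ∀ r, σ₂.rarr r = σ₁.rarr r := fun r => F₂.rarr r rfl
    have n10 : σ₂.nreg 10 = σ.narr 0 e := by rw [f2, F₁.nreg 10 rfl, h10]
    have n11 : σ₂.nreg 11 = σ.narr 1 e := by rw [f2, F₁.nreg 11 rfl, h11]
    have n7 : σ₂.nreg 7 = σ.nreg 7 := by rw [f2, F₁.nreg 7 rfl]
    have X2 : σ₂.rarr 8 = σ.rarr 8 := by rw [g2, F₁.rarr 8 rfl]
    have Y2 : σ₂.rarr 9 = σ.rarr 9 := by rw [g2, F₁.rarr 9 rfl]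
    have i3 := hC₂ (σ := σ₂) (Envelope.env_convex e) (by rw [X2, Y2]; exact hlist e le_rfl) n10 n11
      (by rw [n7]; exact hbound e le_rfl)
    refine (i3.mono (T' := C₂ * (4 * B.n + 10)) (Nat.mul_le_mul_left _ (by omega)) fun _ _ h => h).seq
      fun σ₃ F₃ L₃ => ?_
    obtain ⟨p3, x3, y3, b3, c3, d3⟩ := L₃
    rw [L₂.1, L₂.2] at p3
    rw [n7] at x3 y3 b3
    rw [X2] at x3
    rw [Y2] at y3
    refine (Runs.of_loopFree (Q := fun σ' => σ'.rreg 2 = B.slope e (e + 1) ∧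
      σ'.rreg 3 = B.intercept e (e + 1)) rfl (by
        have q5 : σ₃.rreg 5 = σ₁.rreg 5 := by rw [F₃.rreg 5 rfl, F₂.rreg 5 rfl]
        have q6 : σ₃.rreg 6 = σ₁.rreg 6 := by rw [F₃.rreg 6 rfl, F₂.rreg 6 rfl]
        simp [Prog.run, q5, q6, L₁.intercept, L₁.slope])).seq fun σ₄ F₄ L₄ => ?_
    have f4 : ∀ r, σ₄.nreg r = σ₃.nreg r := fun r => F₄.nreg r rfl
    have g4 : ∀ r, σ₄.rarr r = σ₃.rarr r := fun r => F₄.rarr r rfl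
    have i5 := hC₂ (σ := σ₄) ((Envelope.env_convex e).sup (Envelope.convexOn_line 0 _))
      (by rw [g4, g4]; exact p3) (f4 10) (f4 11) (by rw [f4, c3])
    refine (i5.mono (T' := C₂ * (4 * B.n + 10)) (Nat.mul_le_mul_left _ (by omega)) fun _ _ h => h).seq
      fun σ₅ F₅ L₅ => ?_
    obtain ⟨p5, x5, y5, b5, c5, d5⟩ := L₅
    rw [L₄.1, L₄.2] at p5
    rw [f4, c3] at x5 y5 b5
    rw [g4] at x5 y5
    have X5 : ∀ k < σ.nreg 7, σ₅.rarr 8 k = σ.rarr 8 k := fun k hk => by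
      rw [x5 k (by omega), x3 k hk]
    have Y5 : ∀ k < σ.nreg 7, σ₅.rarr 9 k = σ.rarr 9 k := fun k hk => by
      rw [y5 k (by omega), y3 k hk]
    have A0 : σ₅.narr 0 = σ.narr 0 := by
      rw [F₅.narr 0 rfl, F₄.narr 0 rfl, F₃.narr 0 rfl, F₂.narr 0 rfl, F₁.narr 0 rfl]
    have A1 : σ₅.narr 1 = σ.narr 1 := by
      rw [F₅.narr 1 rfl, F₄.narr 1 rfl, F₃.narr 1 rfl, F₂.narr 1 rfl, F₁.narr 1 rfl]
    have hin := (((L₁.input.frame F₂ rfl).frame F₃ rfl).frame F₄ rfl).frame F₅ rfl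
    have n8 : σ₅.nreg 8 = e := by
      rw [F₅.nreg 8 rfl, F₄.nreg 8 rfl, F₃.nreg 8 rfl, F₂.nreg 8 rfl, L₁.n8]
    set last : Prog := .seq (.setN 8 (.add (.reg 8) (.const 1))) <|
      .seq (.storeN 0 (.reg 8) (.reg 10)) <| .storeN 1 (.reg 8) (.reg 11) with hlast
    have hframe := last.frame_run rfl σ₅
    refine Runs.of_loopFree rfl ?_
    have hd : σ₅.nreg 11 ≤ 2 + 4 * (e + 1) := by omega
    refine ⟨hin.frame hframe rfl, ?_, ?_, ?_, ⟨?_, ?_, ?_, ?_⟩, ?_, ?_⟩ <;>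
      simp [hlast, Prog.run, n8, A0, A1]
    · intro m hm
      rcases Nat.le_succ_iff.1 hm with hm | rfl
      · rw [Function.update_of_ne (by omega), Function.update_of_ne (by omega)]
        have := hbound m hm
        exact (hlist m hm).congr (fun k hk => X5 k (by omega)) fun k hk => Y5 k (by omega)
      · rw [Function.update_self, Function.update_self]
        exact p5
    · intro m hm
      rcases Nat.le_succ_iff.1 hm with hm | rfl
      · rw [Function.update_of_ne (by omega)]; exact hsize m hm
      · rw [Function.update_self]; exact hd
    · intro m hm
      rcases Nat.le_succ_iff.1 hm with hm | rfl
      · rw [Function.update_of_ne (by omega), Function.update_of_ne (by omega)]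
        have := hbound m hm
        omega
      · rw [Function.update_self, Function.update_self, c5]
    · omega
    · intro k hk; rw [X5 k (by omega), hX k hk]
    · intro k hk; rw [Y5 k (by omega), hY k hk]
  refine key.mono ?_ fun _ _ h => h
  nlinarith

theorem buildProg_runs : ∃ C, ∀ {B : Envelope} {D : ℝ} {σ : State}, 0 ≤ D → BuildInput B D σ →
    Runs buildProg σ (C * (B.n + 1) ^ 2)
      (BuildInv B D (σ.nreg 7) (σ.rarr 8) (σ.rarr 9) B.n) := by
  obtain ⟨C, hC⟩ := edgeBody_runs
  refine ⟨C + startProg.size + 10, ?_⟩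
  intro B D σ hD hI
  have h2 := (startProg_runs hD hI).seq fun σ' _ h => Runs.for_loop
    (b := .nle (.add (.reg 8) (.const 1)) (.reg 0)) (p := edgeBody)
    (T := C * (B.n + 1)) (I := BuildInv B D (σ.nreg 7) (σ.rarr 8) (σ.rarr 9)) (N := B.n) (k := 0)
    (fun k σ _ h => by simp only [Test.holds, NExpr.eval, h.input.n, h.n8]; omega)
    (fun k σ hk h => hC hk h) (Nat.zero_le _) h
  refine h2.mono ?_ fun _ _ h => h
  simp only [Test.cost, NExpr.cost, Nat.sub_zero]
  generalize startProg.size = a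
  nlinarith [Nat.zero_le (a * B.n), Nat.zero_le (a * (B.n * B.n)), Nat.zero_le (B.n * B.n),
    Nat.zero_le (C * B.n)]

/-! ### Scanning pairs of lists -/

/-- Parameters of a scan: the two lists, the list of the objective, and the constants. -/
structure ScanArgs where
  bx : ℕ
  nx : ℕ
  bz : ℕ
  nz : ℕ
  bm : ℕ
  nm : ℕ
  cX : ℝ
  cY : ℝ
  s : ℝ
  x : ℝ
  X : ℕ → ℝ
  Y : ℕ → ℝ

/-- The parameters are in memory. -/
structure ScanInput (c : ScanArgs) (σ : State) : Prop where
  bx : σ.nreg 14 = c.bx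
  nx : σ.nreg 15 = c.nx
  bz : σ.nreg 16 = c.bz
  nz : σ.nreg 17 = c.nz
  bm : σ.nreg 18 = c.bm
  nm : σ.nreg 19 = c.nm
  cX : σ.rreg 14 = c.cX
  cY : σ.rreg 15 = c.cY
  s : σ.rreg 16 = c.s
  x : σ.rreg 22 = c.x
  X : σ.rarr 8 = c.X
  Y : σ.rarr 9 = c.Y

/-- The parameters of a scan are left alone. -/
def Prog.keepsScan (p : Prog) : Bool :=
  !(p.writesN 14 || p.writesN 15 || p.writesN 16 || p.writesN 17 || p.writesN 18 || p.writesN 19 ||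
    p.writesR 14 || p.writesR 15 || p.writesR 16 || p.writesR 22 || p.storesR 8 || p.storesR 9)

theorem ScanInput.frame {c : ScanArgs} {σ σ' : State} {p : Prog} (h : ScanInput c σ)
    (F : Frame p σ σ') (hp : p.keepsScan = true) : ScanInput c σ' := by
  simp only [Prog.keepsScan, Bool.not_eq_true', Bool.or_eq_false_iff] at hp
  obtain ⟨⟨⟨⟨⟨⟨⟨⟨⟨⟨⟨h1, h2⟩, h3⟩, h4⟩, h5⟩, h6⟩, h7⟩, h8⟩, h9⟩, h10⟩, h11⟩, h12⟩ := hp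
  obtain ⟨e1, e2, e3, e4, e5, e6, e7, e8, e9, e10, e11, e12⟩ := h
  exact ⟨by rw [F.nreg _ h1, e1], by rw [F.nreg _ h2, e2], by rw [F.nreg _ h3, e3],
    by rw [F.nreg _ h4, e4], by rw [F.nreg _ h5, e5], by rw [F.nreg _ h6, e6],
    by rw [F.rreg _ h7, e7], by rw [F.rreg _ h8, e8], by rw [F.rreg _ h9, e9],
    by rw [F.rreg _ h10, e10], by rw [F.rarr _ h11, e11], by rw [F.rarr _ h12, e12]⟩

/-- The best value found so far, if any, is at most `V`. -/
def Below (σ : State) (V : ℝ) : Prop := 1 ≤ σ.nreg 24 → σ.rreg 17 ≤ V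

/-- A value of at least `v` has been found. -/
def Above (σ : State) (v : ℝ) : Prop := 1 ≤ σ.nreg 24 ∧ v ≤ σ.rreg 17

theorem Above.mono {σ : State} {v v' : ℝ} (h : Above σ v) (hv : v' ≤ v) : Above σ v' :=
  ⟨h.1, hv.trans h.2⟩

/-- Index of the current point in the first list. -/
def idxX : NExpr := .add (.reg 14) (.reg 20)
/-- Index of the current point in the second list. -/
def idxZ : NExpr := .add (.reg 16) (.reg 21)
/-- Index of the current point in the list of the objective. -/
def idxM : NExpr := .add (.reg 18) (.reg 22)
/-- The next index. -/
def NExpr.succ (e : NExpr) : NExpr := .add e (.const 1)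

/-- Value of the current candidate. -/
def valueProg : Prog :=
  .seq (.branch (.nle (.add (.reg 22) (.const 2)) (.reg 19))
    (.setR 24 (.add (.read 9 idxM) (.mul (.sub (.reg 20) (.read 8 idxM))
      (.div (.sub (.read 9 idxM.succ) (.read 9 idxM)) (.sub (.read 8 idxM.succ) (.read 8 idxM))))))
    (.setR 24 (.read 9 idxM))) <|
  .seq (.setR 24 (.add (.reg 22) (.reg 24))) <|
  .seq (maxR 24 (.const 0)) <|
  .seq (.setR 21 (.add (.reg 14) (.read 9 idxX))) <|
  .seq (maxR 21 (.add (.reg 15) (.read 9 idxZ))) <|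
  .seq (maxR 21 (.const 0)) <|
  .seq (maxR 21 (.div (.add (.add (.read 9 idxX) (.read 9 idxZ)) (.reg 16)) (.const 2))) <|
  .setR 24 (.sub (.reg 24) (.reg 21))

/-- Compare the value of the current candidate with the best one. -/
def compareProg : Prog :=
  .seq (.branch (.and (.nle (.const 1) (.reg 24)) (.rle (.reg 24) (.reg 17))) .nop
    (.seq (.setR 17 (.reg 24)) (.setN 24 (.const 1)))) <|
  .setN 20 (.add (.reg 20) (.const 1))

/-- Having computed the second weight, advance in the list of the objective or record. -/
def tailProg : Prog :=
  .seq (.setR 20 (.add (.read 8 idxX) (.reg 19))) <|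
  .branch (.and (.nle (.add (.reg 22) (.const 2)) (.reg 19))
    (.not (.rle (.reg 20) (.read 8 idxM.succ))))
    (.setN 22 (.add (.reg 22) (.const 1)))
    (.seq valueProg compareProg)

/-- Value of the pair `(a, b)` for the total weight `ω`. -/
noncomputable def ScanArgs.value (c : ScanArgs) (mf : ℝ → ℝ) (ω : ℝ) (a b : ℕ) : ℝ :=
  max 0 (c.x + mf ω) - max (max 0 (max (c.cX + c.Y (c.bx + a)) (c.cY + c.Y (c.bz + b))))
    ((c.Y (c.bx + a) + c.Y (c.bz + b) + c.s) / 2)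

section Tail

variable {c : ScanArgs} {mf : ℝ → ℝ} {D : ℝ} {σ : State}

theorem tailProg_advance (hI : ScanInput c σ)
    (h : σ.nreg 22 + 2 ≤ c.nm ∧
      c.X (c.bm + σ.nreg 22 + 1) < c.X (c.bx + σ.nreg 20) + σ.rreg 19) :
    (tailProg.run σ).nreg 20 = σ.nreg 20 ∧ (tailProg.run σ).nreg 21 = σ.nreg 21 ∧
    (tailProg.run σ).nreg 22 = σ.nreg 22 + 1 ∧ (tailProg.run σ).nreg 24 = σ.nreg 24 ∧
    (tailProg.run σ).rreg 17 = σ.rreg 17 := by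
  simp [tailProg, Prog.run, idxX, idxM, NExpr.succ, hI.nm, hI.bm, hI.bx, hI.X, h.1, h.2]

/-- By `h` and `hlow`, the total weight lies on the segment that starts at the pointer into the list
of the objective, or the pointer is at the last point. Either way the interpolated value is exact.
-/
theorem tailProg_record (hI : ScanInput c σ)
    (h : ¬ (σ.nreg 22 + 2 ≤ c.nm ∧
      c.X (c.bm + σ.nreg 22 + 1) < c.X (c.bx + σ.nreg 20) + σ.rreg 19))
    (hm : PointList c.X c.Y c.bm c.nm mf D) (hmn : σ.nreg 22 < c.nm)
    (hω : c.X (c.bx + σ.nreg 20) + σ.rreg 19 ≤ D)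
    (hlow : c.X (c.bm + σ.nreg 22) ≤ c.X (c.bx + σ.nreg 20) + σ.rreg 19) :
    (tailProg.run σ).nreg 20 = σ.nreg 20 + 1 ∧ (tailProg.run σ).nreg 21 = σ.nreg 21 ∧
    (tailProg.run σ).nreg 22 = σ.nreg 22 ∧
    (∀ V, Below σ V → c.value mf (c.X (c.bx + σ.nreg 20) + σ.rreg 19) (σ.nreg 20) (σ.nreg 21) ≤ V →
      Below (tailProg.run σ) V) ∧
    (∀ v, Above σ v → Above (tailProg.run σ) v) ∧
    Above (tailProg.run σ)
      (c.value mf (c.X (c.bx + σ.nreg 20) + σ.rreg 19) (σ.nreg 20) (σ.nreg 21)) := by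
  set ω := c.X (c.bx + σ.nreg 20) + σ.rreg 19 with hωdef
  set m := σ.nreg 22 with hmdef
  -- the objective
  have hM : (m + 2 ≤ c.nm → c.Y (c.bm + m) + (ω - c.X (c.bm + m)) *
      ((c.Y (c.bm + m + 1) - c.Y (c.bm + m)) / (c.X (c.bm + m + 1) - c.X (c.bm + m))) = mf ω) ∧
      (¬ m + 2 ≤ c.nm → c.Y (c.bm + m) = mf ω) := by
    constructor
    · intro h2
      have hle : ω ≤ c.X (c.bm + m + 1) := by
        by_contra hlt
        exact h ⟨h2, not_le.1 hlt⟩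
      have := hm.segment (a := m) h2 _ _ le_rfl (hm.step m h2).le hlow hle
      rw [this, hm.val m hmn, segSlope, hm.val m hmn]
      ring
    -- At the last point, `hω` and `hlow` leave only ω = D.
    · intro h2
      have e : m = c.nm - 1 := by omega
      have hl := hm.last
      rw [← e] at hl
      rw [hm.val m hmn, le_antisymm hω (hl ▸ hlow), hl]
  have hrun : ∃ σ', σ'.nreg = σ.nreg ∧ σ'.rreg 17 = σ.rreg 17 ∧
      σ'.rreg 24 = c.value mf ω (σ.nreg 20) (σ.nreg 21) ∧
      tailProg.run σ = compareProg.run σ' := by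
    have htest : ¬ (Test.and (.nle (.add (.reg 22) (.const 2)) (.reg 19))
        (.not (.rle (.reg 20) (.read 8 idxM.succ)))).holds (σ.setR 20 ω) := by
      simp only [Test.holds, NExpr.eval, RExpr.eval, idxM, NExpr.succ, State.setR_nreg,
        State.setR_rreg, State.setR_rarr, hI.nm, hI.bm, hI.X, not_le]
      exact h
    have h1 : tailProg.run σ = compareProg.run (valueProg.run (σ.setR 20 ω)) := by
      rw [tailProg, Prog.run]
      have : (Prog.setR 20 (.add (.read 8 idxX) (.reg 19))).run σ = σ.setR 20 ω := by
        simp [Prog.run, idxX, hI.bx, hI.X, hωdef]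
      rw [this, Prog.run_branch_neg htest, Prog.run]
    refine ⟨_, ?_, ?_, ?_, h1⟩
    · by_cases h2 : m + 2 ≤ c.nm <;>
        simp [valueProg, Prog.run, hI.nm, ← hmdef, h2]
    · by_cases h2 : m + 2 ≤ c.nm <;>
        simp [valueProg, Prog.run, hI.nm, ← hmdef, h2]
    · by_cases h2 : m + 2 ≤ c.nm
      · have hM' := hM.1 h2
        simp [valueProg, Prog.run, idxX, idxZ, idxM, NExpr.succ, hI.nm, hI.bm, hI.bx, hI.bz,
          hI.X, hI.Y, hI.cX, hI.cY, hI.s, hI.x, ← hmdef, h2, hM', ScanArgs.value]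
        simp only [max_comm]
      · have hM' := hM.2 h2
        simp [valueProg, Prog.run, idxX, idxZ, idxM, hI.nm, hI.bm, hI.bx, hI.bz,
          hI.Y, hI.cX, hI.cY, hI.s, hI.x, ← hmdef, h2, hM', ScanArgs.value]
        simp only [max_comm]
  obtain ⟨σ', hn, h17, h24, hrun⟩ := hrun
  rw [hrun]
  set v := c.value mf ω (σ.nreg 20) (σ.nreg 21)
  rw [compareProg, Prog.run]
  by_cases ht : (Test.and (.nle (.const 1) (.reg 24)) (.rle (.reg 24) (.reg 17))).holds σ'
  · rw [Prog.run_branch_pos ht]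
    simp only [Test.holds, NExpr.eval, RExpr.eval, hn, h17, h24] at ht
    refine ⟨by simp [Prog.run, hn], by simp [Prog.run, hn], by simp [Prog.run, hn, hmdef],
      fun V h1 _ => ?_, fun w h1 => ?_, ?_⟩ <;> simp [Prog.run, Below, Above, hn, h17] at *
    · exact h1
    · exact h1
    · exact ht
  · rw [Prog.run_branch_neg ht]
    simp only [Test.holds, NExpr.eval, RExpr.eval, hn, h17, h24, not_and, not_le] at ht
    refine ⟨by simp [Prog.run, hn], by simp [Prog.run, hn], by simp [Prog.run, hn, hmdef],
      fun V _ h1 => ?_, fun w h1 => ?_, ?_⟩ <;> simp [Prog.run, Below, Above, h24] at *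
    · exact h1
    · exact h1.2.trans (ht h1.1).le

end Tail

/-- One step of a scan: advance in the second list, or compute the second weight and go on. -/
def scanBody (pre : RExpr) (T : Test) (beta : Prog) : Prog :=
  .seq (.setR 18 pre)
    (.branch T (.setN 21 (.add (.reg 21) (.const 1))) (.seq beta tailProg))

/-- There is a current point in the first list. -/
def scanTest : Test := .nle (.add (.reg 20) (.const 1)) (.reg 15)

/-- Scan of a pair of lists. -/
def scanProg (pre : RExpr) (T : Test) (beta : Prog) : Prog :=
  .seq (.setN 20 (.const 0)) <| .seq (.setN 21 (.const 0)) <| .seq (.setN 22 (.const 0)) <|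
    .loop scanTest (scanBody pre T beta)

theorem ScanInput.setR {c : ScanArgs} {σ : State} (h : ScanInput c σ) {r : ℕ} {v : ℝ}
    (hr : r = 18 ∨ r = 19) : ScanInput c (σ.setR r v) := by
  obtain ⟨e1, e2, e3, e4, e5, e6, e7, e8, e9, e10, e11, e12⟩ := h
  rcases hr with rfl | rfl <;>
    exact ⟨e1, e2, e3, e4, e5, e6, by simp [e7], by simp [e8], by simp [e9], by simp [e10],
      e11, e12⟩

theorem ScanInput.setN {c : ScanArgs} {σ : State} (h : ScanInput c σ) {r : ℕ} {v : ℕ}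
    (hr : r = 20 ∨ r = 21 ∨ r = 22) : ScanInput c (σ.setN r v) := by
  obtain ⟨e1, e2, e3, e4, e5, e6, e7, e8, e9, e10, e11, e12⟩ := h
  rcases hr with rfl | rfl | rfl <;>
    exact ⟨by simp [e1], by simp [e2], by simp [e3], by simp [e4], by simp [e5], by simp [e6],
      e7, e8, e9, e10, e11, e12⟩

/-- What a scan achieves: only candidate values are recorded, earlier results are kept, and every
point of the first list has its candidate recorded. -/
structure Scanned (c : ScanArgs) (v : ℕ → ℕ → ℝ) (R : ℕ → ℕ → Prop) (σ σ' : State) : Prop where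
  below : ∀ V, Below σ V → (∀ a < c.nx, ∀ b < c.nz, R a b → v a b ≤ V) → Below σ' V
  above : ∀ w, Above σ w → Above σ' w
  done : ∀ a < c.nx, ∃ b < c.nz, R a b ∧ Above σ' (v a b)

/-- A common frame for both scans: `Adv` tells when the pointer into the second list has to move on,
`J` is an invariant of the pair of pointers, and `β` is the second weight. Each iteration moves
exactly one of three pointers forward, so there are at most nx + nz + nm iterations. The pointer
into the list of the objective never has to go back because the total weight does not decrease along
the scan; this is what `hmono` is for. -/
theorem scanProg_runs {c : ScanArgs} {pre : RExpr} {T : Test} {beta : Prog}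
    (hbeta : beta.loopFree = true)
    {mf : ℝ → ℝ} {D : ℝ} {Adv J : ℕ → ℕ → Prop} {β : ℕ → ℕ → ℝ}
    (hm : PointList c.X c.Y c.bm c.nm mf D)
    (hstep : ∀ a, a + 1 < c.nx → c.X (c.bx + a) ≤ c.X (c.bx + a + 1))
    (hx0 : ∀ a < c.nx, 0 ≤ c.X (c.bx + a)) (hz : 0 < c.nz)
    (hβ0 : ∀ a < c.nx, ∀ b < c.nz, J a b → ¬ Adv a b → 0 ≤ β a b)
    (hβD : ∀ a < c.nx, ∀ b < c.nz, J a b → ¬ Adv a b → c.X (c.bx + a) + β a b ≤ D)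
    (hT : ∀ σ, ScanInput c σ → σ.nreg 20 < c.nx → σ.nreg 21 < c.nz →
      (T.holds (σ.setR 18 (pre.eval σ)) ↔ Adv (σ.nreg 20) (σ.nreg 21)))
    (hβ : ∀ σ, ScanInput c σ → σ.nreg 20 < c.nx → σ.nreg 21 < c.nz →
      ¬ Adv (σ.nreg 20) (σ.nreg 21) → beta.run (σ.setR 18 (pre.eval σ)) =
        (σ.setR 18 (pre.eval σ)).setR 19 (β (σ.nreg 20) (σ.nreg 21)))
    (hJ0 : J 0 0)
    (hJb : ∀ a < c.nx, ∀ b < c.nz, J a b → Adv a b → b + 1 < c.nz ∧ J a (b + 1))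
    (hJa : ∀ a, a + 1 < c.nx → ∀ b < c.nz, J a b → J (a + 1) b)
    (hmono : ∀ a a' b b', a ≤ a' → a' < c.nx → b ≤ b' → b' < c.nz → J a b → ¬ Adv a b →
      J a' b' → ¬ Adv a' b' → β a b ≤ β a' b')
    {σ : State} (hI : ScanInput c σ) :
    Runs (scanProg pre T beta) σ
      (((c.nx + c.nz + c.nm) * ((scanBody pre T beta).size + scanTest.cost) + scanTest.cost) + 6)
      (Scanned c (fun a b => c.value mf (c.X (c.bx + a) + β a b) a b)
        (fun a b => J a b ∧ ¬ Adv a b) σ) := by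
  set v := fun a b => c.value mf (c.X (c.bx + a) + β a b) a b with hv
  -- Besides bookkeeping, the invariant says that the pointer into the list of the objective has not
  -- passed the total weight of any pair that can still be evaluated at the current first point.
  let I : State → Prop := fun τ => ScanInput c τ ∧ τ.nreg 20 ≤ c.nx ∧ τ.nreg 21 < c.nz ∧
    τ.nreg 22 < c.nm ∧
    (τ.nreg 20 < c.nx → J (τ.nreg 20) (τ.nreg 21) ∧
      ∀ b, τ.nreg 21 ≤ b → b < c.nz → J (τ.nreg 20) b → ¬ Adv (τ.nreg 20) b →
        c.X (c.bm + τ.nreg 22) ≤ c.X (c.bx + τ.nreg 20) + β (τ.nreg 20) b) ∧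
    (∀ V, Below σ V → (∀ a < c.nx, ∀ b < c.nz, J a b ∧ ¬ Adv a b → v a b ≤ V) → Below τ V) ∧
    (∀ w, Above σ w → Above τ w) ∧
    (∀ a < τ.nreg 20, ∃ b < c.nz, (J a b ∧ ¬ Adv a b) ∧ Above τ (v a b))
  have hlf : (scanBody pre T beta).loopFree = true := by
    simp [scanBody, Prog.loopFree, hbeta, tailProg, valueProg, compareProg, maxR]
  have hloop := fun ρ₀ : State => Runs.loop (σ := ρ₀) (b := scanTest) (p := scanBody pre T beta) (I := I)
    (φ := fun τ => τ.nreg 20 + τ.nreg 21 + τ.nreg 22) (N := c.nx + c.nz + c.nm)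
    (T := (scanBody pre T beta).size)
    (fun τ h => by obtain ⟨-, h1, h2, h3, -⟩ := h; omega) (by
      rintro τ ⟨hI, ha, hb, hmn, hJ, hbel, habo, hdone⟩ ht
      apply Runs.of_loopFree hlf
      simp only [scanTest, Test.holds, NExpr.eval, hI.nx] at ht
      have ha' : τ.nreg 20 < c.nx := ht
      obtain ⟨hJ1, hJ2⟩ := hJ ha'
      have hT1 := hT τ hI ha' hb
      have hrun : (scanBody pre T beta).run τ =
          (Prog.branch T (.setN 21 (.add (.reg 21) (.const 1))) (.seq beta tailProg)).run
            (τ.setR 18 (pre.eval τ)) := rfl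
      rw [hrun]
      by_cases hadv : Adv (τ.nreg 20) (τ.nreg 21)
      · rw [Prog.run_branch_pos (hT1.2 hadv)]
        obtain ⟨k1, k2⟩ := hJb _ ha' _ hb hJ1 hadv
        have e : (Prog.setN 21 (.add (.reg 21) (.const 1))).run (τ.setR 18 (pre.eval τ)) =
          (τ.setR 18 (pre.eval τ)).setN 21 (τ.nreg 21 + 1) := rfl
        rw [e]
        refine ⟨⟨(hI.setR (Or.inl rfl)).setN (by simp), by simpa using ha, by simpa using k1,
          by simpa using hmn, ?_, ?_, ?_, ?_⟩, ?_⟩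
        · intro _
          refine ⟨by simpa using k2, fun b h1 h2 h3 h4 => ?_⟩
          simp at h1 h3 h4 ⊢
          exact hJ2 b (by omega) h2 h3 h4
        · intro V h1 h2; simpa [Below] using hbel V h1 h2
        · intro V h1; simpa [Above] using habo V h1
        · simpa [Above] using hdone
        · simp
      · rw [Prog.run_branch_neg (fun h => hadv (hT1.1 h))]
        have hβ1 := hβ τ hI ha' hb hadv
        set b₀ := β (τ.nreg 20) (τ.nreg 21) with hb₀
        set ρ := (τ.setR 18 (pre.eval τ)).setR 19 b₀ with hρ
        have e : (Prog.seq beta tailProg).run (τ.setR 18 (pre.eval τ)) = tailProg.run ρ := by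
          rw [Prog.run, hβ1]
        rw [e]
        have hIρ : ScanInput c ρ := (hI.setR (Or.inl rfl)).setR (Or.inr rfl)
        have hF := tailProg.frame_run rfl ρ
        have hI' : ScanInput c (tailProg.run ρ) := hIρ.frame hF rfl
        have n20 : ρ.nreg 20 = τ.nreg 20 := rfl
        have n21 : ρ.nreg 21 = τ.nreg 21 := rfl
        have n22 : ρ.nreg 22 = τ.nreg 22 := rfl
        have n24 : ρ.nreg 24 = τ.nreg 24 := rfl
        have r17 : ρ.rreg 17 = τ.rreg 17 := by simp [hρ]
        have r19 : ρ.rreg 19 = b₀ := by simp [hρ]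
        by_cases hc : ρ.nreg 22 + 2 ≤ c.nm ∧
            c.X (c.bm + ρ.nreg 22 + 1) < c.X (c.bx + ρ.nreg 20) + ρ.rreg 19
        · obtain ⟨q1, q2, q3, q4, q5⟩ := tailProg_advance hIρ hc
          rw [n20, n22, r19] at hc
          refine ⟨⟨hI', by rw [q1, n20]; exact ha, by rw [q2, n21]; exact hb,
            by rw [q3, n22]; omega, ?_, ?_, ?_, ?_⟩, ?_⟩
          · rw [q1, q2, q3, n20, n21, n22]
            refine fun _ => ⟨hJ1, fun b h1 h2 h3 h4 => ?_⟩
            have := hmono _ _ _ _ le_rfl ha' h1 h2 hJ1 hadv h3 h4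
            rw [← Nat.add_assoc]
            linarith [hc.2]
          · intro V h1 h2
            have := hbel V h1 h2
            rwa [Below, ← n24, ← q4, ← r17, ← q5] at this
          · intro w h1
            have := habo w h1
            rwa [Above, ← n24, ← q4, ← r17, ← q5] at this
          · intro a ha
            rw [q1, n20] at ha
            obtain ⟨b, h1, h2, h3⟩ := hdone a ha
            rw [Above, ← n24, ← q4, ← r17, ← q5] at h3
            exact ⟨b, h1, h2, h3⟩
          · rw [q1, q2, q3, n20, n21, n22]; omega
        · obtain ⟨q1, q2, q3, q4, q5, q6⟩ := tailProg_record hIρ hc hm hmn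
            (by rw [n20, r19]; exact hβD _ ha' _ hb hJ1 hadv)
            (by rw [n20, n22, r19]; exact hJ2 _ le_rfl hb hJ1 hadv)
          rw [n20, n21, r19] at q4 q6
          have keep : ∀ w, Above τ w → Above (tailProg.run ρ) w := by
            intro w hw
            apply q5
            rwa [Above, n24, r17]
          refine ⟨⟨hI', by rw [q1, n20]; exact ha', by rw [q2, n21]; exact hb,
            by rw [q3, n22]; omega, ?_, ?_, ?_, ?_⟩, ?_⟩
          · rw [q1, q2, q3, n20, n21, n22]
            refine fun h => ⟨hJa _ h _ hb hJ1, fun b h1 h2 h3 h4 => ?_⟩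
            have g1 := hJ2 _ le_rfl hb hJ1 hadv
            have g2 := hmono _ _ _ _ (Nat.le_succ _) h h1 h2 hJ1 hadv h3 h4
            have g3 := hstep _ h
            rw [← Nat.add_assoc]
            exact g1.trans (add_le_add g3 g2)
          · intro V h1 h2
            refine q4 V ?_ (h2 _ ha' _ hb ⟨hJ1, hadv⟩)
            have := hbel V h1 h2
            rwa [Below, ← n24, ← r17] at this
          · exact fun w h1 => keep w (habo w h1)
          · intro a ha
            rw [q1, n20] at ha
            rcases Nat.lt_succ_iff_lt_or_eq.1 ha with ha | rfl
            · obtain ⟨b, h1, h2, h3⟩ := hdone a ha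
              exact ⟨b, h1, h2, keep _ h3⟩
            · exact ⟨_, hb, ⟨hJ1, hadv⟩, q6⟩
          · rw [q1, q2, q3, n20, n21, n22]; omega)
  set σ₀ := ((σ.setN 20 0).setN 21 0).setN 22 0 with hσ₀
  have hI0 : ScanInput c σ₀ := ((hI.setN (by simp)).setN (by simp)).setN (by simp)
  have hstart : I σ₀ := by
    refine ⟨hI0, by simp [hσ₀], by simpa [hσ₀] using hz, by simpa [hσ₀] using hm.pos, ?_,
      ?_, ?_, ?_⟩
    · intro h
      simp [hσ₀] at h ⊢
      refine ⟨hJ0, fun b hb h1 h2 => ?_⟩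
      rw [hm.first]
      exact add_nonneg (by simpa using hx0 0 h) (hβ0 0 h b hb h1 h2)
    · intro V h _; simpa [Below, hσ₀] using h
    · intro V h; simpa [Above, hσ₀] using h
    · simp [hσ₀]
  have h1 : Runs (scanProg pre T beta) σ _ _ :=
    Runs.seq (Q := fun τ => τ = σ.setN 20 0) (Runs.of_loopFree rfl rfl) <| by
      rintro _ - rfl
      exact Runs.seq (Q := fun τ => τ = (σ.setN 20 0).setN 21 0) (Runs.of_loopFree rfl rfl) <| by
        rintro _ - rfl
        exact Runs.seq (Q := fun τ => τ = σ₀) (Runs.of_loopFree rfl rfl) <| by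
          rintro _ - rfl
          exact hloop _ hstart
  refine h1.mono ?_ ?_
  · have : σ₀.nreg 20 + σ₀.nreg 21 + σ₀.nreg 22 = 0 := by simp [hσ₀]
    simp only [this, Nat.sub_zero, Prog.size, NExpr.cost]
    omega
  · rintro τ - ⟨⟨hI, h1, h2, h3, h4, h5, h6, h7⟩, ht⟩
    simp only [scanTest, Test.holds, NExpr.eval, hI.nx, not_le] at ht
    have : τ.nreg 20 = c.nx := by omega
    rw [this] at h7
    exact ⟨h5, h6, h7⟩

/-- Scan for a fixed location: the second weight is the largest one for which the second side is
not higher than the first one. -/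
def vertexScan : Prog :=
  scanProg (.sub (.add (.reg 14) (.read 9 idxX)) (.reg 15))
    (.and (.nle (.add (.reg 21) (.const 2)) (.reg 17)) (.rle (.read 9 idxZ.succ) (.reg 18)))
    (.branch (.and (.nle (.add (.reg 21) (.const 2)) (.reg 17)) (.rle (.read 9 idxZ) (.reg 18)))
      (.setR 19 (.add (.read 8 idxZ) (.mul (.sub (.reg 18) (.read 9 idxZ))
        (.div (.sub (.read 8 idxZ.succ) (.read 8 idxZ))
          (.sub (.read 9 idxZ.succ) (.read 9 idxZ))))))
      (.setR 19 (.read 8 idxZ)))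

/-- Scan for an edge: the second list is merged into the first one by slopes. -/
def edgeScan : Prog :=
  scanProg
    (.div (.sub (.read 9 idxX) (.read 9 (.sub idxX (.const 1))))
      (.sub (.read 8 idxX) (.read 8 (.sub idxX (.const 1)))))
    (.and (.nle (.const 1) (.reg 20)) (.and (.nle (.add (.reg 21) (.const 2)) (.reg 17))
      (.rle (.div (.sub (.read 9 idxZ.succ) (.read 9 idxZ))
        (.sub (.read 8 idxZ.succ) (.read 8 idxZ))) (.reg 18))))
    (.setR 19 (.read 8 idxZ))

/-! ### What the scans for a vertex and for an edge record -/

section Specs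

variable {c : ScanArgs} {l r mf : ℝ → ℝ} {A B : ℝ}

/-- The second weight determined by a vertex scan. -/
noncomputable def ScanArgs.partner (c : ScanArgs) (a b : ℕ) : ℝ :=
  open Classical in
  if b + 2 ≤ c.nz ∧ c.Y (c.bz + b) ≤ c.cX + c.Y (c.bx + a) - c.cY then
    c.X (c.bz + b) + (c.cX + c.Y (c.bx + a) - c.cY - c.Y (c.bz + b)) *
      ((c.X (c.bz + b + 1) - c.X (c.bz + b)) / (c.Y (c.bz + b + 1) - c.Y (c.bz + b)))
  else c.X (c.bz + b)

/-- By `hJ` and `hA` the scan has stopped at the last point of the second list not above the level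
of the first side. If the list goes on, r crosses the level strictly increasing on the next segment,
so the crossing is the largest admissible weight; at the last point it is B. Only for b = 0 may the
point be too high; then no weight is admissible and 0 is used. The last conjunct allows reading the
height off the point b without evaluating r at the partner. -/
theorem ScanArgs.partner_spec (hl : PointList c.X c.Y c.bx c.nx l A)
    (hr : PointList c.X c.Y c.bz c.nz r B) (mr : Monotone r) {a b : ℕ}
    (ha : a < c.nx) (hb : b < c.nz)
    (hJ : 1 ≤ b → c.Y (c.bz + b) ≤ c.cX + c.Y (c.bx + a) - c.cY)
    (hA : ¬ (b + 2 ≤ c.nz ∧ c.Y (c.bz + b + 1) ≤ c.cX + c.Y (c.bx + a) - c.cY)) :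
    c.partner a b ∈ Set.Icc 0 B ∧
    (∀ β ∈ Set.Icc 0 B, c.cY + r β ≤ c.cX + l (c.X (c.bx + a)) → β ≤ c.partner a b) ∧
    (c.cY + r (c.partner a b) ≤ c.cX + l (c.X (c.bx + a)) ∨ c.partner a b = 0) ∧
    max (c.cX + c.Y (c.bx + a)) (c.cY + c.Y (c.bz + b)) =
      max (c.cX + l (c.X (c.bx + a))) (c.cY + r (c.partner a b)) := by
  have e1 := hl.val a ha
  have e2 := hr.val b hb
  have hmem := hr.mem hb
  by_cases hc : b + 2 ≤ c.nz ∧ c.Y (c.bz + b) ≤ c.cX + c.Y (c.bx + a) - c.cY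
  · have hp : c.partner a b = _ := if_pos hc
    obtain ⟨h1, h2⟩ := hc
    have h3 : c.cX + c.Y (c.bx + a) - c.cY < c.Y (c.bz + b + 1) := by
      by_contra h; exact hA ⟨h1, not_lt.1 h⟩
    have e3 := hr.val (b + 1) h1
    rw [← Nat.add_assoc] at e3
    have hX := hr.step b h1
    have hY : 0 < c.Y (c.bz + b + 1) - c.Y (c.bz + b) := by linarith
    have hX' : 0 < c.X (c.bz + b + 1) - c.X (c.bz + b) := by linarith
    set p := c.partner a b with hpdef
    have p1 : c.X (c.bz + b) ≤ p := by
      rw [hp]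
      have := mul_nonneg (sub_nonneg.2 h2) (div_pos hX' hY).le
      linarith
    have p2 : p < c.X (c.bz + b + 1) := by
      rw [hp, mul_div_assoc', ← sub_pos]
      have : (c.cX + c.Y (c.bx + a) - c.cY - c.Y (c.bz + b)) *
          (c.X (c.bz + b + 1) - c.X (c.bz + b)) / (c.Y (c.bz + b + 1) - c.Y (c.bz + b)) <
          c.X (c.bz + b + 1) - c.X (c.bz + b) := by
        rw [div_lt_iff₀ hY, mul_comm]
        exact mul_lt_mul_of_pos_left (by linarith) hX'
      linarith
    have hs : segSlope c.X c.Y (c.bz + b) * (p - c.X (c.bz + b)) =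
        c.cX + c.Y (c.bx + a) - c.cY - c.Y (c.bz + b) := by
      rw [hp, segSlope]
      field_simp
      ring
    have hseg := hr.segment h1
    have hrp : r p = c.cX + c.Y (c.bx + a) - c.cY := by
      rw [hseg _ p le_rfl hX.le p1 p2.le, hs, e2]; ring
    have hpos : 0 < segSlope c.X c.Y (c.bz + b) := div_pos hY hX'
    refine ⟨⟨hmem.1.trans p1, p2.le.trans (hr.mem h1).2⟩, fun β hβ hle => ?_, Or.inl ?_, ?_⟩
    · by_contra hlt
      push Not at hlt
      rcases le_total β (c.X (c.bz + b + 1)) with hβ1 | hβ1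
      · have := hseg p β p1 p2.le (p1.trans hlt.le) hβ1
        rw [hrp] at this
        have := mul_pos hpos (sub_pos.2 hlt)
        linarith
      · have := mr hβ1
        linarith
    · rw [hrp, e1]; linarith
    · rw [hrp, ← e1, max_eq_left (by linarith), max_eq_left (by linarith)]
  · have hp : c.partner a b = c.X (c.bz + b) := if_neg hc
    rw [hp]
    refine ⟨hmem, ?_, ?_, by rw [e1, e2]⟩
    · intro β hβ hle
      by_cases h1 : b + 2 ≤ c.nz
      · have h2 : ¬ c.Y (c.bz + b) ≤ c.cX + c.Y (c.bx + a) - c.cY := fun h => hc ⟨h1, h⟩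
        have hb0 : b = 0 := by
          by_contra h; exact h2 (hJ (by omega))
        subst hb0
        rw [Nat.add_zero] at h2 e2 ⊢
        exfalso
        have := mr hβ.1
        rw [hr.first] at e2
        exact h2 (by linarith)
      · have : b = c.nz - 1 := by omega
        rw [this, hr.last]; exact hβ.2
    · by_cases h1 : 1 ≤ b
      · left; linarith [hJ h1]
      · right
        have : b = 0 := by omega
        rw [this, Nat.add_zero, hr.first]

/-- What a vertex scan achieves. -/
structure VertexScanned (c : ScanArgs) (l r mf : ℝ → ℝ) (A B : ℝ) (σ σ' : State) : Prop where
  below : ∀ V, Below σ V → (∀ α ∈ Set.Icc 0 A, ∀ β ∈ Set.Icc 0 B,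
    max 0 (c.x + mf (α + β)) - max 0 (max (c.cX + l α) (c.cY + r β)) ≤ V) → Below σ' V
  above : ∀ w, Above σ w → Above σ' w
  done : ∀ a < c.nx, ∀ β ∈ Set.Icc 0 B, c.cY + r β ≤ c.cX + l (c.X (c.bx + a)) →
    Above σ' (max 0 (c.x + mf (c.X (c.bx + a) + β)) - max 0 (c.cX + l (c.X (c.bx + a))))

/-- When the first side determines the height, a larger second weight can only raise the monotone
objective. So the largest admissible one beats all others, and one value per point of the first list
suffices. -/
theorem vertexScan_runs : ∃ C, ∀ {c : ScanArgs} {l r mf : ℝ → ℝ} {A B : ℝ} {σ : State},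
    PointList c.X c.Y c.bx c.nx l A → PointList c.X c.Y c.bz c.nz r B →
    PointList c.X c.Y c.bm c.nm mf (A + B) → Monotone l → Monotone r → Monotone mf →
    c.s ≤ c.cX + c.cY → ScanInput c σ →
    Runs vertexScan σ (C * (c.nx + c.nz + c.nm + 1)) (VertexScanned c l r mf A B σ) := by
  refine ⟨1000, ?_⟩
  intro c l r mf A B σ hl hr hm ml mr mm hs hI
  have hX : ∀ a, a + 1 < c.nx → c.Y (c.bx + a) ≤ c.Y (c.bx + (a + 1)) := fun a ha => by
    rw [hl.val a (by omega), hl.val (a + 1) ha]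
    exact ml (hl.step a ha).le
  have h := scanProg_runs (c := c)
    (pre := .sub (.add (.reg 14) (.read 9 idxX)) (.reg 15))
    (T := .and (.nle (.add (.reg 21) (.const 2)) (.reg 17)) (.rle (.read 9 idxZ.succ) (.reg 18)))
    (beta := .branch
      (.and (.nle (.add (.reg 21) (.const 2)) (.reg 17)) (.rle (.read 9 idxZ) (.reg 18)))
      (.setR 19 (.add (.read 8 idxZ) (.mul (.sub (.reg 18) (.read 9 idxZ))
        (.div (.sub (.read 8 idxZ.succ) (.read 8 idxZ))
          (.sub (.read 9 idxZ.succ) (.read 9 idxZ))))))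
      (.setR 19 (.read 8 idxZ))) rfl
    (Adv := fun a b => b + 2 ≤ c.nz ∧ c.Y (c.bz + b + 1) ≤ c.cX + c.Y (c.bx + a) - c.cY)
    (J := fun a b => 1 ≤ b → c.Y (c.bz + b) ≤ c.cX + c.Y (c.bx + a) - c.cY)
    (β := c.partner) hm (fun a ha => (hl.step a ha).le) (fun a ha => (hl.mem ha).1) hr.pos
    (fun a ha b hb hJ hA => (ScanArgs.partner_spec hl hr mr ha hb hJ hA).1.1)
    (fun a ha b hb hJ hA => add_le_add (hl.mem ha).2
      (ScanArgs.partner_spec hl hr mr ha hb hJ hA).1.2)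
    (by
      intro τ hI ha hb
      simp [idxX, idxZ, NExpr.succ, hI.bx, hI.bz, hI.nz, hI.cX, hI.cY, hI.Y])
    (by
      intro τ hI ha hb hA
      by_cases hc : τ.nreg 21 + 2 ≤ c.nz ∧
        c.Y (c.bz + τ.nreg 21) ≤ c.cX + c.Y (c.bx + τ.nreg 20) - c.cY
      · rw [Prog.run_branch_pos]
        · rw [ScanArgs.partner, if_pos hc]
          simp [Prog.run, idxX, idxZ, NExpr.succ, hI.bx, hI.bz, hI.cX, hI.cY, hI.X, hI.Y]
        · simpa [idxX, idxZ, hI.bx, hI.bz, hI.nz, hI.cX, hI.cY, hI.Y] using hc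
      · rw [Prog.run_branch_neg]
        · rw [ScanArgs.partner, if_neg hc]
          simp [Prog.run, idxX, idxZ, hI.bx, hI.bz, hI.cX, hI.cY, hI.X, hI.Y]
        · simpa [idxX, idxZ, hI.bx, hI.bz, hI.nz, hI.cX, hI.cY, hI.Y] using hc)
    (by simp)
    (fun a ha b hb hJ hA => ⟨hA.1, fun _ => hA.2⟩)
    (fun a ha b hb hJ h1 => by have := hJ h1; have := hX a ha; linarith)
    (by
      intro a a' b b' haa ha' hbb hb' hJ hA hJ' hA'
      have s1 := ScanArgs.partner_spec hl hr mr (haa.trans_lt ha') (hbb.trans_lt hb') hJ hA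
      have s2 := ScanArgs.partner_spec hl hr mr ha' hb' hJ' hA'
      rcases s1.2.2.1 with h | h
      · exact s2.2.1 _ s1.1 (h.trans (add_le_add_right (ml (hl.mono haa ha')) _))
      · rw [h]; exact s2.1.1)
    hI
  have hval : ∀ a < c.nx, ∀ b < c.nz,
      ((1 ≤ b → c.Y (c.bz + b) ≤ c.cX + c.Y (c.bx + a) - c.cY) ∧
        ¬ (b + 2 ≤ c.nz ∧ c.Y (c.bz + b + 1) ≤ c.cX + c.Y (c.bx + a) - c.cY)) →
      c.value mf (c.X (c.bx + a) + c.partner a b) a b =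
        max 0 (c.x + mf (c.X (c.bx + a) + c.partner a b)) -
          max 0 (max (c.cX + l (c.X (c.bx + a))) (c.cY + r (c.partner a b))) := by
    rintro a ha b hb ⟨hJ, hA⟩
    have s1 := ScanArgs.partner_spec hl hr mr ha hb hJ hA
    rw [ScanArgs.value, ← s1.2.2.2]
    congr 1
    -- Since s ≤ cX + cY, the half-sum is at most the mean of the two sides and hence irrelevant at
    -- a vertex.
    apply max_eq_left
    have q1 := le_max_left (c.cX + c.Y (c.bx + a)) (c.cY + c.Y (c.bz + b))
    have q2 := le_max_right (c.cX + c.Y (c.bx + a)) (c.cY + c.Y (c.bz + b))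
    have q3 := le_max_right 0 (max (c.cX + c.Y (c.bx + a)) (c.cY + c.Y (c.bz + b)))
    linarith
  refine h.mono ?_ ?_
  · simp only [scanBody, scanTest, tailProg, valueProg, compareProg, maxR, Prog.size, RExpr.cost,
      NExpr.cost, Test.cost, idxX, idxZ, idxM, NExpr.succ]
    omega
  · rintro σ' - ⟨h1, h2, h3⟩
    refine ⟨fun V hV hall => h1 V hV fun a ha b hb hc => ?_, h2, fun a ha β hβ hle => ?_⟩
    · rw [hval a ha b hb hc]
      exact hall _ (hl.mem ha) _ (ScanArgs.partner_spec hl hr mr ha hb hc.1 hc.2).1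
    · obtain ⟨b, hb, hc, hab⟩ := h3 a ha
      refine hab.mono ?_
      rw [hval a ha b hb hc]
      have s1 := ScanArgs.partner_spec hl hr mr ha hb hc.1 hc.2
      have q1 := s1.2.1 β hβ hle
      have q2 := mm (show c.X (c.bx + a) + β ≤ c.X (c.bx + a) + c.partner a b by linarith)
      have q3 : max (c.cX + l (c.X (c.bx + a))) (c.cY + r (c.partner a b)) =
          c.cX + l (c.X (c.bx + a)) := by
        apply max_eq_left
        rcases s1.2.2.1 with h | h
        · exact h
        · rw [h]
          have := mr hβ.1
          linarith
      rw [q3]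
      have q4 := max_le_max (le_refl (0 : ℝ)) (add_le_add_right q2 c.x)
      linarith

/-- What an edge scan achieves. -/
structure EdgeScanned (c : ScanArgs) (l r mf : ℝ → ℝ) (A B : ℝ) (σ σ' : State) : Prop where
  below : ∀ V, Below σ V → (∀ α ∈ Set.Icc 0 A, ∀ β ∈ Set.Icc 0 B,
    max 0 (c.x + mf (α + β)) - max (max 0 (max (c.cX + l α) (c.cY + r β)))
      ((l α + r β + c.s) / 2) ≤ V) → Below σ' V
  above : ∀ w, Above σ w → Above σ' w
  done : ∀ a < c.nx, ∃ b < c.nz,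
    (∀ b' < b, 1 ≤ a ∧ segSlope c.X c.Y (c.bz + b') ≤ segSlope c.X c.Y (c.bx + (a - 1))) ∧
    (b + 1 < c.nz → 1 ≤ a →
      segSlope c.X c.Y (c.bx + (a - 1)) < segSlope c.X c.Y (c.bz + b)) ∧
    Above σ' (max 0 (c.x + mf (c.X (c.bx + a) + c.X (c.bz + b))) -
      max (max 0 (max (c.cX + l (c.X (c.bx + a))) (c.cY + r (c.X (c.bz + b)))))
        ((l (c.X (c.bx + a)) + r (c.X (c.bz + b)) + c.s) / 2))

/-- The invariant is the state of a merge by slopes: the segments passed in the second list are no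
steeper than the last segment passed in the first list. Convexity of `l` preserves it when the first
pointer moves on. -/
theorem edgeScan_runs : ∃ C, ∀ {c : ScanArgs} {l r mf : ℝ → ℝ} {A B : ℝ} {σ : State},
    PointList c.X c.Y c.bx c.nx l A → PointList c.X c.Y c.bz c.nz r B →
    PointList c.X c.Y c.bm c.nm mf (A + B) → ConvexOn ℝ Set.univ l → ScanInput c σ →
    Runs edgeScan σ (C * (c.nx + c.nz + c.nm + 1)) (EdgeScanned c l r mf A B σ) := by
  refine ⟨1000, ?_⟩
  intro c l r mf A B σ hl hr hm cl hI
  have h := scanProg_runs (c := c)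
    (pre := .div (.sub (.read 9 idxX) (.read 9 (.sub idxX (.const 1))))
      (.sub (.read 8 idxX) (.read 8 (.sub idxX (.const 1)))))
    (T := .and (.nle (.const 1) (.reg 20)) (.and (.nle (.add (.reg 21) (.const 2)) (.reg 17))
      (.rle (.div (.sub (.read 9 idxZ.succ) (.read 9 idxZ))
        (.sub (.read 8 idxZ.succ) (.read 8 idxZ))) (.reg 18))))
    (beta := .setR 19 (.read 8 idxZ)) rfl
    (Adv := fun a b => 1 ≤ a ∧ b + 2 ≤ c.nz ∧
      segSlope c.X c.Y (c.bz + b) ≤ segSlope c.X c.Y (c.bx + (a - 1)))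
    (J := fun a b => ∀ b' < b, 1 ≤ a ∧
      segSlope c.X c.Y (c.bz + b') ≤ segSlope c.X c.Y (c.bx + (a - 1)))
    (β := fun _ b => c.X (c.bz + b)) hm (fun a ha => (hl.step a ha).le)
    (fun a ha => (hl.mem ha).1) hr.pos
    (fun a ha b hb hJ hA => (hr.mem hb).1)
    (fun a ha b hb hJ hA => add_le_add (hl.mem ha).2 (hr.mem hb).2)
    (by
      intro τ hI ha hb
      simp only [Test.holds, NExpr.eval, RExpr.eval, idxX, idxZ, NExpr.succ, State.setR_nreg,
        State.setR_rreg, State.setR_rarr, hI.bx, hI.bz, hI.nz, hI.X, hI.Y, if_true]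
      -- At the first point there is no preceding segment and register 18 holds a meaningless value;
      -- the guard `1 ≤ nreg 20` keeps it from being used.
      refine and_congr_right fun h1 => ?_
      obtain ⟨d, hd⟩ : ∃ d, τ.nreg 20 = d + 1 := ⟨τ.nreg 20 - 1, by omega⟩
      rw [hd, ← Nat.add_assoc, Nat.add_sub_cancel, Nat.add_sub_cancel]
      rfl)
    (by
      intro τ hI ha hb hA
      simp [Prog.run, idxZ, hI.bz, hI.X])
    (by simp)
    (by
      intro a ha b hb hJ hA
      refine ⟨hA.2.1, fun b' hb' => ?_⟩
      rcases Nat.lt_succ_iff_lt_or_eq.1 hb' with hb' | rfl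
      · exact hJ b' hb'
      · exact ⟨hA.1, hA.2.2⟩)
    (by
      intro a ha b hb hJ b' hb'
      obtain ⟨h1, h2⟩ := hJ b' hb'
      exact ⟨by omega, h2.trans (hl.segSlope_mono cl (by omega) (by omega))⟩)
    (fun a a' b b' _ _ hbb hb' _ _ _ _ => hr.mono hbb hb')
    hI
  have hval : ∀ a < c.nx, ∀ b < c.nz,
      c.value mf (c.X (c.bx + a) + c.X (c.bz + b)) a b =
        max 0 (c.x + mf (c.X (c.bx + a) + c.X (c.bz + b))) -
          max (max 0 (max (c.cX + l (c.X (c.bx + a))) (c.cY + r (c.X (c.bz + b)))))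
            ((l (c.X (c.bx + a)) + r (c.X (c.bz + b)) + c.s) / 2) := by
    intro a ha b hb
    rw [ScanArgs.value, hl.val a ha, hr.val b hb]
  refine h.mono ?_ ?_
  · simp only [scanBody, scanTest, tailProg, valueProg, compareProg, maxR, Prog.size, RExpr.cost,
      NExpr.cost, Test.cost, idxX, idxZ, idxM, NExpr.succ]
    omega
  · rintro σ' - ⟨h1, h2, h3⟩
    refine ⟨fun V hV hall => h1 V hV fun a ha b hb hc => ?_, h2, fun a ha => ?_⟩
    · rw [hval a ha b hb]
      exact hall _ (hl.mem ha) _ (hr.mem hb)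
    · obtain ⟨b, hb, hc, hab⟩ := h3 a ha
      refine ⟨b, hb, hc.1, fun q1 q2 => ?_, ?_⟩
      · by_contra hlt
        exact hc.2 ⟨q2, q1, not_lt.1 hlt⟩
      · rw [← hval a ha b hb]; exact hab

end Specs

end RealRAM

/-! ### The optimum over locations and weights -/

/-- Data of the optimization problem: `n` edges, vertex positions `pos`, the envelopes `L`, `R` for
the two sides and `M` for the objective at `x`, the ranges `[0, A]`, `[0, B]` of the two additional
weights, and the first and last vertex `p`, `q` of the range of locations. -/
structure Core where
  n : ℕ
  pos : ℕ → ℝ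
  L : ℕ → ℝ → ℝ
  R : ℕ → ℝ → ℝ
  M : ℝ → ℝ
  x : ℝ
  A : ℝ
  B : ℝ
  p : ℕ
  q : ℕ

namespace Core

/-- Conditions on the data. -/
structure Good (K : Core) : Prop where
  p_le : K.p ≤ K.q
  q_le : K.q ≤ K.n
  pos_mono : ∀ a b, a ≤ b → b ≤ K.n → K.pos a ≤ K.pos b
  pos_zero : K.pos 0 = 0
  L_mono : ∀ m ≤ K.n, Monotone (K.L m)
  R_mono : ∀ m ≤ K.n, Monotone (K.R m)
  L_convex : ∀ m, ConvexOn ℝ Set.univ (K.L m)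
  R_convex : ∀ m, ConvexOn ℝ Set.univ (K.R m)
  L_cont : ∀ m, Continuous (K.L m)
  R_cont : ∀ m, Continuous (K.R m)
  L_le : ∀ m m', m ≤ m' → ∀ α, K.L m α ≤ K.L m' α
  R_le : ∀ m m', m ≤ m' → ∀ β, K.R m β ≤ K.R m' β
  L_sign : ∀ m ≤ K.n, (∀ α, K.L m α = -K.pos K.n) ∨ ∃ e < m, ∀ α, 0 ≤ α → 0 ≤ K.pos e + K.L m α
  R_sign : ∀ m ≤ K.n, (∀ β, K.R m β = -K.pos K.n) ∨
    ∃ e < m, ∀ β, 0 ≤ β → 0 ≤ K.pos K.n - K.pos (K.n - e) + K.R m β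
  M_mono : Monotone K.M
  M_support : ∀ ω₀, ∃ a b : ℝ, 0 ≤ a ∧ (∀ ω, a * ω + b ≤ K.M ω) ∧ a * ω₀ + b = K.M ω₀

variable (K : Core)

/-- Objective minus the height at the location `y`, with the two sides given by `l` and `r`. -/
noncomputable def val (l r : ℝ → ℝ) (y α β : ℝ) : ℝ :=
  max 0 (K.x + K.M (α + β)) - max 0 (max (y + l α) (K.pos K.n - y + r β))

/-- Objective minus the height at the vertex `k`. -/
noncomputable def valV (k : ℕ) (α β : ℝ) : ℝ := K.val (K.L k) (K.R (K.n - k)) (K.pos k) α β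

/-- Objective minus a lower bound for the height on edge `k`. -/
noncomputable def valE (k : ℕ) (α β : ℝ) : ℝ :=
  max 0 (K.x + K.M (α + β)) -
    max (max 0 (max (K.pos k + K.L (k + 1) α) (K.pos K.n - K.pos (k + 1) + K.R (K.n - k) β)))
      ((K.L (k + 1) α + K.R (K.n - k) β + K.pos K.n) / 2)

variable {K}

/-- A supporting line of the objective at the given total weight replaces the convex objective by a
linear one. Candidates are valued with the true objective, which dominates every such line, so one
bound V serves for all of them. -/
theorem Good.support (hK : K.Good) (ω₀ : ℝ) : ∃ a b : ℝ, 0 ≤ a ∧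
    (∀ ω, a * ω + b ≤ max 0 (K.x + K.M ω)) ∧ a * ω₀ + b = max 0 (K.x + K.M ω₀) := by
  obtain ⟨a, b, h0, h1, h2⟩ := hK.M_support ω₀
  rcases le_total 0 (K.x + K.M ω₀) with h | h
  · refine ⟨a, K.x + b, h0, fun ω => ?_, ?_⟩
    · have := h1 ω
      exact le_max_of_le_right (by linarith)
    · rw [max_eq_right h, ← h2]; ring
  · exact ⟨0, 0, le_rfl, fun ω => by simp, by rw [max_eq_left h]; simp⟩

/-- If no vertex counts on either side, both envelopes are the constant -x_n and the height is at
most 0. Otherwise a counting vertex keeps its side nonnegative for all weights. So the maximum with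
0 never creates a breakpoint of its own. -/
theorem Good.sign_vertex (hK : K.Good) {k : ℕ} (hk : k ≤ K.n) :
    (∀ α ∈ Set.Icc 0 K.A, ∀ β ∈ Set.Icc 0 K.B,
      0 ≤ max (K.pos k + K.L k α) (K.pos K.n - K.pos k + K.R (K.n - k) β)) ∨
    (∀ α ∈ Set.Icc 0 K.A, ∀ β ∈ Set.Icc 0 K.B,
      max (K.pos k + K.L k α) (K.pos K.n - K.pos k + K.R (K.n - k) β) ≤ 0) := by
  rcases hK.L_sign k hk with hL | ⟨e, he, hL⟩
  · rcases hK.R_sign (K.n - k) (by omega) with hR | ⟨e, he, hR⟩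
    · right
      intro α _ β _
      rw [hL, hR]
      have h1 := hK.pos_mono 0 k (by omega) hk
      have h2 := hK.pos_mono k K.n hk le_rfl
      rw [hK.pos_zero] at h1
      exact max_le (by linarith) (by linarith)
    · left
      intro α _ β hβ
      have h1 := hR β hβ.1
      have h2 := hK.pos_mono k (K.n - e) (by omega) (by omega)
      exact le_max_of_le_right (by linarith)
  · left
    intro α hα β _
    have h1 := hL α hα.1
    have h2 := hK.pos_mono e k he.le hk
    exact le_max_of_le_left (by linarith)

theorem Good.sign_edge (hK : K.Good) {k : ℕ} (hk : k < K.n) :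
    (∀ α ∈ Set.Icc 0 K.A, ∀ β ∈ Set.Icc 0 K.B, ∀ y ∈ Set.Icc (K.pos k) (K.pos (k + 1)),
      0 ≤ max (y + K.L (k + 1) α) (K.pos K.n - y + K.R (K.n - k) β)) ∨
    (∀ α ∈ Set.Icc 0 K.A, ∀ β ∈ Set.Icc 0 K.B,
      max (K.pos k + K.L (k + 1) α) (K.pos K.n - K.pos k + K.R (K.n - k) β) ≤ 0) := by
  rcases hK.L_sign (k + 1) hk with hL | ⟨e, he, hL⟩
  · rcases hK.R_sign (K.n - k) (by omega) with hR | ⟨e, he, hR⟩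
    · right
      intro α _ β _
      rw [hL, hR]
      have h1 := hK.pos_mono 0 k (by omega) hk.le
      have h2 := hK.pos_mono k K.n hk.le le_rfl
      rw [hK.pos_zero] at h1
      exact max_le (by linarith) (by linarith)
    · left
      intro α _ β hβ y hy
      have h1 := hR β hβ.1
      have h2 := hK.pos_mono (k + 1) (K.n - e) (by omega) (by omega)
      exact le_max_of_le_right (by linarith [hy.2])
  · left
    intro α hα β _ y hy
    have h1 := hL α hα.1
    have h2 := hK.pos_mono e k (by omega) hk.le
    exact le_max_of_le_left (by linarith [hy.1])

/-- Candidates with respect to the two lists suffice for the vertex `k`. -/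
theorem Good.valV_le (hK : K.Good) {k : ℕ} (hk : k ≤ K.n) {X Y : ℕ → ℝ} {bx nx bz nz : ℕ} {V : ℝ}
    (hl : PointList X Y bx nx (K.L k) K.A) (hr : PointList X Y bz nz (K.R (K.n - k)) K.B)
    (h1 : ∀ i < nx, ∀ β ∈ Set.Icc 0 K.B,
      K.pos K.n - K.pos k + K.R (K.n - k) β ≤ K.pos k + K.L k (X (bx + i)) →
      max 0 (K.x + K.M (X (bx + i) + β)) - max 0 (K.pos k + K.L k (X (bx + i))) ≤ V)
    (h2 : ∀ i < nz, ∀ α ∈ Set.Icc 0 K.A,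
      K.pos k + K.L k α ≤ K.pos K.n - K.pos k + K.R (K.n - k) (X (bz + i)) →
      max 0 (K.x + K.M (X (bz + i) + α)) -
        max 0 (K.pos K.n - K.pos k + K.R (K.n - k) (X (bz + i))) ≤ V)
    {α β : ℝ} (hα : α ∈ Set.Icc 0 K.A) (hβ : β ∈ Set.Icc 0 K.B) : K.valV k α β ≤ V := by
  obtain ⟨a, b, ha, hle, he⟩ := hK.support (α + β)
  rw [valV, val, ← he]
  refine vertex_complete hl hr (hK.L_mono k hk) (hK.R_mono _ (by omega)) (hK.L_cont k)
    (hK.R_cont _) ha (fun i hi β hβ hc => ?_) (fun i hi α hα hc => ?_) (hK.sign_vertex hk) hα hβ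
  · have := hle (X (bx + i) + β)
    have := h1 i hi β hβ hc
    linarith
  · have := hle (X (bz + i) + α)
    have := h2 i hi α hα hc
    rw [add_comm α]
    linarith

/-- Candidates with respect to the two lists suffice for the edge `k`, once its ends have been
dealt with. -/
theorem Good.val_le (hK : K.Good) {k : ℕ} (hk : k < K.n) {X Y : ℕ → ℝ} {bx nx bz nz : ℕ} {V : ℝ}
    (hl : PointList X Y bx nx (K.L (k + 1)) K.A) (hr : PointList X Y bz nz (K.R (K.n - k)) K.B)
    (h1 : ∀ i < nx, ∃ j < nz,
      (∀ j' < j, 1 ≤ i ∧ segSlope X Y (bz + j') ≤ segSlope X Y (bx + (i - 1))) ∧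
      (j + 1 < nz → 1 ≤ i → segSlope X Y (bx + (i - 1)) < segSlope X Y (bz + j)) ∧
      K.valE k (X (bx + i)) (X (bz + j)) ≤ V)
    (h2 : ∀ j < nz, ∃ i < nx,
      (∀ i' < i, 1 ≤ j ∧ segSlope X Y (bx + i') ≤ segSlope X Y (bz + (j - 1))) ∧
      (i + 1 < nx → 1 ≤ j → segSlope X Y (bz + (j - 1)) < segSlope X Y (bx + i)) ∧
      K.valE k (X (bx + i)) (X (bz + j)) ≤ V)
    (hu : ∀ α ∈ Set.Icc 0 K.A, ∀ β ∈ Set.Icc 0 K.B, K.valV k α β ≤ V)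
    (hv : ∀ α ∈ Set.Icc 0 K.A, ∀ β ∈ Set.Icc 0 K.B, K.valV (k + 1) α β ≤ V)
    {α β y : ℝ} (hα : α ∈ Set.Icc 0 K.A) (hβ : β ∈ Set.Icc 0 K.B)
    (hy : y ∈ Set.Icc (K.pos k) (K.pos (k + 1))) :
    K.val (K.L (k + 1)) (K.R (K.n - k)) y α β ≤ V := by
  obtain ⟨a, b, ha, hle, he⟩ := hK.support (α + β)
  obtain ⟨i, hi, j, hj, hQ, mα, mβ⟩ := exists_pair hl hr (hK.L_convex _) (hK.R_convex _)
    (Q := fun i j => K.valE k (X (bx + i)) (X (bz + j)) ≤ V) h1 h2 (2 * a)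
  rw [val, ← he]
  refine edge_complete (hK.L_convex _) (hK.R_convex _) (hl.mem hi) (hr.mem hj) mα mβ ?_
    (fun α hα β hβ => ?_) (fun α hα β hβ => ?_) (hK.sign_edge hk) hα hβ hy
  · have := hle (X (bx + i) + X (bz + j))
    rw [valE] at hQ
    linarith
  · have q1 := hle (α + β)
    have q2 := hu α hα β hβ
    rw [valV, val] at q2
    -- At an end of the edge, the formula for the edge takes one more edge into account on one side
    -- than the formula for the vertex. It gives a greater or equal height, so the bound at the
    -- vertex suffices.
    have q3 := hK.L_le k (k + 1) (by omega) α
    have q4 : max 0 (max (K.pos k + K.L k α) (K.pos K.n - K.pos k + K.R (K.n - k) β)) ≤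
        max 0 (max (K.pos k + K.L (k + 1) α) (K.pos K.n - K.pos k + K.R (K.n - k) β)) := by
      gcongr
    linarith
  · have q1 := hle (α + β)
    have q2 := hv α hα β hβ
    rw [valV, val] at q2
    have q3 := hK.R_le (K.n - (k + 1)) (K.n - k) (by omega) β
    have q4 : max 0 (max (K.pos (k + 1) + K.L (k + 1) α)
          (K.pos K.n - K.pos (k + 1) + K.R (K.n - (k + 1)) β)) ≤
        max 0 (max (K.pos (k + 1) + K.L (k + 1) α)
          (K.pos K.n - K.pos (k + 1) + K.R (K.n - k) β)) := by
      gcongr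
    linarith

end Core

/-! ### Scanning all vertices and edges in the range of locations -/

namespace RealRAM

/-- All lists are in memory: those of `L` according to the index arrays `0`, `1`, those of `R`
according to `2`, `3`, and that of `M`. -/
structure Lists (K : Core) (σ : State) : Prop where
  n : σ.nreg 0 = K.n
  p : σ.nreg 25 = K.p
  q : σ.nreg 26 = K.q
  x : σ.rreg 22 = K.x
  s : σ.rreg 16 = K.pos K.n
  pos : ∀ k ≤ K.n, σ.rarr 5 k = K.pos k
  L : ∀ m ≤ K.n, PointList (σ.rarr 8) (σ.rarr 9) (σ.narr 0 m) (σ.narr 1 m) (K.L m) K.A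
  R : ∀ m ≤ K.n, PointList (σ.rarr 8) (σ.rarr 9) (σ.narr 2 m) (σ.narr 3 m) (K.R m) K.B
  M : PointList (σ.rarr 8) (σ.rarr 9) (σ.nreg 18) (σ.nreg 19) K.M (K.A + K.B)
  sizeL : ∀ m ≤ K.n, σ.narr 1 m ≤ 2 + 4 * m
  sizeR : ∀ m ≤ K.n, σ.narr 3 m ≤ 2 + 4 * m
  sizeM : σ.nreg 19 ≤ 2 + 4 * K.n

/-- The lists are left alone. -/
def Prog.keepsLists (p : Prog) : Bool :=
  !(p.writesN 0 || p.writesN 25 || p.writesN 26 || p.writesN 18 || p.writesN 19 ||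
    p.writesR 22 || p.writesR 16 || p.storesR 5 || p.storesR 8 || p.storesR 9 ||
    p.storesN 0 || p.storesN 1 || p.storesN 2 || p.storesN 3)

theorem Lists.frame {K : Core} {σ σ' : State} {p : Prog} (h : Lists K σ)
    (F : Frame p σ σ') (hp : p.keepsLists = true) : Lists K σ' := by
  simp only [Prog.keepsLists, Bool.not_eq_true', Bool.or_eq_false_iff] at hp
  obtain ⟨⟨⟨⟨⟨⟨⟨⟨⟨⟨⟨⟨⟨h1, h2⟩, h3⟩, h4⟩, h5⟩, h6⟩, h7⟩, h8⟩, h9⟩, h10⟩, h11⟩, h12⟩, h13⟩, h14⟩ := hp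
  obtain ⟨e1, e2, e3, e4, e5, e6, e7, e8, e9, e10, e11, e12⟩ := h
  have f18 := F.nreg _ h4
  have f19 := F.nreg _ h5
  have g5 := F.rarr _ h8
  have g8 := F.rarr _ h9
  have g9 := F.rarr _ h10
  have i0 := F.narr _ h11
  have i1 := F.narr _ h12
  have i2 := F.narr _ h13
  have i3 := F.narr _ h14
  exact ⟨by rw [F.nreg _ h1, e1], by rw [F.nreg _ h2, e2], by rw [F.nreg _ h3, e3],
    by rw [F.rreg _ h6, e4], by rw [F.rreg _ h7, e5], by rwa [g5],
    by rwa [g8, g9, i0, i1], by rwa [g8, g9, i2, i3], by rwa [g8, g9, f18, f19],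
    by rwa [i1], by rwa [i3], by rwa [f19]⟩

/-- Select the lists with indices `m` and `m'` and the constants `u` and `u'`. -/
def selectProg (m m' : NExpr) (u u' : RExpr) : Prog :=
  .seq (.setN 14 (.read 0 m)) <| .seq (.setN 15 (.read 1 m)) <|
  .seq (.setN 16 (.read 2 m')) <| .seq (.setN 17 (.read 3 m')) <|
  .seq (.setR 14 u) (.setR 15 u')

/-- The same with the two sides exchanged. -/
def selectProg' (m m' : NExpr) (u u' : RExpr) : Prog :=
  .seq (.setN 14 (.read 2 m')) <| .seq (.setN 15 (.read 3 m')) <|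
  .seq (.setN 16 (.read 0 m)) <| .seq (.setN 17 (.read 1 m)) <|
  .seq (.setR 14 u') (.setR 15 u)

/-- Both scans for a pair of lists, then go on to the next index. -/
def pairProg (scan : Prog) (m m' : NExpr) (u u' : RExpr) : Prog :=
  .seq (selectProg m m' u u') <| .seq scan <| .seq (selectProg' m m' u u') <| .seq scan <|
    .setN 32 (.add (.reg 32) (.const 1))

/-- All vertices. -/
def vertexBody : Prog :=
  pairProg vertexScan (.reg 32) (.sub (.reg 0) (.reg 32)) (.read 5 (.reg 32))
    (.sub (.reg 16) (.read 5 (.reg 32)))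

/-- All edges. -/
def edgesBody : Prog :=
  pairProg edgeScan (.add (.reg 32) (.const 1)) (.sub (.reg 0) (.reg 32)) (.read 5 (.reg 32))
    (.sub (.reg 16) (.read 5 (.add (.reg 32) (.const 1))))

/-- Progress made for one vertex or edge: only values `v α β` have been recorded. -/
structure Progress (K : Core) (v : ℝ → ℝ → ℝ) (σ σ' : State) : Prop where
  lists : Lists K σ'
  n32 : σ'.nreg 32 = σ.nreg 32 + 1
  below : ∀ V, Below σ V → (∀ α ∈ Set.Icc 0 K.A, ∀ β ∈ Set.Icc 0 K.B, v α β ≤ V) → Below σ' V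
  above : ∀ w, Above σ w → Above σ' w

theorem Below.congr {σ σ' : State} {V : ℝ} (h : Below σ V) (h1 : σ'.nreg 24 = σ.nreg 24)
    (h2 : σ'.rreg 17 = σ.rreg 17) : Below σ' V := by
  rwa [Below, h1, h2]

theorem Above.congr {σ σ' : State} {V : ℝ} (h : Above σ V) (h1 : σ'.nreg 24 = σ.nreg 24)
    (h2 : σ'.rreg 17 = σ.rreg 17) : Above σ' V := by
  rwa [Above, h1, h2]

/-- The arguments of a scan with the list `m` of the left side first. -/
noncomputable def scanArgs (K : Core) (σ : State) (m m' : ℕ) (u u' : ℝ) : ScanArgs where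
  bx := σ.narr 0 m
  nx := σ.narr 1 m
  bz := σ.narr 2 m'
  nz := σ.narr 3 m'
  bm := σ.nreg 18
  nm := σ.nreg 19
  cX := u
  cY := u'
  s := K.pos K.n
  x := K.x
  X := σ.rarr 8
  Y := σ.rarr 9

/-- The arguments of a scan with the list `m'` of the right side first. -/
noncomputable def scanArgs' (K : Core) (σ : State) (m m' : ℕ) (u u' : ℝ) : ScanArgs where
  bx := σ.narr 2 m'
  nx := σ.narr 3 m'
  bz := σ.narr 0 m
  nz := σ.narr 1 m
  bm := σ.nreg 18
  nm := σ.nreg 19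
  cX := u'
  cY := u
  s := K.pos K.n
  x := K.x
  X := σ.rarr 8
  Y := σ.rarr 9

/-- Two scans with exchanged roles supply the candidates with a breakpoint in the first and in the
second weight. The lists have O(n) points, so a vertex costs O(n). -/
theorem vertexBody_runs : ∃ C, ∀ {K : Core} {σ : State} {k : ℕ}, K.Good → Lists K σ →
    σ.nreg 32 = k → k ≤ K.n →
    Runs vertexBody σ (C * (K.n + 1)) (fun σ' => Progress K (K.valV k) σ σ' ∧
      ∀ α ∈ Set.Icc 0 K.A, ∀ β ∈ Set.Icc 0 K.B, Above σ' (K.valV k α β)) := by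
  obtain ⟨C, hC⟩ := vertexScan_runs
  refine ⟨C * 26 + 100, ?_⟩
  intro K σ k hK hL h32 hk
  set sel := selectProg (.reg 32) (.sub (.reg 0) (.reg 32)) (.read 5 (.reg 32))
    (.sub (.reg 16) (.read 5 (.reg 32))) with hsel
  set sel' := selectProg' (.reg 32) (.sub (.reg 0) (.reg 32)) (.read 5 (.reg 32))
    (.sub (.reg 16) (.read 5 (.reg 32))) with hsel'
  have hlk := hL.L k hk
  have hrk := hL.R (K.n - k) (by omega)
  have s1 := hL.sizeL k hk
  have s2 := hL.sizeR (K.n - k) (by omega)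
  have s3 := hL.sizeM
  have key : Runs vertexBody σ (sel.size + (C * (12 * K.n + 7) + (sel'.size +
      (C * (12 * K.n + 7) + 4)))) (fun σ' => Progress K (K.valV k) σ σ' ∧
      ∀ α ∈ Set.Icc 0 K.A, ∀ β ∈ Set.Icc 0 K.B, Above σ' (K.valV k α β)) := by
    refine (Runs.of_loopFree (p := sel)
      (Q := ScanInput (scanArgs K σ k (K.n - k) (K.pos k) (K.pos K.n - K.pos k))) rfl (by
        constructor <;> simp [hsel, selectProg, scanArgs, Prog.run, hL.n, h32, hL.pos k hk, hL.s,
          hL.x])).seq fun σ₁ F₁ I₁ => ?_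
    have L₁ := hL.frame F₁ rfl
    refine ((hC (A := K.A) (B := K.B) (l := K.L k) (r := K.R (K.n - k)) (mf := K.M) hlk hrk hL.M
      (hK.L_mono k hk) (hK.R_mono _ (by omega)) hK.M_mono (by simp [scanArgs]) I₁).mono
      (T' := C * (12 * K.n + 7)) (Nat.mul_le_mul_left _ (by simp only [scanArgs]; omega))
      fun _ _ h => h).seq fun σ₂ F₂ V₂ => ?_
    have L₂ := L₁.frame F₂ rfl
    have e32 : σ₂.nreg 32 = k := by rw [F₂.nreg 32 rfl, F₁.nreg 32 rfl, h32]
    refine (Runs.of_loopFree (p := sel')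
      (Q := ScanInput (scanArgs' K σ k (K.n - k) (K.pos k) (K.pos K.n - K.pos k))) rfl (by
        constructor <;> simp [hsel', selectProg', scanArgs', Prog.run, L₂.n, e32, L₂.pos k hk,
          L₂.s, L₂.x] <;>
          first
          | rw [F₂.narr _ rfl, F₁.narr _ rfl]
          | rw [F₂.nreg _ rfl, F₁.nreg _ rfl]
          | rw [F₂.rarr _ rfl, F₁.rarr _ rfl])).seq fun σ₃ F₃ I₃ => ?_
    have L₃ := L₂.frame F₃ rfl
    refine ((hC (A := K.B) (B := K.A) (l := K.R (K.n - k)) (r := K.L k) (mf := K.M) hrk hlk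
      (add_comm K.B K.A ▸ hL.M) (hK.R_mono _ (by omega)) (hK.L_mono k hk) hK.M_mono
      (by simp [scanArgs']) I₃).mono
      (T' := C * (12 * K.n + 7)) (Nat.mul_le_mul_left _ (by simp only [scanArgs']; omega))
      fun _ _ h => h).seq fun σ₄ F₄ V₄ => ?_
    have L₄ := L₃.frame F₄ rfl
    have e32' : σ₄.nreg 32 = k := by rw [F₄.nreg 32 rfl, F₃.nreg 32 rfl, e32]
    have F₅ := (Prog.setN 32 (.add (.reg 32) (.const 1))).frame_run rfl σ₄
    have keep : ∀ w, Above σ₂ w → Above ((Prog.setN 32 (.add (.reg 32) (.const 1))).run σ₄) w :=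
      fun w hw => (V₄.above w (hw.congr (F₃.nreg _ rfl) (F₃.rreg _ rfl))).congr (F₅.nreg _ rfl)
        (F₅.rreg _ rfl)
    refine Runs.of_loopFree rfl ⟨⟨L₄.frame F₅ rfl, ?_, ?_, ?_⟩, ?_⟩
    · simp [Prog.run, e32', h32]
    · intro V hV hall
      have q1 := V₂.below V (hV.congr (F₁.nreg _ rfl) (F₁.rreg _ rfl)) hall
      refine (V₄.below V (q1.congr (F₃.nreg _ rfl) (F₃.rreg _ rfl)) ?_).congr (F₅.nreg _ rfl)
        (F₅.rreg _ rfl)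
      intro β hβ α hα
      have := hall α hα β hβ
      rw [Core.valV, Core.val] at this
      simp only [scanArgs']
      rw [add_comm β, max_comm (K.pos K.n - K.pos k + K.R (K.n - k) β)]
      exact this
    · intro w hw
      exact keep w (V₂.above w (hw.congr (F₁.nreg _ rfl) (F₁.rreg _ rfl)))
    · intro α hα β hβ
      have d1 : ∀ i < σ.narr 1 k, ∀ β ∈ Set.Icc 0 K.B, _ → _ := fun i hi β hβ hc =>
        keep _ (V₂.done i hi β hβ hc)
      have d2 : ∀ i < σ.narr 3 (K.n - k), ∀ α ∈ Set.Icc 0 K.A, _ → _ := fun i hi α hα hc =>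
        (V₄.done i hi α hα hc).congr (F₅.nreg 24 rfl) (F₅.rreg 17 rfl)
      refine ⟨?_, hK.valV_le hk hlk hrk (fun i hi β hβ hc => (d1 i hi β hβ hc).2)
        (fun i hi α hα hc => (d2 i hi α hα hc).2) hα hβ⟩
      -- This shows only that something has been recorded: the last point of one of the lists
      -- satisfies the condition of its scan.
      by_cases hc : K.pos K.n - K.pos k + K.R (K.n - k) β ≤ K.pos k + K.L k K.A
      · refine (d1 _ (Nat.sub_lt hlk.pos Nat.one_pos) β hβ ?_).1
        have := hlk.last
        simp only [scanArgs]
        rw [this]; exact hc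
      · refine (d2 _ (Nat.sub_lt hrk.pos Nat.one_pos) α hα ?_).1
        have := hrk.last
        simp only [scanArgs']
        rw [this]
        have q1 := hK.L_mono k hk hα.2
        have q2 := hK.R_mono (K.n - k) (by omega) hβ.2
        push Not at hc
        linarith
  refine key.mono ?_ fun _ _ h => h
  simp only [hsel, hsel', selectProg, selectProg', Prog.size, NExpr.cost, RExpr.cost]
  nlinarith [Nat.zero_le (C * K.n)]

/-- The values at both ends must have been recorded beforehand, since a balancing location off the
edge is handled by an end of the edge. This is why all vertices are scanned before the edges. -/
theorem edgesBody_runs : ∃ C, ∀ {K : Core} {σ : State} {k : ℕ}, K.Good → Lists K σ →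
    σ.nreg 32 = k → k < K.n →
    (∀ α ∈ Set.Icc 0 K.A, ∀ β ∈ Set.Icc 0 K.B, Above σ (K.valV k α β)) →
    (∀ α ∈ Set.Icc 0 K.A, ∀ β ∈ Set.Icc 0 K.B, Above σ (K.valV (k + 1) α β)) →
    Runs edgesBody σ (C * (K.n + 1)) (fun σ' => Progress K (K.valE k) σ σ' ∧
      ∀ α ∈ Set.Icc 0 K.A, ∀ β ∈ Set.Icc 0 K.B, ∀ y ∈ Set.Icc (K.pos k) (K.pos (k + 1)),
        Above σ' (K.val (K.L (k + 1)) (K.R (K.n - k)) y α β)) := by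
  obtain ⟨C, hC⟩ := edgeScan_runs
  refine ⟨C * 30 + 100, ?_⟩
  intro K σ k hK hL h32 hk hu hv
  set sel := selectProg (.add (.reg 32) (.const 1)) (.sub (.reg 0) (.reg 32)) (.read 5 (.reg 32))
    (.sub (.reg 16) (.read 5 (.add (.reg 32) (.const 1)))) with hsel
  set sel' := selectProg' (.add (.reg 32) (.const 1)) (.sub (.reg 0) (.reg 32)) (.read 5 (.reg 32))
    (.sub (.reg 16) (.read 5 (.add (.reg 32) (.const 1)))) with hsel'
  have hlk := hL.L (k + 1) hk
  have hrk := hL.R (K.n - k) (by omega)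
  have s1 := hL.sizeL (k + 1) hk
  have s2 := hL.sizeR (K.n - k) (by omega)
  have s3 := hL.sizeM
  have key : Runs edgesBody σ (sel.size + (C * (12 * K.n + 11) + (sel'.size +
      (C * (12 * K.n + 11) + 4)))) (fun σ' => Progress K (K.valE k) σ σ' ∧
      ∀ α ∈ Set.Icc 0 K.A, ∀ β ∈ Set.Icc 0 K.B, ∀ y ∈ Set.Icc (K.pos k) (K.pos (k + 1)),
        Above σ' (K.val (K.L (k + 1)) (K.R (K.n - k)) y α β)) := by
    refine (Runs.of_loopFree (p := sel)
      (Q := ScanInput (scanArgs K σ (k + 1) (K.n - k) (K.pos k) (K.pos K.n - K.pos (k + 1)))) rfl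
      (by
        constructor <;> simp [hsel, selectProg, scanArgs, Prog.run, hL.n, h32, hL.pos k hk.le,
          hL.pos (k + 1) hk, hL.s, hL.x])).seq fun σ₁ F₁ I₁ => ?_
    have L₁ := hL.frame F₁ rfl
    refine ((hC (A := K.A) (B := K.B) (l := K.L (k + 1)) (r := K.R (K.n - k)) (mf := K.M) hlk hrk
      hL.M (hK.L_convex _) I₁).mono
      (T' := C * (12 * K.n + 11)) (Nat.mul_le_mul_left _ (by simp only [scanArgs]; omega))
      fun _ _ h => h).seq fun σ₂ F₂ V₂ => ?_
    have L₂ := L₁.frame F₂ rfl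
    have e32 : σ₂.nreg 32 = k := by rw [F₂.nreg 32 rfl, F₁.nreg 32 rfl, h32]
    refine (Runs.of_loopFree (p := sel')
      (Q := ScanInput (scanArgs' K σ (k + 1) (K.n - k) (K.pos k) (K.pos K.n - K.pos (k + 1)))) rfl
      (by
        constructor <;> simp [hsel', selectProg', scanArgs', Prog.run, L₂.n, e32, L₂.pos k hk.le,
          L₂.pos (k + 1) hk, L₂.s, L₂.x] <;>
          first
          | rw [F₂.narr _ rfl, F₁.narr _ rfl]
          | rw [F₂.nreg _ rfl, F₁.nreg _ rfl]
          | rw [F₂.rarr _ rfl, F₁.rarr _ rfl])).seq fun σ₃ F₃ I₃ => ?_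
    have L₃ := L₂.frame F₃ rfl
    refine ((hC (A := K.B) (B := K.A) (l := K.R (K.n - k)) (r := K.L (k + 1)) (mf := K.M) hrk hlk
      (add_comm K.B K.A ▸ hL.M) (hK.R_convex _) I₃).mono
      (T' := C * (12 * K.n + 11)) (Nat.mul_le_mul_left _ (by simp only [scanArgs']; omega))
      fun _ _ h => h).seq fun σ₄ F₄ V₄ => ?_
    have L₄ := L₃.frame F₄ rfl
    have e32' : σ₄.nreg 32 = k := by rw [F₄.nreg 32 rfl, F₃.nreg 32 rfl, e32]
    have F₅ := (Prog.setN 32 (.add (.reg 32) (.const 1))).frame_run rfl σ₄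
    have keep : ∀ w, Above σ₂ w → Above ((Prog.setN 32 (.add (.reg 32) (.const 1))).run σ₄) w :=
      fun w hw => (V₄.above w (hw.congr (F₃.nreg _ rfl) (F₃.rreg _ rfl))).congr (F₅.nreg _ rfl)
        (F₅.rreg _ rfl)
    have keep' : ∀ w, Above σ w → Above ((Prog.setN 32 (.add (.reg 32) (.const 1))).run σ₄) w :=
      fun w hw => keep w (V₂.above w (hw.congr (F₁.nreg _ rfl) (F₁.rreg _ rfl)))
    have hswap : ∀ α β, max 0 (K.x + K.M (β + α)) -
        max (max 0 (max (K.pos K.n - K.pos (k + 1) + K.R (K.n - k) β) (K.pos k + K.L (k + 1) α)))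
          ((K.R (K.n - k) β + K.L (k + 1) α + K.pos K.n) / 2) = K.valE k α β := by
      intro α β
      rw [Core.valE, add_comm β, max_comm (K.pos K.n - K.pos (k + 1) + K.R (K.n - k) β),
        add_comm (K.R (K.n - k) β)]
    refine Runs.of_loopFree rfl ⟨⟨L₄.frame F₅ rfl, ?_, ?_, keep'⟩, ?_⟩
    · simp [Prog.run, e32', h32]
    · intro V hV hall
      have q1 := V₂.below V (hV.congr (F₁.nreg _ rfl) (F₁.rreg _ rfl)) hall
      refine (V₄.below V (q1.congr (F₃.nreg _ rfl) (F₃.rreg _ rfl)) ?_).congr (F₅.nreg _ rfl)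
        (F₅.rreg _ rfl)
      intro β hβ α hα
      exact (hswap α β).trans_le (hall α hα β hβ)
    · intro α hα β hβ y hy
      refine ⟨(keep' _ (hu α hα β hβ)).1, hK.val_le hk hlk hrk (fun i hi => ?_) (fun j hj => ?_)
        (fun α hα β hβ => (keep' _ (hu α hα β hβ)).2) (fun α hα β hβ => (keep' _ (hv α hα β hβ)).2)
        hα hβ hy⟩
      · obtain ⟨j, hj, h1, h2, h3⟩ := V₂.done i hi
        exact ⟨j, hj, h1, h2, (keep _ h3).2⟩
      · obtain ⟨i, hi, h1, h2, h3⟩ := V₄.done j hj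
        refine ⟨i, hi, h1, h2, ?_⟩
        rw [← hswap]
        exact (h3.congr (F₅.nreg 24 rfl) (F₅.rreg 17 rfl)).2
  refine key.mono ?_ fun _ _ h => h
  simp only [hsel, hsel', selectProg, selectProg', Prog.size, NExpr.cost, RExpr.cost]
  nlinarith [Nat.zero_le (C * K.n)]

/-- All scans. -/
def scanAll : Prog :=
  .seq (.setN 32 (.reg 25)) <| .seq (.loop (.nle (.reg 32) (.reg 26)) vertexBody) <|
  .seq (.setN 32 (.reg 25)) (.loop (.nle (.add (.reg 32) (.const 1)) (.reg 26)) edgesBody)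

/-- The value recorded is at least all values of the problem `K`, and nothing else has been
recorded. -/
structure Solved (K : Core) (σ σ' : State) : Prop where
  below : ∀ V, Below σ V →
    (∀ k, K.p ≤ k → k ≤ K.q → ∀ α ∈ Set.Icc 0 K.A, ∀ β ∈ Set.Icc 0 K.B, K.valV k α β ≤ V) →
    (∀ k, K.p ≤ k → k < K.q → ∀ α ∈ Set.Icc 0 K.A, ∀ β ∈ Set.Icc 0 K.B, K.valE k α β ≤ V) →
    Below σ' V
  above : ∀ w, Above σ w → Above σ' w
  vertex : ∀ k, K.p ≤ k → k ≤ K.q → ∀ α ∈ Set.Icc 0 K.A, ∀ β ∈ Set.Icc 0 K.B,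
    Above σ' (K.valV k α β)
  edge : ∀ k, K.p ≤ k → k < K.q → ∀ α ∈ Set.Icc 0 K.A, ∀ β ∈ Set.Icc 0 K.B,
    ∀ y ∈ Set.Icc (K.pos k) (K.pos (k + 1)), Above σ' (K.val (K.L (k + 1)) (K.R (K.n - k)) y α β)

theorem scanAll_runs : ∃ C, ∀ {K : Core} {σ : State}, K.Good → Lists K σ →
    Runs scanAll σ (C * (K.n + 1) ^ 2) (Solved K σ) := by
  obtain ⟨C₁, hC₁⟩ := vertexBody_runs
  obtain ⟨C₂, hC₂⟩ := edgesBody_runs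
  refine ⟨C₁ + C₂ + 30, ?_⟩
  intro K σ hK hL
  let I : ℕ → State → Prop := fun k τ => Lists K τ ∧ τ.nreg 32 = k ∧ K.p ≤ k ∧
    (∀ V, Below σ V →
      (∀ k, K.p ≤ k → k ≤ K.q → ∀ α ∈ Set.Icc 0 K.A, ∀ β ∈ Set.Icc 0 K.B, K.valV k α β ≤ V) →
      Below τ V) ∧ (∀ w, Above σ w → Above τ w) ∧
    ∀ k', K.p ≤ k' → k' < k → ∀ α ∈ Set.Icc 0 K.A, ∀ β ∈ Set.Icc 0 K.B, Above τ (K.valV k' α β)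
  let I' : ℕ → State → Prop := fun k τ => Lists K τ ∧ τ.nreg 32 = k ∧ K.p ≤ k ∧ (∀ V, Below σ V →
      (∀ k, K.p ≤ k → k ≤ K.q → ∀ α ∈ Set.Icc 0 K.A, ∀ β ∈ Set.Icc 0 K.B, K.valV k α β ≤ V) →
      (∀ k, K.p ≤ k → k < K.q → ∀ α ∈ Set.Icc 0 K.A, ∀ β ∈ Set.Icc 0 K.B, K.valE k α β ≤ V) →
      Below τ V) ∧ (∀ w, Above σ w → Above τ w) ∧
    (∀ k, K.p ≤ k → k ≤ K.q → ∀ α ∈ Set.Icc 0 K.A, ∀ β ∈ Set.Icc 0 K.B,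
      Above τ (K.valV k α β)) ∧
    ∀ k', K.p ≤ k' → k' < k → ∀ α ∈ Set.Icc 0 K.A, ∀ β ∈ Set.Icc 0 K.B,
      ∀ y ∈ Set.Icc (K.pos k') (K.pos (k' + 1)),
        Above τ (K.val (K.L (k' + 1)) (K.R (K.n - k')) y α β)
  have hp := hK.p_le
  have hq := hK.q_le
  have key : Runs scanAll σ (2 + ((K.q + 1 - K.p) * (C₁ * (K.n + 1) + 3) + 3 +
      (2 + ((K.q - K.p) * (C₂ * (K.n + 1) + 5) + 5)))) (I' K.q) := by
    refine (Runs.of_loopFree (Q := I K.p) rfl ?_).seq fun σ₁ F₁ I₁ => ?_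
    · have F := (Prog.setN 32 (.reg 25)).frame_run rfl σ
      refine ⟨hL.frame F rfl, by simp [Prog.run, hL.p], le_rfl,
        fun V hV _ => hV.congr (F.nreg _ rfl) (F.rreg _ rfl),
        fun w hw => hw.congr (F.nreg _ rfl) (F.rreg _ rfl), fun k' h1 h2 => by omega⟩
    refine (Runs.for_loop (b := .nle (.reg 32) (.reg 26)) (p := vertexBody)
      (T := C₁ * (K.n + 1)) (I := I) (N := K.q + 1) (k := K.p)
      (fun k τ _ h => by simp only [Test.holds, NExpr.eval, h.1.q, h.2.1]; omega)
      (fun k τ hk h => ?_) (by omega) I₁).seq fun σ₂ F₂ I₂ => ?_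
    · obtain ⟨h1, h2, hkp, h3, h4, h5⟩ := h
      refine (hC₁ hK h1 h2 (by omega)).mono le_rfl fun τ' F ⟨g1, g2⟩ => ?_
      refine ⟨g1.lists, by rw [g1.n32, h2], by omega, fun V hV hall =>
        g1.below V (h3 V hV hall) (hall k hkp (by omega)), fun w hw => g1.above w (h4 w hw),
        fun k' q1 q2 α hα β hβ => ?_⟩
      rcases Nat.lt_succ_iff_lt_or_eq.1 q2 with q2 | rfl
      · exact g1.above _ (h5 k' q1 q2 α hα β hβ)
      · exact g2 α hα β hβ
    refine (Runs.of_loopFree (Q := I' K.p) rfl ?_).seq fun σ₃ F₃ I₃ => ?_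
    · have F := (Prog.setN 32 (.reg 25)).frame_run rfl σ₂
      obtain ⟨h1, h2, -, h3, h4, h5⟩ := I₂
      refine ⟨h1.frame F rfl, by simp [Prog.run, h1.p], le_rfl,
        fun V hV hall _ => (h3 V hV hall).congr (F.nreg _ rfl) (F.rreg _ rfl),
        fun w hw => (h4 w hw).congr (F.nreg _ rfl) (F.rreg _ rfl),
        fun k' q1 q2 α hα β hβ => (h5 k' q1 (by omega) α hα β hβ).congr (F.nreg _ rfl)
          (F.rreg _ rfl), fun k' q1 q2 => by omega⟩
    refine Runs.for_loop (b := .nle (.add (.reg 32) (.const 1)) (.reg 26)) (p := edgesBody)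
      (T := C₂ * (K.n + 1)) (I := I') (N := K.q) (k := K.p)
      (fun k τ _ h => by simp only [Test.holds, NExpr.eval, h.1.q, h.2.1]; omega)
      (fun k τ hk h => ?_) hp I₃
    obtain ⟨h1, h2, hkp, h3, h4, h5, h6⟩ := h
    refine (hC₂ hK h1 h2 (by omega) (h5 k hkp hk.le) (h5 (k + 1) (by omega) hk)).mono le_rfl
      fun τ' F ⟨g1, g2⟩ => ?_
    refine ⟨g1.lists, by rw [g1.n32, h2], by omega, fun V hV hall hall' =>
      g1.below V (h3 V hV hall hall') (hall' k hkp hk), fun w hw => g1.above w (h4 w hw),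
      fun k' q1 q2 α hα β hβ => g1.above _ (h5 k' q1 q2 α hα β hβ),
      fun k' q1 q2 α hα β hβ y hy => ?_⟩
    rcases Nat.lt_succ_iff_lt_or_eq.1 q2 with q2 | rfl
    · exact g1.above _ (h6 k' q1 q2 α hα β hβ y hy)
    · exact g2 α hα β hβ y hy
  refine key.mono ?_ fun τ _ ⟨_, _, _, h1, h2, h3, h4⟩ => ⟨h1, h2, h3, h4⟩
  have e1 : (K.q + 1 - K.p) * (C₁ * (K.n + 1) + 3) ≤ (K.n + 1) * (C₁ * (K.n + 1) + 3) :=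
    Nat.mul_le_mul_right _ (by omega)
  have e2 : (K.q - K.p) * (C₂ * (K.n + 1) + 5) ≤ (K.n + 1) * (C₂ * (K.n + 1) + 5) :=
    Nat.mul_le_mul_right _ (by omega)
  nlinarith

/-! ### Building all lists -/

/-- Load positions, prefix weights and capacities; `ie` and `iv` are the indices of the edge and of
the vertex with number `nreg 8`. -/
def loadProg (ie iv : NExpr) : Prog :=
  .seq (.setN 8 (.const 0)) <| .seq (.storeR 5 (.const 0) (.const 0)) <|
  .seq (.storeR 6 (.const 0) (.read 4 iv)) <|
  .loop (.nle (.add (.reg 8) (.const 1)) (.reg 0)) <|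
    .seq (.storeR 7 (.reg 8) (.read 1 ie)) <|
    .seq (.storeR 5 (.add (.reg 8) (.const 1)) (.add (.read 5 (.reg 8)) (.read 0 ie))) <|
    .seq (.setN 8 (.add (.reg 8) (.const 1))) <|
    .storeR 6 (.reg 8) (.add (.read 6 (.sub (.reg 8) (.const 1))) (.read 4 iv))

/-- Positions, prefix weights and capacities up to vertex `t` have been loaded. -/
structure Loaded (d c w : ℕ → ℝ) (t : ℕ) (σ : State) : Prop where
  x : ∀ k ≤ t, σ.rarr 5 k = ∑ e ∈ Finset.range k, d e
  W : ∀ k ≤ t, σ.rarr 6 k = ∑ e ∈ Finset.range (k + 1), w e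
  c : ∀ k < t, σ.rarr 7 k = c k

theorem loadProg_runs {ie iv : NExpr} {fe fv : ℕ → ℕ → ℕ}
    (hie : ∀ τ : State, ie.eval τ = fe (τ.nreg 0) (τ.nreg 8))
    (hiv : ∀ τ : State, iv.eval τ = fv (τ.nreg 0) (τ.nreg 8)) :
    ∃ C, ∀ {σ : State} {n : ℕ} {d c w : ℕ → ℝ}, σ.nreg 0 = n →
      (∀ t < n, σ.rarr 0 (fe n t) = d t) → (∀ t < n, σ.rarr 1 (fe n t) = c t) →
      (∀ t ≤ n, σ.rarr 4 (fv n t) = w t) →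
      Runs (loadProg ie iv) σ (C * (n + 1)) (Loaded d c w n) := by
  set body : Prog := .seq (.storeR 7 (.reg 8) (.read 1 ie)) <|
    .seq (.storeR 5 (.add (.reg 8) (.const 1)) (.add (.read 5 (.reg 8)) (.read 0 ie))) <|
    .seq (.setN 8 (.add (.reg 8) (.const 1))) <|
    .storeR 6 (.reg 8) (.add (.read 6 (.sub (.reg 8) (.const 1))) (.read 4 iv)) with hbody
  refine ⟨body.size + iv.cost + 20, ?_⟩
  intro σ n d c w hn hd hc hw
  let I : ℕ → State → Prop := fun t τ => Loaded d c w t τ ∧ τ.nreg 0 = n ∧ τ.nreg 8 = t ∧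
    τ.rarr 0 = σ.rarr 0 ∧ τ.rarr 1 = σ.rarr 1 ∧ τ.rarr 4 = σ.rarr 4
  have key : Runs (loadProg ie iv) σ (2 + (3 + ((Prog.storeR 6 (.const 0) (.read 4 iv)).size +
      ((n - 0) * (body.size + 5) + 5)))) (I n) := by
    refine (Runs.of_loopFree (Q := fun τ => τ = σ.setN 8 0) rfl rfl).seq ?_
    rintro _ - rfl
    refine (Runs.of_loopFree (Q := fun τ => τ = (σ.setN 8 0).putR 5 0 0) rfl
      (by simp [Prog.run])).seq ?_
    rintro _ - rfl
    refine (Runs.of_loopFree (Q := I 0) rfl ?_).seq fun σ₁ _ h => ?_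
    · refine ⟨⟨?_, ?_, ?_⟩, ?_, ?_, ?_, ?_, ?_⟩ <;> simp [Prog.run, hn, hiv]
      rw [hw 0 (Nat.zero_le _)]
    · refine Runs.for_loop (b := .nle (.add (.reg 8) (.const 1)) (.reg 0)) (p := body)
        (T := body.size) (I := I) (N := n) (k := 0)
        (fun k τ _ h => by simp only [Test.holds, NExpr.eval, h.2.1, h.2.2.1]; omega)
        (fun k τ hk h => ?_) (Nat.zero_le _) h
      obtain ⟨⟨h1, h2, h3⟩, h4, h5, h6, h7, h8⟩ := h
      refine Runs.of_loopFree rfl ?_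
      refine ⟨⟨?_, ?_, ?_⟩, ?_, ?_, ?_, ?_, ?_⟩ <;>
        simp [hbody, Prog.run, h4, h5, h6, h7, h8, hie, hiv]
      · intro t ht
        rcases Nat.le_succ_iff.1 ht with ht | rfl
        · rw [Function.update_of_ne (by omega), h1 t ht]
        · rw [Function.update_self, h1 k le_rfl, hd k hk, Finset.sum_range_succ]
      · intro t ht
        rcases Nat.le_succ_iff.1 ht with ht | rfl
        · rw [Function.update_of_ne (by omega), h2 t ht]
        · rw [Function.update_self, h2 k le_rfl, hw (k + 1) hk, Finset.sum_range_succ _ (k + 1)]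
      · intro t ht
        rcases Nat.lt_or_eq_of_le ht with ht | rfl
        · rw [Function.update_of_ne (by omega), h3 t ht]
        · rw [Function.update_self, hc t hk]
  refine key.mono ?_ fun τ _ h => h.1
  simp only [Nat.sub_zero, Prog.size, NExpr.cost, RExpr.cost]
  generalize body.size = a
  generalize iv.cost = b
  nlinarith [Nat.zero_le (b * n)]

/-- Copy the index arrays `0` and `1` to `2` and `3`. -/
def copyProg : Prog :=
  .seq (.setN 8 (.const 0)) <| .loop (.nle (.reg 8) (.reg 0)) <|
    .seq (.storeN 2 (.reg 8) (.read 0 (.reg 8))) <| .seq (.storeN 3 (.reg 8) (.read 1 (.reg 8))) <|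
    .setN 8 (.add (.reg 8) (.const 1))

theorem copyProg_runs : ∃ C, ∀ {σ : State} {n : ℕ}, σ.nreg 0 = n →
    Runs copyProg σ (C * (n + 1)) (fun σ' => ∀ k ≤ n,
      σ'.narr 2 k = σ.narr 0 k ∧ σ'.narr 3 k = σ.narr 1 k) := by
  refine ⟨30, ?_⟩
  intro σ n hn
  set body : Prog := .seq (.storeN 2 (.reg 8) (.read 0 (.reg 8))) <|
    .seq (.storeN 3 (.reg 8) (.read 1 (.reg 8))) <| .setN 8 (.add (.reg 8) (.const 1)) with hbody
  let I : ℕ → State → Prop := fun t τ => τ.nreg 0 = n ∧ τ.nreg 8 = t ∧ τ.narr 0 = σ.narr 0 ∧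
    τ.narr 1 = σ.narr 1 ∧ ∀ k < t, τ.narr 2 k = σ.narr 0 k ∧ τ.narr 3 k = σ.narr 1 k
  have key : Runs copyProg σ (2 + ((n + 1 - 0) * (body.size + 3) + 3)) (I (n + 1)) := by
    refine (Runs.of_loopFree (Q := I 0) rfl (by
      refine ⟨?_, ?_, ?_, ?_, ?_⟩ <;> simp [Prog.run, hn])).seq fun σ₁ _ h => ?_
    refine Runs.for_loop (b := .nle (.reg 8) (.reg 0)) (p := body)
      (T := body.size) (I := I) (N := n + 1) (k := 0)
      (fun k τ _ h => by simp only [Test.holds, NExpr.eval, h.1, h.2.1]; omega)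
      (fun k τ hk h => ?_) (Nat.zero_le _) h
    obtain ⟨h1, h2, h3, h4, h5⟩ := h
    refine Runs.of_loopFree rfl ?_
    refine ⟨?_, ?_, ?_, ?_, ?_⟩ <;> simp [hbody, Prog.run, h1, h2, h3, h4]
    intro t ht
    rcases Nat.lt_or_eq_of_le ht with ht | rfl
    · rw [Function.update_of_ne (by omega), Function.update_of_ne (by omega)]
      exact h5 t ht
    · simp
  refine key.mono ?_ fun τ _ h k hk => h.2.2.2.2 k (by omega)
  simp only [hbody, Nat.sub_zero, Prog.size, NExpr.cost]
  omega

/-- Number of edges before `x`, then select the list with this index. -/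
def countProg : Prog :=
  .seq (.setN 31 (.const 0)) <|
  .seq (.loop (.and (.nle (.add (.reg 31) (.const 1)) (.reg 0))
      (.not (.rle (.reg 22) (.read 5 (.reg 31))))) (.setN 31 (.add (.reg 31) (.const 1)))) <|
  .seq (.setN 18 (.read 0 (.reg 31))) (.setN 19 (.read 1 (.reg 31)))

theorem countProg_runs : ∃ C, ∀ {σ : State} {n E : ℕ}, σ.nreg 0 = n → E ≤ n →
    (∀ e < E, σ.rarr 5 e < σ.rreg 22) → (E < n → σ.rreg 22 ≤ σ.rarr 5 E) →
    Runs countProg σ (C * (n + 1)) (fun σ' => σ'.nreg 18 = σ.narr 0 E ∧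
      σ'.nreg 19 = σ.narr 1 E) := by
  refine ⟨40, ?_⟩
  intro σ n E hn hE h1 h2
  let I : ℕ → State → Prop := fun t τ => τ.nreg 0 = n ∧ τ.nreg 31 = t ∧ τ.narr 0 = σ.narr 0 ∧
    τ.narr 1 = σ.narr 1 ∧ τ.rarr 5 = σ.rarr 5 ∧ τ.rreg 22 = σ.rreg 22
  have key : Runs countProg σ (2 + (((E - 0) * (4 + 11) + 11) + 6))
      (fun σ' => σ'.nreg 18 = σ.narr 0 E ∧ σ'.nreg 19 = σ.narr 1 E) := by
    refine (Runs.of_loopFree (Q := I 0) rfl (by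
      refine ⟨?_, ?_, ?_, ?_, ?_, ?_⟩ <;> simp [Prog.run, hn])).seq fun σ₁ _ h => ?_
    refine (Runs.for_loop (b := .and (.nle (.add (.reg 31) (.const 1)) (.reg 0))
      (.not (.rle (.reg 22) (.read 5 (.reg 31))))) (p := .setN 31 (.add (.reg 31) (.const 1)))
      (T := 4) (I := I) (N := E) (k := 0)
      (fun k τ hk h => ?_) (fun k τ hk h => ?_) (Nat.zero_le _) h).seq fun σ₂ _ h => ?_
    · obtain ⟨g1, g2, g3, g4, g5, g6⟩ := h
      simp only [Test.holds, NExpr.eval, RExpr.eval, g1, g2, g5, g6, not_le]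
      constructor
      · rintro ⟨q1, q2⟩
        refine lt_of_le_of_ne hk ?_
        rintro rfl
        exact absurd (h2 q1) (not_le.2 q2)
      · exact fun q => ⟨by omega, h1 k q⟩
    · obtain ⟨g1, g2, g3, g4, g5, g6⟩ := h
      exact Runs.of_loopFree rfl ⟨by simp [Prog.run, g1], by simp [Prog.run, g2], g3, g4, g5, g6⟩
    · obtain ⟨g1, g2, g3, g4, g5, g6⟩ := h
      exact Runs.of_loopFree rfl (by simp [Prog.run, g2, g3, g4])
  exact key.mono (by omega) fun _ _ h => h

end RealRAM

/-- The problem of maximizing the objective minus the height over all additional weights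
`0 ≤ α ≤ A` at `i` and `0 ≤ β ≤ B` at `i'` in the scenario `w`.  The objective at `x` counts the
vertices between `lo` and `hi`, the locations range from vertex `p` to vertex `q`, and `fL`, `fR`
tell whether `α`, `β` are to be treated as positive. -/
structure EvacTask where
  P : PathNetwork
  w : ℕ → ℝ
  i : ℕ
  i' : ℕ
  p : ℕ
  q : ℕ
  lo : ℕ
  hi : ℕ
  fL : ℕ
  fR : ℕ
  x : ℝ
  A : ℝ
  B : ℝ

/-! ### Envelopes for the two sides and for the objective of a task -/

namespace EvacTask

open PathNetwork

variable (T : EvacTask)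

/-- Envelopes for the left side. -/
noncomputable def left : Envelope where
  n := T.P.n
  x := T.P.pos
  c := T.P.cap
  W := weight T.w 0
  i := T.i
  lo := 0
  hi := T.P.n
  f := T.fL

/-- Envelopes for the right side. -/
noncomputable def right : Envelope where
  n := T.P.n
  x := T.P.rev.pos
  c := T.P.rev.cap
  W := weight (T.P.revScenario T.w) 0
  i := T.P.n - T.i'
  lo := 0
  hi := T.P.n
  f := T.fR

/-- Envelopes for the objective. -/
noncomputable def obj : Envelope where
  n := T.P.n
  x := T.P.pos
  c := T.P.cap
  W := weight T.w 0
  i := T.i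
  lo := T.lo
  hi := T.hi
  f := T.fL + T.fR

theorem exists_edges : ∃ E, ¬ (E < T.P.n ∧ T.P.pos E < T.x) := ⟨T.P.n, by simp⟩

open Classical in
/-- Number of edges that start before `x`. -/
noncomputable def edges : ℕ := Nat.find T.exists_edges

theorem edges_le : T.edges ≤ T.P.n := Nat.find_min' _ (by simp)

theorem pos_lt_of_lt {e : ℕ} (he : e < T.edges) : T.P.pos e < T.x := by
  have := Nat.find_min T.exists_edges he
  rw [not_not] at this
  exact this.2

theorem le_pos_edges (h : T.edges < T.P.n) : T.x ≤ T.P.pos T.edges := by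
  have := Nat.find_spec T.exists_edges
  by_contra hlt
  exact this ⟨h, not_le.1 hlt⟩

theorem lt_edges_iff {e : ℕ} (he : e < T.P.n) : e < T.edges ↔ T.P.pos e < T.x := by
  refine ⟨T.pos_lt_of_lt, fun h => ?_⟩
  by_contra hlt
  have h1 := T.le_pos_edges (by omega)
  have h2 := T.P.pos_le (show T.edges ≤ e by omega) he.le
  linarith

/-- The optimization problem. -/
noncomputable def core : Core where
  n := T.P.n
  pos := T.P.pos
  L := T.left.env
  R := T.right.env
  M := T.obj.env T.edges
  x := T.x
  A := T.A
  B := T.B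
  p := T.p
  q := T.q

/-- Conditions on the data. -/
structure Good : Prop where
  w_nonneg : ∀ t ≤ T.P.n, 0 ≤ T.w t
  p_le : T.p ≤ T.q
  q_le : T.q ≤ T.P.n
  A_nonneg : 0 ≤ T.A
  B_nonneg : 0 ≤ T.B

variable {T}

theorem Good.left (h : T.Good) : T.left.Good where
  c_pos := T.P.cap_pos
  x_mono _ _ := T.P.pos_le
  W_nonneg _ ht := weight_nonneg h.w_nonneg ht

theorem Good.right (h : T.Good) : T.right.Good where
  c_pos := T.P.rev.cap_pos
  x_mono _ _ := T.P.rev.pos_le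
  W_nonneg _ ht := weight_nonneg (P := T.P.rev) (fun _ _ => h.w_nonneg _ (Nat.sub_le _ _)) ht

theorem Good.obj (h : T.Good) : T.obj.Good where
  c_pos := T.P.cap_pos
  x_mono _ _ := T.P.pos_le
  W_nonneg _ ht := weight_nonneg h.w_nonneg ht

theorem Good.core (h : T.Good) : T.core.Good where
  p_le := h.p_le
  q_le := h.q_le
  pos_mono _ _ := T.P.pos_le
  pos_zero := T.P.pos_zero
  L_mono _ hm := Envelope.env_monotone h.left hm
  R_mono _ hm := Envelope.env_monotone h.right hm
  L_convex := Envelope.env_convex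
  R_convex := Envelope.env_convex
  L_cont := Envelope.env_continuous
  R_cont := Envelope.env_continuous
  L_le _ _ h α := Envelope.env_mono_left h α
  R_le _ _ h α := Envelope.env_mono_left h α
  L_sign m hm := Envelope.env_dichotomy h.left hm
  R_sign m hm := by
    rcases Envelope.env_dichotomy h.right hm with h1 | ⟨e, he, h1⟩
    · left
      intro β
      have := h1 β
      simp only [EvacTask.right, pos_rev_n] at this
      exact this
    · right
      refine ⟨e, he, fun β hβ => ?_⟩
      have := h1 β hβ
      have hm' : m ≤ T.P.n := hm
      simp only [EvacTask.right] at this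
      rw [pos_rev (by omega)] at this
      exact this
  M_mono := Envelope.env_monotone h.obj T.edges_le
  M_support := Envelope.env_support h.obj T.edges_le

end EvacTask

/-! ### Writing all lists of a task into memory -/

namespace RealRAM

/-- A task is in memory. -/
structure TaskInput (T : EvacTask) (σ : State) : Prop where
  n : σ.nreg 0 = T.P.n
  i : σ.nreg 33 = T.i
  i' : σ.nreg 34 = T.i'
  p : σ.nreg 25 = T.p
  q : σ.nreg 26 = T.q
  lo : σ.nreg 27 = T.lo
  hi : σ.nreg 28 = T.hi
  fL : σ.nreg 29 = T.fL
  fR : σ.nreg 30 = T.fR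
  x : σ.rreg 22 = T.x
  A : σ.rreg 10 = T.A
  B : σ.rreg 11 = T.B
  len : ∀ k < T.P.n, σ.rarr 0 k = T.P.len k
  cap : ∀ k < T.P.n, σ.rarr 1 k = T.P.cap k
  w : ∀ k ≤ T.P.n, σ.rarr 4 k = T.w k

/-- The task is left alone. -/
def Prog.keepsTask (p : Prog) : Bool :=
  !(p.writesN 0 || p.writesN 33 || p.writesN 34 || p.writesN 25 || p.writesN 26 || p.writesN 27 ||
    p.writesN 28 || p.writesN 29 || p.writesN 30 || p.writesR 22 || p.writesR 10 ||
    p.writesR 11 || p.storesR 0 || p.storesR 1 || p.storesR 4)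

theorem TaskInput.frame {T : EvacTask} {σ σ' : State} {p : Prog} (h : TaskInput T σ)
    (F : Frame p σ σ') (hp : p.keepsTask = true) : TaskInput T σ' := by
  simp only [Prog.keepsTask, Bool.not_eq_true', Bool.or_eq_false_iff] at hp
  obtain ⟨⟨⟨⟨⟨⟨⟨⟨⟨⟨⟨⟨⟨⟨h1, h2⟩, h3⟩, h4⟩, h5⟩, h6⟩, h7⟩, h8⟩, h9⟩, h10⟩, h11⟩, h12⟩, h13⟩, h14⟩,
    h15⟩ := hp
  obtain ⟨e1, e2, e3, e4, e5, e6, e7, e8, e9, e10, e11, e12, e13, e14, e15⟩ := h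
  exact ⟨by rw [F.nreg _ h1, e1], by rw [F.nreg _ h2, e2], by rw [F.nreg _ h3, e3],
    by rw [F.nreg _ h4, e4], by rw [F.nreg _ h5, e5], by rw [F.nreg _ h6, e6],
    by rw [F.nreg _ h7, e7], by rw [F.nreg _ h8, e8], by rw [F.nreg _ h9, e9],
    by rw [F.rreg _ h10, e10], by rw [F.rreg _ h11, e11], by rw [F.rreg _ h12, e12],
    by rwa [F.rarr _ h13], by rwa [F.rarr _ h14], by rwa [F.rarr _ h15]⟩

/-- Set the parameters for building envelopes. -/
def paramProg (i lo hi f : NExpr) (D : RExpr) : Prog :=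
  .seq (.setN 3 i) <| .seq (.setN 4 lo) <| .seq (.setN 5 hi) <| .seq (.setN 6 f) (.setR 1 D)

/-- Load the reversed path. -/
def loadRight : Prog :=
  loadProg (.sub (.sub (.reg 0) (.const 1)) (.reg 8)) (.sub (.reg 0) (.reg 8))

/-- Load the path. -/
def loadLeft : Prog := loadProg (.reg 8) (.reg 8)

/-- Build all lists. -/
def listsProg : Prog :=
  .seq (.setN 7 (.const 0)) <|
  .seq loadRight <|
  .seq (paramProg (.sub (.reg 0) (.reg 34)) (.const 0) (.reg 0) (.reg 30) (.reg 11)) <|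
  .seq buildProg <|
  .seq copyProg <|
  .seq loadLeft <|
  .seq (paramProg (.reg 33) (.reg 27) (.reg 28) (.add (.reg 29) (.reg 30))
    (.add (.reg 10) (.reg 11))) <|
  .seq buildProg <|
  .seq countProg <|
  .seq (paramProg (.reg 33) (.const 0) (.reg 0) (.reg 29) (.reg 10)) <|
  .seq buildProg <|
  .setR 16 (.read 5 (.reg 0))

theorem weight_zero (s : ℕ → ℝ) (t : ℕ) :
    PathNetwork.weight s 0 t = ∑ e ∈ Finset.range (t + 1), s e := by
  rw [PathNetwork.weight, Finset.range_eq_Ico]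
  congr 1

/-- The three families are built one behind the other in the same arrays, each from the current end
of the used memory on. Every construction overwrites the index arrays 0 and 1. So those of the right
side are copied away, and of the objective only the list for the edges that start before x is
remembered, by its place and length. The left side comes last and keeps arrays 0 and 1. -/
theorem listsProg_runs : ∃ C, ∀ {T : EvacTask} {σ : State}, T.Good → TaskInput T σ →
    Runs listsProg σ (C * (T.P.n + 1) ^ 2) (Lists T.core) := by
  obtain ⟨C₁, hC₁⟩ := loadProg_runs (ie := .sub (.sub (.reg 0) (.const 1)) (.reg 8))
    (iv := .sub (.reg 0) (.reg 8)) (fe := fun n k => n - 1 - k) (fv := fun n k => n - k)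
    (fun _ => rfl) (fun _ => rfl)
  obtain ⟨C₂, hC₂⟩ := loadProg_runs (ie := .reg 8) (iv := .reg 8) (fe := fun _ k => k)
    (fv := fun _ k => k) (fun _ => rfl) (fun _ => rfl)
  obtain ⟨C₃, hC₃⟩ := buildProg_runs
  obtain ⟨C₄, hC₄⟩ := copyProg_runs
  obtain ⟨C₅, hC₅⟩ := countProg_runs
  refine ⟨C₁ + C₂ + 3 * C₃ + C₄ + C₅ + 60, ?_⟩
  intro T σ hT hI
  set n := T.P.n with hn
  have key : Runs listsProg σ (2 + (C₁ * (n + 1) + (12 + (C₃ * (n + 1) ^ 2 + (C₄ * (n + 1) +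
      (C₂ * (n + 1) + (14 + (C₃ * (n + 1) ^ 2 + (C₅ * (n + 1) + (10 + (C₃ * (n + 1) ^ 2 +
        3))))))))))) (Lists T.core) := by
    refine (Runs.of_loopFree (Q := fun _ => True) rfl trivial).seq fun σ₁ F₁ _ => ?_
    have I₁ := hI.frame F₁ rfl
    refine (hC₁ (n := n) (d := T.P.rev.len) (c := T.P.rev.cap) (w := T.P.revScenario T.w) I₁.n
      (fun t ht => I₁.len _ (by omega)) (fun t ht => I₁.cap _ (by omega))
      (fun t ht => I₁.w _ (by omega))).seq fun σ₂ F₂ L₂ => ?_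
    have I₂ := I₁.frame F₂ rfl
    set par₁ := paramProg (.sub (.reg 0) (.reg 34)) (.const 0) (.reg 0) (.reg 30) (.reg 11)
      with hpar₁
    refine (Runs.of_loopFree (p := par₁) (Q := BuildInput T.right T.B) rfl ?_).seq
      fun σ₃ F₃ B₃ => ?_
    · have F := par₁.frame_run rfl σ₂
      refine ⟨(F.nreg 0 rfl).trans I₂.n, ?_, ?_, ?_, ?_, ?_, fun t ht => ?_, fun t ht => ?_,
        fun e he => ?_⟩
      · simp [hpar₁, paramProg, Prog.run, I₂.n, I₂.i', EvacTask.right]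
      · simp [hpar₁, paramProg, Prog.run, EvacTask.right]
      · simp [hpar₁, paramProg, Prog.run, I₂.n, EvacTask.right]
      · simp [hpar₁, paramProg, Prog.run, I₂.fR, EvacTask.right]
      · simp [hpar₁, paramProg, Prog.run, I₂.B]
      · rw [F.rarr 5 rfl, L₂.x t ht]; rfl
      · rw [F.rarr 6 rfl, L₂.W t ht]; exact (weight_zero _ _).symm
      · rw [F.rarr 7 rfl, L₂.c e he]; rfl
    have I₃ := I₂.frame F₃ rfl
    refine (hC₃ hT.B_nonneg B₃).seq fun σ₄ F₄ B₄ => ?_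
    have I₄ := I₃.frame F₄ rfl
    refine (hC₄ I₄.n).seq fun σ₅ F₅ Q₅ => ?_
    have I₅ := I₄.frame F₅ rfl
    refine (hC₂ (n := n) (d := T.P.len) (c := T.P.cap) (w := T.w) I₅.n I₅.len I₅.cap I₅.w).seq
      fun σ₆ F₆ L₆ => ?_
    have I₆ := I₅.frame F₆ rfl
    set par₂ := paramProg (.reg 33) (.reg 27) (.reg 28) (.add (.reg 29) (.reg 30))
      (.add (.reg 10) (.reg 11)) with hpar₂
    refine (Runs.of_loopFree (p := par₂) (Q := BuildInput T.obj (T.A + T.B)) rfl ?_).seq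
      fun σ₇ F₇ B₇ => ?_
    · have F := par₂.frame_run rfl σ₆
      refine ⟨(F.nreg 0 rfl).trans I₆.n, ?_, ?_, ?_, ?_, ?_, fun t ht => ?_, fun t ht => ?_,
        fun e he => ?_⟩
      · simp [hpar₂, paramProg, Prog.run, I₆.i, EvacTask.obj]
      · simp [hpar₂, paramProg, Prog.run, I₆.lo, EvacTask.obj]
      · simp [hpar₂, paramProg, Prog.run, I₆.hi, EvacTask.obj]
      · simp [hpar₂, paramProg, Prog.run, I₆.fR, I₆.fL, EvacTask.obj]
      · simp [hpar₂, paramProg, Prog.run, I₆.A, I₆.B]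
      · rw [F.rarr 5 rfl, L₆.x t ht]; rfl
      · rw [F.rarr 6 rfl, L₆.W t ht]; exact (weight_zero _ _).symm
      · rw [F.rarr 7 rfl, L₆.c e he]; rfl
    have I₇ := I₆.frame F₇ rfl
    refine (hC₃ (add_nonneg hT.A_nonneg hT.B_nonneg) B₇).seq fun σ₈ F₈ B₈ => ?_
    have I₈ := I₇.frame F₈ rfl
    refine (hC₅ (n := n) (E := T.edges) I₈.n T.edges_le
      (fun e he => by
        have := T.edges_le
        rw [B₈.input.x e (by change e ≤ T.P.n; omega), I₈.x]; exact T.pos_lt_of_lt he)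
      (fun h => by
        rw [B₈.input.x _ T.edges_le, I₈.x]; exact T.le_pos_edges h)).seq
      fun σ₉ F₉ Q₉ => ?_
    have I₉ := I₈.frame F₉ rfl
    set par₃ := paramProg (.reg 33) (.const 0) (.reg 0) (.reg 29) (.reg 10) with hpar₃
    refine (Runs.of_loopFree (p := par₃) (Q := BuildInput T.left T.A) rfl ?_).seq
      fun σ₁₀ F₁₀ B₁₀ => ?_
    · have F := par₃.frame_run rfl σ₉
      refine ⟨(F.nreg 0 rfl).trans I₉.n, ?_, ?_, ?_, ?_, ?_, fun t ht => ?_, fun t ht => ?_,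
        fun e he => ?_⟩
      · simp [hpar₃, paramProg, Prog.run, I₉.i, EvacTask.left]
      · simp [hpar₃, paramProg, Prog.run, EvacTask.left]
      · simp [hpar₃, paramProg, Prog.run, I₉.n, EvacTask.left]
      · simp [hpar₃, paramProg, Prog.run, I₉.fL, EvacTask.left]
      · simp [hpar₃, paramProg, Prog.run, I₉.A]
      · rw [F.rarr 5 rfl, F₉.rarr 5 rfl]; exact B₈.input.x t ht
      · rw [F.rarr 6 rfl, F₉.rarr 6 rfl]; exact B₈.input.W t ht
      · rw [F.rarr 7 rfl, F₉.rarr 7 rfl]; exact B₈.input.c e he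
    have I₁₀ := I₉.frame F₁₀ rfl
    refine (hC₃ hT.A_nonneg B₁₀).seq fun σ₁₁ F₁₁ B₁₁ => ?_
    have I₁₁ := I₁₀.frame F₁₁ rfl
    have F := (Prog.setR 16 (.read 5 (.reg 0))).frame_run rfl σ₁₁
    have I₁₂ := I₁₁.frame F rfl
    -- the memory of the lists
    have n7 : σ₇.nreg 7 = σ₄.nreg 7 := by rw [F₇.nreg 7 rfl, F₆.nreg 7 rfl, F₅.nreg 7 rfl]
    have n7' : σ₁₀.nreg 7 = σ₈.nreg 7 := by rw [F₁₀.nreg 7 rfl, F₉.nreg 7 rfl]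
    have fp : σ₄.nreg 7 ≤ σ₈.nreg 7 := n7 ▸ B₈.built.fp_le
    have XM : ∀ k < σ₈.nreg 7, σ₁₁.rarr 8 k = σ₈.rarr 8 k := fun k hk => by
      rw [B₁₁.memX k (by omega), F₁₀.rarr 8 rfl, F₉.rarr 8 rfl]
    have YM : ∀ k < σ₈.nreg 7, σ₁₁.rarr 9 k = σ₈.rarr 9 k := fun k hk => by
      rw [B₁₁.memY k (by omega), F₁₀.rarr 9 rfl, F₉.rarr 9 rfl]
    have XR : ∀ k < σ₄.nreg 7, σ₁₁.rarr 8 k = σ₄.rarr 8 k := fun k hk => by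
      rw [XM k (by omega), B₈.memX k (by omega), F₇.rarr 8 rfl, F₆.rarr 8 rfl, F₅.rarr 8 rfl]
    have YR : ∀ k < σ₄.nreg 7, σ₁₁.rarr 9 k = σ₄.rarr 9 k := fun k hk => by
      rw [YM k (by omega), B₈.memY k (by omega), F₇.rarr 9 rfl, F₆.rarr 9 rfl, F₅.rarr 9 rfl]
    have a2 : σ₁₁.narr 2 = σ₅.narr 2 := by
      rw [F₁₁.narr 2 rfl, F₁₀.narr 2 rfl, F₉.narr 2 rfl, F₈.narr 2 rfl, F₇.narr 2 rfl,
        F₆.narr 2 rfl]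
    have a3 : σ₁₁.narr 3 = σ₅.narr 3 := by
      rw [F₁₁.narr 3 rfl, F₁₀.narr 3 rfl, F₉.narr 3 rfl, F₈.narr 3 rfl, F₇.narr 3 rfl,
        F₆.narr 3 rfl]
    have n18 : σ₁₁.nreg 18 = σ₈.narr 0 T.edges := by
      rw [F₁₁.nreg 18 rfl, F₁₀.nreg 18 rfl, Q₉.1]
    have n19 : σ₁₁.nreg 19 = σ₈.narr 1 T.edges := by
      rw [F₁₁.nreg 19 rfl, F₁₀.nreg 19 rfl, Q₉.2]
    refine Runs.of_loopFree rfl ⟨I₁₂.n, I₁₂.p, I₁₂.q, I₁₂.x, ?_, ?_, ?_, ?_, ?_, ?_, ?_, ?_⟩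
    · have := B₁₁.input.x n le_rfl
      simp only [Prog.run, RExpr.eval, NExpr.eval, I₁₁.n, State.setR_rreg, if_true]
      exact this
    · rw [F.rarr 5 rfl]; exact B₁₁.input.x
    · rw [F.rarr 8 rfl, F.rarr 9 rfl, F.narr 0 rfl, F.narr 1 rfl]; exact B₁₁.built.list
    · rw [F.rarr 8 rfl, F.rarr 9 rfl, F.narr 2 rfl, F.narr 3 rfl, a2, a3]
      intro m hm
      rw [(Q₅ m hm).1, (Q₅ m hm).2]
      have := B₄.built.bound m hm
      exact (B₄.built.list m hm).congr (fun k hk => XR k (by omega)) fun k hk => YR k (by omega)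
    · rw [F.rarr 8 rfl, F.rarr 9 rfl, F.nreg 18 rfl, F.nreg 19 rfl, n18, n19]
      have := B₈.built.bound _ T.edges_le
      exact (B₈.built.list _ T.edges_le).congr (fun k hk => XM k (by omega))
        fun k hk => YM k (by omega)
    · rw [F.narr 1 rfl]; exact B₁₁.built.size
    · rw [F.narr 3 rfl, a3]
      intro m hm
      rw [(Q₅ m hm).2]; exact B₄.built.size m hm
    · rw [F.nreg 19 rfl, n19]
      have h1 := B₈.built.size _ T.edges_le
      have h2 := T.edges_le
      change _ ≤ 2 + 4 * T.P.n
      omega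
  refine key.mono ?_ fun _ _ h => h
  have h1 : n + 1 ≤ (n + 1) ^ 2 := Nat.le_self_pow two_ne_zero _
  have hC : ∀ C, C * (n + 1) ≤ C * (n + 1) ^ 2 := fun C => Nat.mul_le_mul_left C h1
  have g1 := hC C₁
  have g2 := hC C₂
  have g4 := hC C₄
  have g5 := hC C₅
  generalize (n + 1) ^ 2 = S at *
  linarith

/-- Solve the task in memory. -/
def solveProg : Prog := .seq listsProg scanAll

theorem solveProg_runs : ∃ C, ∀ {T : EvacTask} {σ : State}, T.Good → TaskInput T σ →
    Runs solveProg σ (C * (T.P.n + 1) ^ 2) (fun σ' => TaskInput T σ' ∧ Solved T.core σ σ') := by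
  obtain ⟨C₁, hC₁⟩ := listsProg_runs
  obtain ⟨C₂, hC₂⟩ := scanAll_runs
  refine ⟨C₁ + C₂, ?_⟩
  intro T σ hT hI
  refine ((hC₁ hT hI).seq fun σ₁ F₁ L₁ => (hC₂ hT.core L₁).mono le_rfl
    fun σ' F S => (⟨(hI.frame F₁ rfl).frame F rfl, fun V hV =>
      S.below V (hV.congr (F₁.nreg _ rfl) (F₁.rreg _ rfl)), fun w hw =>
      S.above w (hw.congr (F₁.nreg _ rfl) (F₁.rreg _ rfl)), S.vertex, S.edge⟩ :
      TaskInput T σ' ∧ Solved T.core σ σ')).mono ?_ fun _ _ h => h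
  rw [add_mul]; exact le_rfl

end RealRAM

/-! ### Evacuation times and envelopes -/

namespace PathNetwork

/-- The value of an envelope. -/
theorem sSup_g_eq {P : PathNetwork} {s : ℕ → ℝ} {B : Envelope} (hB : B.Good) (hn : B.n = P.n)
    (hx : B.x = P.pos) (hc : B.c = P.cap) {S : Set ℕ} (hS : ∀ t ∈ S, t ≤ P.n) {y ω : ℝ} {m : ℕ}
    (hy : y ≤ P.pos P.n) (hm : m ≤ P.n) (hmy : ∀ e < P.n, e < m ↔ P.pos e < y)
    (hact : ∀ e < m, ∀ t ≤ e, (t ∈ S ∧ 0 < weight s 0 t) ↔ B.Act t)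
    (hw : ∀ e < m, ∀ t ≤ e, t ∈ S → weight s 0 t = B.W t + B.shift ω t) :
    sSup ((fun t => P.g s t y) '' S) = max 0 (y + B.env m ω) := by
  refine eq_of_forall_ge_iff fun z => ?_
  have h0 := sSup_g_nonneg (P := P) (s := s) hy hS
  have h1 : sSup ((fun t => P.g s t y) '' S) ≤ z ↔ sSup ((fun t => P.g s t y) '' S) ≤ z ∧ 0 ≤ z :=
    ⟨fun h => ⟨h, h0.trans h⟩, fun h => h.1⟩
  have h2 : y + B.env m ω ≤ z ↔ B.env m ω ≤ z - y := by
    constructor <;> intro h <;> linarith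
  rw [h1, sSup_g_le_iff hy hS, max_le_iff, h2, Envelope.env_le_iff hB (hn ▸ hm), hn, hx, hc]
  refine and_congr_right fun hz => ⟨fun h => ⟨by linarith, fun e he t hte ha => ?_⟩, fun h => ?_⟩
  · obtain ⟨htS, hW⟩ := (hact e he t hte).2 ha
    have := h e (by omega) ((hmy e (by omega)).1 he) t hte htS hW
    rw [hw e he t hte htS] at this
    linarith
  · intro e he hey t hte htS hW
    have hem := (hmy e he).2 hey
    have := h.2 e hem t hte ((hact e hem t hte).1 ⟨htS, hW⟩)
    rw [hw e hem t hte htS]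
    linarith

theorem evac_nonneg {P : PathNetwork} {s : ℕ → ℝ} {y : ℝ} (hy : y ≤ P.pos P.n) :
    0 ≤ P.evac s y :=
  le_max_of_le_left (sSup_g_nonneg hy fun _ ht => ht.1)

theorem minEvac_le {P : PathNetwork} {s : ℕ → ℝ} {a b y : ℝ} (hb : b ≤ P.pos P.n)
    (hy : y ∈ Set.Icc a b) : P.minEvac s a b ≤ P.evac s y :=
  csInf_le ⟨0, by rintro _ ⟨y, hy, rfl⟩; exact evac_nonneg (hy.2.trans hb)⟩ ⟨y, hy, rfl⟩

theorem le_minEvac {P : PathNetwork} {s : ℕ → ℝ} {a b z : ℝ} (hab : a ≤ b)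
    (h : ∀ y ∈ Set.Icc a b, z ≤ P.evac s y) : z ≤ P.minEvac s a b :=
  le_csInf ((Set.nonempty_Icc.2 hab).image _) (by rintro _ ⟨y, hy, rfl⟩; exact h y hy)

end PathNetwork

namespace EvacTask

open PathNetwork

variable (T : EvacTask)

/-- The scenario with the additional weights `α` and `β`. -/
noncomputable def scen (α β : ℝ) : ℕ → ℝ := fun t =>
  T.w t + (if t = T.i then α else 0) + (if t = T.i' then β else 0)

/-- The vertices that count for the objective. -/
def targets : Set ℕ := {t | t ≤ T.P.n ∧ T.lo ≤ t ∧ t ≤ T.hi ∧ T.P.pos t ≤ T.x}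

/-- The value of a scenario. -/
noncomputable def value (s : ℕ → ℝ) : ℝ :=
  sSup ((fun t => T.P.g s t T.x) '' T.targets) - T.P.minEvac s (T.P.pos T.p) (T.P.pos T.q)

/-- Conditions that relate the indices. -/
structure Valid : Prop extends T.Good where
  i_le : T.i ≤ T.p
  le_i' : T.q ≤ T.i'
  i'_le : T.i' ≤ T.P.n
  lo_le : T.i ≤ T.lo
  B_zero : T.B = 0 ∨ T.i' ≤ T.lo
  x_le : T.x ≤ T.P.pos T.P.n

variable {T}

theorem weight_scen {α β : ℝ} (t : ℕ) : weight (T.scen α β) 0 t =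
    weight T.w 0 t + (if T.i ≤ t then α else 0) + (if T.i' ≤ t then β else 0) := by
  simp [weight, scen, Finset.sum_add_distrib]

/-- The hypothesis t + i < n keeps these vertices of the reversed path clear of `i`, so only β
enters. -/
theorem revScenario_scen {α β : ℝ} {t : ℕ} (hi' : T.i' ≤ T.P.n) (ht : t + T.i < T.P.n) :
    weight (T.P.revScenario (T.scen α β)) 0 t =
      weight (T.P.revScenario T.w) 0 t + (if T.P.n - T.i' ≤ t then β else 0) := by
  have h : ∀ k ∈ Finset.Icc 0 t, T.P.revScenario (T.scen α β) k =
      T.P.revScenario T.w k + (if k = T.P.n - T.i' then β else 0) := by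
    intro k hk
    have hk' := (Finset.mem_Icc.1 hk).2
    have h1 : T.P.n - k ≠ T.i := by omega
    have h2 : T.P.n - k = T.i' ↔ k = T.P.n - T.i' := by omega
    simp only [revScenario, scen, if_neg h1, h2, add_zero]
  rw [weight, Finset.sum_congr rfl h]
  simp [weight, Finset.sum_add_distrib]

/-- The weights `α`, `β` are positive exactly if the task says so. -/
structure Inner (T : EvacTask) (α β : ℝ) : Prop where
  α_nonneg : 0 ≤ α
  β_nonneg : 0 ≤ β
  α_pos : 0 < α ↔ 1 ≤ T.fL
  β_pos : 0 < β ↔ 1 ≤ T.fR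
  β_zero : β = 0 ∨ T.i' ≤ T.lo

theorem pos_add_iff {W α : ℝ} {f : Prop} (hW : 0 ≤ W) (hα : 0 ≤ α) (h : 0 < α ↔ f) :
    0 < W + α ↔ 0 < W ∨ f := by
  rw [← h]
  constructor
  · intro h'
    rcases hW.eq_or_lt with e | e
    · right; linarith
    · exact Or.inl e
  · rintro (h' | h') <;> linarith

/-- All vertices that count lie at or behind `i`, and at or behind `i'` unless β = 0. So the weights
enter only through their sum, and a function of one variable describes the objective. -/
theorem objective_eq (hT : T.Valid) {α β : ℝ} (h : T.Inner α β) :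
    sSup ((fun t => T.P.g (T.scen α β) t T.x) '' T.targets) =
      max 0 (T.x + T.core.M (α + β)) := by
  have hw : ∀ t, T.lo ≤ t → weight (T.scen α β) 0 t = weight T.w 0 t + (α + β) := by
    intro t ht
    rw [weight_scen, if_pos (hT.lo_le.trans ht)]
    rcases h.β_zero with e | e
    · simp [e]
    · rw [if_pos (e.trans ht)]; ring
  have hE := T.edges_le
  refine sSup_g_eq hT.obj rfl rfl rfl (fun t ht => ht.1) hT.x_le hE
    (fun e he => T.lt_edges_iff he) (fun e he t hte => ?_) fun e he t hte ht => ?_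
  · have hpos : T.P.pos t ≤ T.x := (T.P.pos_le hte (by omega)).trans (T.pos_lt_of_lt he).le
    have key : T.lo ≤ t → (0 < weight (T.scen α β) 0 t ↔
        (0 < weight T.w 0 t ∨ 1 ≤ T.fL + T.fR ∧ T.i ≤ t)) := by
      intro hlo
      rw [hw t hlo, pos_add_iff (weight_nonneg hT.w_nonneg (by omega))
        (add_nonneg h.α_nonneg h.β_nonneg) (f := 1 ≤ T.fL + T.fR)]
      · simp only [hT.lo_le.trans hlo, and_true]
      · rw [pos_add_iff h.α_nonneg h.β_nonneg h.β_pos, h.α_pos]; omega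
    constructor
    · rintro ⟨⟨h1, h2, h3, h4⟩, h5⟩
      exact ⟨h2, h3, (key h2).1 h5⟩
    · rintro ⟨h2, h3, h5⟩
      exact ⟨⟨by omega, h2, h3, hpos⟩, (key h2).2 h5⟩
  · rw [hw t ht.2.1]
    simp [Envelope.shift, EvacTask.obj, hT.lo_le.trans ht.2.1]

/-- The vertices before m ≤ q ≤ i' precede `i'`, so the left side never sees β. -/
theorem evacLeft_eq (hT : T.Valid) {α β : ℝ} (h : T.Inner α β) {y : ℝ} {m : ℕ} (hm : m ≤ T.q)
    (hy : y ≤ T.P.pos T.P.n) (hmy : ∀ e < T.P.n, e < m ↔ T.P.pos e < y) :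
    T.P.evacLeft (T.scen α β) y = max 0 (y + T.core.L m α) := by
  have hq := hT.q_le
  have hi' := hT.le_i'
  have hw : ∀ t < m, weight (T.scen α β) 0 t =
      weight T.w 0 t + (if T.i ≤ t then α else 0) := by
    intro t ht
    rw [weight_scen, if_neg (show ¬ T.i' ≤ t by omega), add_zero]
  refine sSup_g_eq hT.left rfl rfl rfl (fun t ht => ht.1) hy (by omega) hmy
    (fun e he t hte => ?_) fun e he t hte ht => ?_
  · have hlt : T.P.pos t < y :=
      (T.P.pos_le hte (by omega)).trans_lt ((hmy e (by omega)).1 he)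
    have key : 0 < weight (T.scen α β) 0 t ↔ (0 < weight T.w 0 t ∨ 1 ≤ T.fL ∧ T.i ≤ t) := by
      rw [hw t (by omega)]
      apply pos_add_iff (weight_nonneg hT.w_nonneg (by omega))
      · split_ifs
        exacts [h.α_nonneg, le_rfl]
      · split_ifs with hc
        · simp only [hc, and_true, h.α_pos]
        · simp [hc]
    constructor
    · rintro ⟨-, h5⟩
      exact ⟨Nat.zero_le _, show t ≤ T.P.n by omega, key.1 h5⟩
    · rintro ⟨-, -, h5⟩
      exact ⟨⟨by omega, hlt⟩, key.2 h5⟩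
  · exact hw t (by omega)

/-- This is the left side of the reversed path. The vertices involved lie behind k ≥ p ≥ i, so α
does not enter. -/
theorem evacRight_eq (hT : T.Valid) {α β : ℝ} (h : T.Inner α β) {y : ℝ} {k : ℕ} (hk : T.p ≤ k)
    (hkn : k ≤ T.P.n) (hy : 0 ≤ y) (hky : ∀ e ≤ T.P.n, k < e ↔ y < T.P.pos e) :
    T.P.evacRight (T.scen α β) y = max 0 (T.P.pos T.P.n - y + T.core.R (T.P.n - k) β) := by
  have hi := hT.i_le
  have hi' := hT.i'_le
  rw [← evacLeft_rev]
  have hw : ∀ t < T.P.n - k, weight (T.P.revScenario (T.scen α β)) 0 t =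
      weight (T.P.revScenario T.w) 0 t + (if T.P.n - T.i' ≤ t then β else 0) := by
    intro t ht
    exact revScenario_scen hi' (by omega)
  have hmy : ∀ e < T.P.n, e < T.P.n - k ↔ T.P.rev.pos e < T.P.pos T.P.n - y := by
    intro e he
    rw [pos_rev he.le]
    have h1 := hky (T.P.n - e) (by omega)
    have h2 : e < T.P.n - k ↔ k < T.P.n - e := by omega
    rw [h2, h1]
    constructor <;> intro h <;> linarith
  refine sSup_g_eq (P := T.P.rev) hT.right rfl rfl rfl (fun t ht => ht.1) ?_
    (show T.P.n - k ≤ T.P.n by omega) hmy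
    (fun e he t hte => ?_) fun e he t hte ht => ?_
  · rw [rev_n, pos_rev_n]; linarith
  · have hen : e < T.P.n := by omega
    have hlt : T.P.rev.pos t < T.P.pos T.P.n - y :=
      (T.P.rev.pos_le hte hen.le).trans_lt ((hmy e hen).1 he)
    have hW : 0 ≤ weight (T.P.revScenario T.w) 0 t :=
      hT.right.W_nonneg t (show t ≤ T.P.n by omega)
    have key : 0 < weight (T.P.revScenario (T.scen α β)) 0 t ↔
        (0 < weight (T.P.revScenario T.w) 0 t ∨ 1 ≤ T.fR ∧ T.P.n - T.i' ≤ t) := by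
      rw [hw t (by omega)]
      apply pos_add_iff hW
      · split_ifs
        exacts [h.β_nonneg, le_rfl]
      · split_ifs with hc
        · simp only [hc, and_true, h.β_pos]
        · simp [hc]
    constructor
    · rintro ⟨-, h5⟩
      exact ⟨Nat.zero_le _, show t ≤ T.P.n by omega, key.1 h5⟩
    · rintro ⟨-, -, h5⟩
      exact ⟨⟨show t ≤ T.P.n by omega, hlt⟩, key.2 h5⟩
  · exact hw t (by omega)

theorem evac_vertex (hT : T.Valid) {α β : ℝ} (h : T.Inner α β) {k : ℕ} (hp : T.p ≤ k)
    (hq : k ≤ T.q) : T.P.evac (T.scen α β) (T.P.pos k) =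
      max 0 (max (T.P.pos k + T.core.L k α)
        (T.P.pos T.P.n - T.P.pos k + T.core.R (T.P.n - k) β)) := by
  have hqn := hT.q_le
  have h0 := T.P.pos_le (Nat.zero_le k) (by omega)
  rw [pos_zero] at h0
  rw [evac, evacLeft_eq hT h hq (T.P.pos_le (by omega) le_rfl)
    (fun e he => (T.P.pos_lt_iff he.le (by omega)).symm),
    evacRight_eq hT h hp (by omega) h0 (fun e he => (T.P.pos_lt_iff (by omega) he).symm),
    max_max_max_comm, max_self]

/-- From inside edge k, this edge is used from both sides; hence the indices k + 1 and n - k, which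
add up to n + 1 instead of n. -/
theorem evac_edge (hT : T.Valid) {α β : ℝ} (h : T.Inner α β) {k : ℕ} (hp : T.p ≤ k)
    (hq : k < T.q) {y : ℝ} (h1 : T.P.pos k < y) (h2 : y < T.P.pos (k + 1)) :
    T.P.evac (T.scen α β) y = max 0 (max (y + T.core.L (k + 1) α)
        (T.P.pos T.P.n - y + T.core.R (T.P.n - k) β)) := by
  have hqn := hT.q_le
  have h0 := T.P.pos_le (Nat.zero_le k) (by omega)
  have h3 := T.P.pos_le (show k + 1 ≤ T.P.n by omega) le_rfl
  rw [pos_zero] at h0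
  rw [evac, evacLeft_eq hT h hq (h2.le.trans h3) (fun e he => ?_),
    evacRight_eq hT h hp (by omega) (h0.trans h1.le) (fun e he => ?_), max_max_max_comm, max_self]
  · constructor
    · exact fun h => h2.trans_le (T.P.pos_le h he)
    · intro h
      by_contra hlt
      have := T.P.pos_le (show e ≤ k by omega) (by omega)
      linarith
  · constructor
    · exact fun h => (T.P.pos_le (show e ≤ k by omega) (by omega)).trans_lt h1
    · intro h
      by_contra hlt
      have := T.P.pos_le (show k + 1 ≤ e by omega) he.le
      linarith

/-- At the ends fewer edges are crossed, so the formula for the open edge is still an upper bound.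
It is needed there because the best location of the closed edge may be an end. -/
theorem evac_le (hT : T.Valid) {α β : ℝ} (h : T.Inner α β) {k : ℕ} (hp : T.p ≤ k)
    (hq : k < T.q) {y : ℝ} (h1 : T.P.pos k ≤ y) (h2 : y ≤ T.P.pos (k + 1)) :
    T.P.evac (T.scen α β) y ≤ max 0 (max (y + T.core.L (k + 1) α)
        (T.P.pos T.P.n - y + T.core.R (T.P.n - k) β)) := by
  rcases h1.eq_or_lt with rfl | h1
  · rw [evac_vertex hT h hp hq.le]
    have := hT.toGood.core.L_le k (k + 1) (by omega) α
    gcongr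
  rcases h2.eq_or_lt with rfl | h2
  · rw [evac_vertex hT h (by omega) hq]
    have := hT.toGood.core.R_le (T.P.n - (k + 1)) (T.P.n - k) (by omega) β
    gcongr
  · exact (evac_edge hT h hp hq h1 h2).le

theorem exists_vertex_or_edge (T : EvacTask) {y : ℝ}
    (hy : y ∈ Set.Icc (T.P.pos T.p) (T.P.pos T.q)) (hpq : T.p ≤ T.q) :
    (∃ k, T.p ≤ k ∧ k ≤ T.q ∧ y = T.P.pos k) ∨
      ∃ k, T.p ≤ k ∧ k < T.q ∧ T.P.pos k < y ∧ y < T.P.pos (k + 1) := by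
  by_contra hcon
  push Not at hcon
  have key : ∀ k, T.p ≤ k → k ≤ T.q → T.P.pos k < y := by
    intro k hk
    induction k, hk using Nat.le_induction with
    | base => exact fun h => lt_of_le_of_ne hy.1 (Ne.symm (hcon.1 _ le_rfl h))
    | succ k hk ih =>
      intro h
      exact lt_of_le_of_ne (hcon.2 k hk (by omega) (ih (by omega)))
        (Ne.symm (hcon.1 _ (by omega) h))
  exact absurd (key T.q hpq le_rfl) (not_lt.2 hy.2)

/-- A bound for the values of all vertices and edges is a bound for the value of the scenario. -/
theorem value_le (hT : T.Valid) {α β V : ℝ} (h : T.Inner α β)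
    (hv : ∀ k, T.p ≤ k → k ≤ T.q → T.core.valV k α β ≤ V)
    (he : ∀ k, T.p ≤ k → k < T.q → ∀ y ∈ Set.Icc (T.P.pos k) (T.P.pos (k + 1)),
      T.core.val (T.core.L (k + 1)) (T.core.R (T.P.n - k)) y α β ≤ V) :
    T.value (T.scen α β) ≤ V := by
  rw [value, objective_eq hT h]
  have : max 0 (T.x + T.core.M (α + β)) - V ≤
      T.P.minEvac (T.scen α β) (T.P.pos T.p) (T.P.pos T.q) := by
    refine le_minEvac (T.P.pos_le hT.p_le hT.q_le) fun y hy => ?_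
    rcases T.exists_vertex_or_edge hy hT.p_le with ⟨k, h1, h2, rfl⟩ | ⟨k, h1, h2, h3, h4⟩
    · rw [evac_vertex hT h h1 h2]
      have : _ - _ ≤ V := hv k h1 h2
      simp only [core] at this ⊢
      linarith
    · rw [evac_edge hT h h1 h2 h3 h4]
      have : _ - _ ≤ V := he k h1 h2 y ⟨h3.le, h4.le⟩
      simp only [core] at this ⊢
      linarith
  linarith

theorem valV_le_value (hT : T.Valid) {α β : ℝ} (h : T.Inner α β) {k : ℕ} (hp : T.p ≤ k)
    (hq : k ≤ T.q) : T.core.valV k α β ≤ T.value (T.scen α β) := by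
  rw [value, objective_eq hT h]
  have h1 := minEvac_le (s := T.scen α β) (T.P.pos_le hT.q_le le_rfl)
    ⟨T.P.pos_le hp (hq.trans hT.q_le), T.P.pos_le hq hT.q_le⟩
  rw [evac_vertex hT h hp hq] at h1
  change max 0 (T.x + T.core.M (α + β)) - _ ≤ _
  exact sub_le_sub_left h1 _

/-- The height at the best location in `[u, v]`. -/
theorem exists_location {u v s l r : ℝ} (huv : u ≤ v) : ∃ y ∈ Set.Icc u v,
    max 0 (max (y + l) (s - y + r)) ≤
      max (max 0 (max (u + l) (s - v + r))) ((l + r + s) / 2) := by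
  -- The location (s + r - l)/2 makes both sides equal; outside [u, v] the nearer end is taken.
  rcases le_total ((s + r - l) / 2) u with h | h
  · refine ⟨u, ⟨le_rfl, huv⟩, le_max_of_le_left ?_⟩
    exact max_le_max le_rfl (max_le (le_max_left _ _) (le_max_of_le_left (by linarith)))
  rcases le_total v ((s + r - l) / 2) with h' | h'
  · refine ⟨v, ⟨huv, le_rfl⟩, le_max_of_le_left ?_⟩
    exact max_le_max le_rfl (max_le (le_max_of_le_right (by linarith)) (le_max_right _ _))
  · refine ⟨_, ⟨h, h'⟩, max_le (le_max_of_le_left (le_max_left _ _)) (le_max_of_le_right ?_)⟩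
    exact max_le (by linarith) (by linarith)

/-- The lower bound in `valE` is attained by the edge formula at some location of the closed edge,
where the true evacuation time is no larger. So the scenario is worth at least as much. -/
theorem valE_le_value (hT : T.Valid) {α β : ℝ} (h : T.Inner α β) {k : ℕ} (hp : T.p ≤ k)
    (hq : k < T.q) : T.core.valE k α β ≤ T.value (T.scen α β) := by
  have hqn := hT.q_le
  rw [value, objective_eq hT h]
  obtain ⟨y, hy, hle⟩ := exists_location (s := T.P.pos T.P.n) (l := T.core.L (k + 1) α)
    (r := T.core.R (T.P.n - k) β) (T.P.pos_le (Nat.le_succ k) (by omega))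
  have h1 := minEvac_le (s := T.scen α β) (T.P.pos_le hT.q_le le_rfl)
    ⟨(T.P.pos_le hp (by omega)).trans hy.1, hy.2.trans (T.P.pos_le hq hT.q_le)⟩
  have h2 := h1.trans ((evac_le hT h hp hq hy.1 hy.2).trans hle)
  change max 0 (T.x + T.core.M (α + β)) - _ ≤ _
  exact sub_le_sub_left h2 _

/-- A continuous function that is bounded at the inner points of a box is bounded on it. -/
theorem le_of_inner {A B V : ℝ} {f : ℝ → ℝ → ℝ} (hf : Continuous fun z : ℝ × ℝ => f z.1 z.2)
    (h : ∀ α ∈ Set.Icc 0 A, ∀ β ∈ Set.Icc 0 B, (0 < A → 0 < α) → (0 < B → 0 < β) → f α β ≤ V)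
    {α β : ℝ} (hα : α ∈ Set.Icc 0 A) (hβ : β ∈ Set.Icc 0 B) : f α β ≤ V := by
  -- The point is approached from the direction of the corner (A, B), along which a weight becomes
  -- positive at once if its range allows it.
  have hlim : Filter.Tendsto (fun τ : ℝ => f (α + τ * (A - α)) (β + τ * (B - β)))
      (nhdsWithin 0 (Set.Ioi 0)) (nhds (f α β)) := by
    have hc : Continuous fun τ : ℝ => f (α + τ * (A - α)) (β + τ * (B - β)) :=
      hf.comp (g := fun z : ℝ × ℝ => f z.1 z.2)
        (f := fun τ : ℝ => (α + τ * (A - α), β + τ * (B - β))) (by fun_prop)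
    have := hc.tendsto 0
    simp only [zero_mul, add_zero] at this
    exact this.mono_left nhdsWithin_le_nhds
  refine le_of_tendsto hlim ?_
  have hmem : ∀ {A α τ : ℝ}, α ∈ Set.Icc 0 A → 0 < τ → τ < 1 →
      α + τ * (A - α) ∈ Set.Icc 0 A ∧ (0 < A → 0 < α + τ * (A - α)) := by
    intro A α τ hα h0 h1
    have q1 := mul_nonneg h0.le (sub_nonneg.2 hα.2)
    have q2 := mul_nonneg (sub_nonneg.2 h1.le) (sub_nonneg.2 hα.2)
    refine ⟨⟨by linarith [hα.1], by linarith⟩, fun hA => ?_⟩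
    have q3 := mul_pos h0 hA
    have q4 := mul_nonneg (sub_nonneg.2 h1.le) hα.1
    linarith
  filter_upwards [Ioo_mem_nhdsGT (zero_lt_one : (0 : ℝ) < 1)] with τ hτ
  obtain ⟨m1, m2⟩ := hmem hα hτ.1 hτ.2
  obtain ⟨m3, m4⟩ := hmem hβ hτ.1 hτ.2
  exact h _ m1 _ m3 m2 m4

theorem core_continuous (hT : T.Good) :
    (∀ k, Continuous fun z : ℝ × ℝ => T.core.valV k z.1 z.2) ∧
      ∀ k, Continuous fun z : ℝ × ℝ => T.core.valE k z.1 z.2 := by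
  have hL := hT.core.L_cont
  have hR := hT.core.R_cont
  have hM : Continuous T.core.M := Envelope.env_continuous _
  refine ⟨fun k => ?_, fun k => ?_⟩
  · simp only [Core.valV, Core.val]
    have h1 := hL k
    have h2 := hR (T.core.n - k)
    fun_prop
  · simp only [Core.valE]
    have h1 := hL (k + 1)
    have h2 := hR (T.core.n - k)
    fun_prop

end EvacTask

/-! ### Evaluating a task -/

namespace EvacTask

/-- The part of a task in which `α` and `β` are zero or positive as prescribed by `u` and `v`. -/
noncomputable def piece (T : EvacTask) (u v : ℕ) : EvacTask :=
  { T with fL := u, fR := v, A := u * T.A, B := v * T.B }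

theorem Valid.piece {T : EvacTask} (hT : T.Valid) (u v : ℕ) : (T.piece u v).Valid where
  w_nonneg := hT.w_nonneg
  p_le := hT.p_le
  q_le := hT.q_le
  A_nonneg := mul_nonneg (Nat.cast_nonneg _) hT.A_nonneg
  B_nonneg := mul_nonneg (Nat.cast_nonneg _) hT.B_nonneg
  i_le := hT.i_le
  le_i' := hT.le_i'
  i'_le := hT.i'_le
  lo_le := hT.lo_le
  B_zero := hT.B_zero.imp_left fun h => by simp [EvacTask.piece, h]
  x_le := hT.x_le

end EvacTask

namespace RealRAM

/-- A task is in memory, with the ranges of the weights in the real registers `12` and `13`. -/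
structure FullInput (T : EvacTask) (σ : State) : Prop where
  n : σ.nreg 0 = T.P.n
  i : σ.nreg 33 = T.i
  i' : σ.nreg 34 = T.i'
  p : σ.nreg 25 = T.p
  q : σ.nreg 26 = T.q
  lo : σ.nreg 27 = T.lo
  hi : σ.nreg 28 = T.hi
  x : σ.rreg 22 = T.x
  A : σ.rreg 12 = T.A
  B : σ.rreg 13 = T.B
  len : ∀ k < T.P.n, σ.rarr 0 k = T.P.len k
  cap : ∀ k < T.P.n, σ.rarr 1 k = T.P.cap k
  w : ∀ k ≤ T.P.n, σ.rarr 4 k = T.w k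

/-- The task is left alone. -/
def Prog.keepsFull (p : Prog) : Bool :=
  !(p.writesN 0 || p.writesN 33 || p.writesN 34 || p.writesN 25 || p.writesN 26 || p.writesN 27 ||
    p.writesN 28 || p.writesR 22 || p.writesR 12 ||
    p.writesR 13 || p.storesR 0 || p.storesR 1 || p.storesR 4)

theorem FullInput.frame {T : EvacTask} {σ σ' : State} {p : Prog} (h : FullInput T σ)
    (F : Frame p σ σ') (hp : p.keepsFull = true) : FullInput T σ' := by
  simp only [Prog.keepsFull, Bool.not_eq_true', Bool.or_eq_false_iff] at hp
  obtain ⟨⟨⟨⟨⟨⟨⟨⟨⟨⟨⟨⟨h1, h2⟩, h3⟩, h4⟩, h5⟩, h6⟩, h7⟩, h10⟩, h11⟩, h12⟩, h13⟩, h14⟩, h15⟩ := hp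
  obtain ⟨e1, e2, e3, e4, e5, e6, e7, e10, e11, e12, e13, e14, e15⟩ := h
  exact ⟨by rw [F.nreg _ h1, e1], by rw [F.nreg _ h2, e2], by rw [F.nreg _ h3, e3],
    by rw [F.nreg _ h4, e4], by rw [F.nreg _ h5, e5], by rw [F.nreg _ h6, e6],
    by rw [F.nreg _ h7, e7],
    by rw [F.rreg _ h10, e10], by rw [F.rreg _ h11, e11], by rw [F.rreg _ h12, e12],
    by rwa [F.rarr _ h13], by rwa [F.rarr _ h14], by rwa [F.rarr _ h15]⟩

/-- Select a part of the task. -/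
def piecePre (u v : ℕ) : Prog :=
  .seq (.setN 29 (.const u)) <| .seq (.setN 30 (.const v)) <|
  .seq (.setR 10 (.mul (.const u) (.reg 12))) (.setR 11 (.mul (.const v) (.reg 13)))

/-- The part of the task is not void. -/
def pieceTest (u v : ℕ) : Test :=
  .and (.not (.and (.nle (.const 1) (.const u)) (.rle (.reg 12) (.const 0))))
    (.not (.and (.nle (.const 1) (.const v)) (.rle (.reg 13) (.const 0))))

/-- Solve a part of the task. -/
def pieceProg (u v : ℕ) : Prog :=
  .branch (pieceTest u v) (.seq (piecePre u v) solveProg) .nop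

/-- What is achieved for a part of the task. -/
structure PieceDone (T : EvacTask) (u v : ℕ) (σ σ' : State) : Prop where
  input : FullInput T σ'
  below : ∀ V, Below σ V → (∀ α ∈ Set.Icc 0 T.A, ∀ β ∈ Set.Icc 0 T.B,
    T.value (T.scen α β) ≤ V) → Below σ' V
  above : ∀ w, Above σ w → Above σ' w
  done : ∀ α ∈ Set.Icc 0 T.A, ∀ β ∈ Set.Icc 0 T.B, (0 < α ↔ 1 ≤ u) → (0 < β ↔ 1 ≤ v) →
    Above σ' (T.value (T.scen α β))

/-- With the signs of α and β prescribed, the set of counting vertices is fixed and the formulas are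
exact. On a piece with α > 0 the scans also use α = 0, with the vertices from `i` on still counting;
such a value need not belong to any scenario, but it is a limit of values that are bounded by those
of scenarios and does not exceed the supremum. The same applies to β. -/
theorem pieceProg_runs : ∃ C, ∀ {T : EvacTask} {u v : ℕ} {σ : State}, T.Valid → u ≤ 1 → v ≤ 1 →
    FullInput T σ → Runs (pieceProg u v) σ (C * (T.P.n + 1) ^ 2) (PieceDone T u v σ) := by
  obtain ⟨C, hC⟩ := solveProg_runs
  refine ⟨C + 40, ?_⟩
  intro T u v σ hT hu hv hI
  have key : Runs (pieceProg u v) σ (17 + (12 + C * (T.P.n + 1) ^ 2)) (PieceDone T u v σ) := by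
    refine Runs.branch (fun hb => ?_) (fun hb => ?_)
    · simp only [pieceTest, Test.holds, NExpr.eval, RExpr.eval, hI.A, hI.B, Rat.cast_zero,
        not_and, not_le] at hb
      obtain ⟨hA, hB⟩ := hb
      have hV := hT.piece u v
      refine (Runs.of_loopFree (p := piecePre u v) (Q := TaskInput (T.piece u v)) rfl ?_).seq
        fun σ₁ F₁ I₁ => ?_
      · have F := (piecePre u v).frame_run rfl σ
        have I := hI.frame F rfl
        refine ⟨I.n, I.i, I.i', I.p, I.q, I.lo, I.hi, ?_, ?_, I.x, ?_, ?_, I.len, I.cap, I.w⟩ <;>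
          simp [piecePre, Prog.run, EvacTask.piece, hI.A, hI.B]
      have inner : ∀ α ∈ Set.Icc 0 (T.piece u v).A, ∀ β ∈ Set.Icc 0 (T.piece u v).B,
          (0 < (T.piece u v).A → 0 < α) → (0 < (T.piece u v).B → 0 < β) →
          (T.piece u v).Inner α β ∧ α ∈ Set.Icc 0 T.A ∧ β ∈ Set.Icc 0 T.B := by
        have side : ∀ {A α : ℝ} {u : ℕ}, 0 ≤ A → u ≤ 1 → (1 ≤ u → 0 < A) → α ∈ Set.Icc 0 (u * A) →
            (0 < u * A → 0 < α) → (0 < α ↔ 1 ≤ u) ∧ α ∈ Set.Icc 0 A := by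
          intro A α u hA0 hu hA hα h
          rcases Nat.le_one_iff_eq_zero_or_eq_one.1 hu with rfl | rfl
          · simp only [Nat.cast_zero, zero_mul] at hα
            exact ⟨⟨fun h => absurd hα.2 (not_le.2 h), by omega⟩, hα.1, hα.2.trans hA0⟩
          · simp only [Nat.cast_one, one_mul] at hα h
            exact ⟨⟨fun _ => le_rfl, fun h' => h (hA h')⟩, hα⟩
        intro α hα β hβ h1 h2
        obtain ⟨p1, p2⟩ := side hT.A_nonneg hu hA hα h1
        obtain ⟨p3, p4⟩ := side hT.B_nonneg hv hB hβ h2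
        refine ⟨⟨hα.1, hβ.1, p1, p3, hT.B_zero.imp_left fun h => ?_⟩, p2, p4⟩
        rw [h] at p4
        exact le_antisymm p4.2 p4.1
      obtain ⟨c1, c2⟩ := EvacTask.core_continuous hV.toGood
      refine (hC hV.toGood I₁).mono le_rfl fun σ' F ⟨_, S⟩ => ⟨(hI.frame F₁ rfl).frame F rfl,
        fun V hV' hall => ?_, fun w hw => ?_, fun α hα β hβ h1 h2 => ?_⟩
      · refine S.below V (hV'.congr (F₁.nreg _ rfl) (F₁.rreg _ rfl)) (fun k h1 h2 α hα β hβ => ?_)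
          fun k h1 h2 α hα β hβ => ?_
        · refine EvacTask.le_of_inner (c1 k) (fun α hα β hβ hA hB => ?_) hα hβ
          obtain ⟨q1, q2, q3⟩ := inner α hα β hβ hA hB
          exact (EvacTask.valV_le_value hV q1 h1 h2).trans (hall α q2 β q3)
        · refine EvacTask.le_of_inner (c2 k) (fun α hα β hβ hA hB => ?_) hα hβ
          obtain ⟨q1, q2, q3⟩ := inner α hα β hβ hA hB
          exact (EvacTask.valE_le_value hV q1 h1 h2).trans (hall α q2 β q3)
      · exact S.above w (hw.congr (F₁.nreg _ rfl) (F₁.rreg _ rfl))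
      · have side : ∀ {A α : ℝ} {u : ℕ}, u ≤ 1 → α ∈ Set.Icc 0 A → (0 < α ↔ 1 ≤ u) →
            α ∈ Set.Icc 0 (u * A) := by
          intro A α u hu hα h
          rcases Nat.le_one_iff_eq_zero_or_eq_one.1 hu with rfl | rfl
          · refine ⟨hα.1, ?_⟩
            by_contra hlt
            simp only [Nat.cast_zero, zero_mul, not_le] at hlt
            exact absurd (h.1 hlt) (by omega)
          · simpa using hα
        have hα' : α ∈ Set.Icc 0 (T.piece u v).core.A := side hu hα h1
        have hβ' : β ∈ Set.Icc 0 (T.piece u v).core.B := side hv hβ h2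
        have hin : (T.piece u v).Inner α β := by
          refine ⟨hα.1, hβ.1, h1, h2, hT.B_zero.imp_left fun h => ?_⟩
          rw [h] at hβ
          exact le_antisymm hβ.2 hβ.1
        refine ⟨(S.vertex _ le_rfl hT.p_le α hα' β hβ').1, ?_⟩
        exact EvacTask.value_le hV hin (fun k g1 g2 => (S.vertex k g1 g2 α hα' β hβ').2)
          fun k g1 g2 y hy => (S.edge k g1 g2 α hα' β hβ' y hy).2
    · refine (Runs.of_loopFree (Q := fun τ => τ = σ) rfl rfl).mono (by simp only [Prog.size]; omega)
        ?_
      rintro _ - rfl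
      refine ⟨hI, fun V hV _ => hV, fun w hw => hw, fun α hα β hβ h1 h2 => ?_⟩
      refine absurd ?_ hb
      simp only [pieceTest, Test.holds, NExpr.eval, RExpr.eval, hI.A, hI.B, Rat.cast_zero,
        not_and, not_le]
      exact ⟨fun h => (h1.2 h).trans_le hα.2, fun h => (h2.2 h).trans_le hβ.2⟩
  refine key.mono ?_ fun _ _ h => h
  have : 1 ≤ (T.P.n + 1) ^ 2 := Nat.one_le_pow _ _ (by omega)
  generalize (T.P.n + 1) ^ 2 = S at *
  rw [add_mul]
  omega

/-- Evaluate a task. -/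
def evalProg : Prog :=
  .seq (.setN 24 (.const 0)) <| .seq (pieceProg 0 0) <| .seq (pieceProg 1 0) <|
  .seq (pieceProg 0 1) <| .seq (pieceProg 1 1) <| .setR 0 (.reg 17)

/-- Every pair of weights belongs to one of the four sign patterns. The values jump when a weight
vanishes, so the result is a least upper bound and not claimed to be a maximum. -/
theorem evalProg_runs : ∃ C, ∀ {T : EvacTask} {σ : State}, T.Valid → FullInput T σ →
    Runs evalProg σ (C * (T.P.n + 1) ^ 2) (fun σ' =>
      IsLUB {v | ∃ α ∈ Set.Icc 0 T.A, ∃ β ∈ Set.Icc 0 T.B, T.value (T.scen α β) = v}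
        (σ'.rreg 0)) := by
  obtain ⟨C, hC⟩ := pieceProg_runs
  refine ⟨4 * C + 5, ?_⟩
  intro T σ hT hI
  set N := C * (T.P.n + 1) ^ 2 with hN
  have key : Runs evalProg σ (2 + (N + (N + (N + (N + 2))))) (fun σ' =>
      IsLUB {v | ∃ α ∈ Set.Icc 0 T.A, ∃ β ∈ Set.Icc 0 T.B, T.value (T.scen α β) = v}
        (σ'.rreg 0)) := by
    refine (Runs.of_loopFree (Q := fun τ => τ.nreg 24 = 0) rfl (by simp [Prog.run])).seq
      fun σ₁ F₁ Q₁ => ?_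
    refine (hC hT (Nat.zero_le _) (Nat.zero_le _) (hI.frame F₁ rfl)).seq fun σ₂ _ D₂ => ?_
    refine (hC hT le_rfl (Nat.zero_le _) D₂.input).seq fun σ₃ _ D₃ => ?_
    refine (hC hT (Nat.zero_le _) le_rfl D₃.input).seq fun σ₄ _ D₄ => ?_
    refine (hC hT le_rfl le_rfl D₄.input).seq fun σ₅ _ D₅ => ?_
    have hab : ∀ α ∈ Set.Icc 0 T.A, ∀ β ∈ Set.Icc 0 T.B, Above σ₅ (T.value (T.scen α β)) := by
      intro α hα β hβ
      by_cases h1 : 0 < α <;> by_cases h2 : 0 < β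
      · exact D₅.done α hα β hβ (by simp [h1]) (by simp [h2])
      · exact D₅.above _ (D₄.above _ (D₃.done α hα β hβ (by simp [h1]) (by simp [h2])))
      · exact D₅.above _ (D₄.done α hα β hβ (by simp [h1]) (by simp [h2]))
      · exact D₅.above _ (D₄.above _ (D₃.above _
          (D₂.done α hα β hβ (by simp [h1]) (by simp [h2]))))
    refine Runs.of_loopFree rfl ?_
    have e : ((Prog.setR 0 (.reg 17)).run σ₅).rreg 0 = σ₅.rreg 17 := by simp [Prog.run]
    rw [e]
    constructor
    · rintro _ ⟨α, hα, β, hβ, rfl⟩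
      exact (hab α hα β hβ).2
    · intro V hV
      have hall : ∀ α ∈ Set.Icc 0 T.A, ∀ β ∈ Set.Icc 0 T.B, T.value (T.scen α β) ≤ V :=
        fun α hα β hβ => hV ⟨α, hα, β, hβ, rfl⟩
      refine D₅.below V (D₄.below V (D₃.below V (D₂.below V ?_ hall) hall) hall) hall
        (hab 0 ⟨le_rfl, hT.A_nonneg⟩ 0 ⟨le_rfl, hT.B_nonneg⟩).1
      intro h
      omega
  refine key.mono ?_ fun _ _ h => h
  have : 1 ≤ (T.P.n + 1) ^ 2 := Nat.one_le_pow _ _ (by omega)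
  rw [add_mul, mul_assoc, ← hN]
  omega

end RealRAM

/-! ### The six functions -/

namespace PathNetwork

variable {P : PathNetwork} {s s' : ℕ → ℝ}

/-- Scenarios are functions on all of ℕ, and reversal with truncated subtraction does not respect
their values beyond n. Therefore everything is shown to depend on the values up to n only. -/
theorem weight_congr (h : ∀ t ≤ P.n, s t = s' t) {a b : ℕ} (hb : b ≤ P.n) :
    weight s a b = weight s' a b :=
  Finset.sum_congr rfl fun t ht => h t ((Finset.mem_Icc.1 ht).2.trans hb)

theorem g_congr (h : ∀ t ≤ P.n, s t = s' t) {t : ℕ} (ht : t ≤ P.n) (x : ℝ) :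
    P.g s t x = P.g s' t x := by
  rw [g, g, weight_congr h ht]

theorem h_congr (h : ∀ t ≤ P.n, s t = s' t) (t : ℕ) (x : ℝ) : P.h s t x = P.h s' t x := by
  rw [PathNetwork.h, PathNetwork.h, weight_congr h le_rfl]

theorem minEvac_congr (h : ∀ t ≤ P.n, s t = s' t) (a b : ℝ) :
    P.minEvac s a b = P.minEvac s' a b := by
  have he : ∀ y, P.evac s y = P.evac s' y := by
    intro y
    rw [evac, evac, evacLeft, evacLeft, evacRight, evacRight]
    congr 2
    · exact Set.image_congr fun t ht => g_congr h ht.1 y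
    · exact Set.image_congr fun t _ => h_congr h t y
  simp only [minEvac, he]

/-- The task for `G_j(x)` (if `i = j`) and `G_{i,j}(x)`. -/
noncomputable def taskG (P : PathNetwork) (i j : ℕ) (x : ℝ) : EvacTask where
  P := P
  w t := if i < t ∧ t ≤ j then P.wmax t else P.wmin t
  i := i
  i' := P.n
  p := j
  q := P.n
  lo := j
  hi := j
  fL := 0
  fR := 0
  x := x
  A := P.wmax i - P.wmin i
  B := 0

/-- The task for `Ḡ_{i,j}(x)`. -/
noncomputable def taskGbar (P : PathNetwork) (i j : ℕ) (x : ℝ) : EvacTask where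
  P := P
  w t := if i < t ∧ t < j then P.wmax t else P.wmin t
  i := i
  i' := j
  p := i
  q := j
  lo := j
  hi := P.n
  fL := 0
  fR := 0
  x := x
  A := P.wmax i - P.wmin i
  B := P.wmax j - P.wmin j

/-- The second weight is a dummy with range {0}, put at vertex n so that it lies behind all
locations. For i < j the maximal weight of j is part of the base scenario; for i = j the base
scenario is minimal everywhere. -/
theorem taskG_valid {i j : ℕ} {x : ℝ} (hij : i ≤ j) (hj : j ≤ P.n) (hx : x ≤ P.pos P.n) :
    (P.taskG i j x).Valid where
  w_nonneg t ht := by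
    simp only [taskG] at ht ⊢
    split_ifs
    exacts [(P.wmin_nonneg t ht).trans (P.wmin_le_wmax t ht), P.wmin_nonneg t ht]
  p_le := hj
  q_le := le_rfl
  A_nonneg := sub_nonneg.2 (P.wmin_le_wmax i (hij.trans hj))
  B_nonneg := le_rfl
  i_le := hij
  le_i' := le_rfl
  i'_le := le_rfl
  lo_le := hij
  B_zero := Or.inl rfl
  x_le := hx

theorem taskGbar_valid {i j : ℕ} {x : ℝ} (hij : i ≤ j) (hj : j ≤ P.n) (hx : x ≤ P.pos P.n) :
    (P.taskGbar i j x).Valid where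
  w_nonneg t ht := by
    simp only [taskGbar] at ht ⊢
    split_ifs
    exacts [(P.wmin_nonneg t ht).trans (P.wmin_le_wmax t ht), P.wmin_nonneg t ht]
  p_le := hij
  q_le := hj
  A_nonneg := sub_nonneg.2 (P.wmin_le_wmax i (hij.trans hj))
  B_nonneg := sub_nonneg.2 (P.wmin_le_wmax j hj)
  i_le := le_rfl
  le_i' := le_rfl
  i'_le := hj
  lo_le := hij
  B_zero := Or.inr le_rfl
  x_le := hx

theorem taskG_value {i j : ℕ} {x : ℝ} (hj : j ≤ P.n) (hx : P.pos j ≤ x) (s : ℕ → ℝ) :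
    (P.taskG i j x).value s = P.g s j x - P.minEvac s (P.pos j) (P.pos P.n) := by
  have : (P.taskG i j x).targets = {j} := by
    ext t
    simp only [EvacTask.targets, taskG, Set.mem_ofPred_eq, Set.mem_singleton_iff]
    constructor
    · omega
    · rintro rfl; exact ⟨hj, le_rfl, le_rfl, hx⟩
  rw [EvacTask.value, this, Set.image_singleton, csSup_singleton]
  rfl

theorem taskGbar_value {i j : ℕ} {x : ℝ} (hj : j ≤ P.n) (s : ℕ → ℝ) :
    (P.taskGbar i j x).value s =
      sSup ((fun t => P.g s t x) '' {t | t ≤ P.n ∧ P.pos j ≤ P.pos t ∧ P.pos t ≤ x}) -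
        P.minEvac s (P.pos i) (P.pos j) := by
  have : (P.taskGbar i j x).targets = {t | t ≤ P.n ∧ P.pos j ≤ P.pos t ∧ P.pos t ≤ x} := by
    ext t
    simp only [EvacTask.targets, taskGbar, Set.mem_ofPred_eq]
    constructor
    · rintro ⟨h1, h2, -, h3⟩; exact ⟨h1, (P.pos_le_iff hj h1).2 h2, h3⟩
    · rintro ⟨h1, h2, h3⟩; exact ⟨h1, (P.pos_le_iff hj h1).1 h2, h1, h3⟩
  rw [EvacTask.value, this]
  rfl

theorem G₁_eq {j : ℕ} {x r : ℝ} (hj : j ≤ P.n) (hx : P.pos j ≤ x)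
    (hr : IsLUB {v | ∃ α ∈ Set.Icc 0 (P.taskG j j x).A, ∃ β ∈ Set.Icc 0 (P.taskG j j x).B,
      (P.taskG j j x).value ((P.taskG j j x).scen α β) = v} r) : P.G₁ j x = r := by
  have hw := P.wmin_le_wmax j hj
  have e : ∀ α, (P.taskG j j x).scen α 0 = P.scenario j j (P.wmin j + α) (P.wmin j + α) := by
    intro α
    ext t
    change (if j < t ∧ t ≤ j then P.wmax t else P.wmin t) + (if t = j then α else 0) +
      (if t = P.n then 0 else 0) = _
    simp only [scenario]
    split_ifs <;> first | omega | (subst_vars; ring1)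
  rw [G₁, ← hr.csSup_eq ⟨_, 0, ⟨le_rfl, sub_nonneg.2 hw⟩, 0, ⟨le_rfl, le_rfl⟩, rfl⟩]
  congr 1
  ext v
  simp only [taskG_value hj hx, Set.mem_image, Set.mem_ofPred_eq]
  constructor
  · rintro ⟨s, ⟨α, hα, β, -, hαβ, rfl⟩, rfl⟩
    refine ⟨α - P.wmin j, ⟨by linarith [hα.1], sub_le_sub_right hα.2 _⟩, 0, ⟨le_rfl, le_rfl⟩, ?_⟩
    rw [e, ← hαβ rfl, add_sub_cancel]
  · rintro ⟨α, hα, β, hβ, rfl⟩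
    obtain rfl : β = 0 := le_antisymm hβ.2 hβ.1
    have h2 : α ≤ P.wmax j - P.wmin j := hα.2
    have hm : P.wmin j + α ∈ Set.Icc (P.wmin j) (P.wmax j) := ⟨by linarith [hα.1], by linarith⟩
    exact ⟨_, ⟨_, hm, _, hm, fun _ => rfl, rfl⟩, by rw [e]⟩

theorem G₂_eq {i j : ℕ} {x r : ℝ} (hij : i < j) (hj : j ≤ P.n) (hx : P.pos j ≤ x)
    (hr : IsLUB {v | ∃ α ∈ Set.Icc 0 (P.taskG i j x).A, ∃ β ∈ Set.Icc 0 (P.taskG i j x).B,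
      (P.taskG i j x).value ((P.taskG i j x).scen α β) = v} r) : P.G₂ i j x = r := by
  have hw := P.wmin_le_wmax i (hij.le.trans hj)
  have e : ∀ α, (P.taskG i j x).scen α 0 = P.scenario i j (P.wmin i + α) (P.wmax j) := by
    intro α
    ext t
    change (if i < t ∧ t ≤ j then P.wmax t else P.wmin t) + (if t = i then α else 0) +
      (if t = P.n then 0 else 0) = _
    simp only [scenario]
    split_ifs <;> first | omega | (subst_vars; ring1)
  rw [G₂, ← hr.csSup_eq ⟨_, 0, ⟨le_rfl, sub_nonneg.2 hw⟩, 0, ⟨le_rfl, le_rfl⟩, rfl⟩]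
  congr 1
  ext v
  simp only [taskG_value hj hx, Set.mem_image, Set.mem_ofPred_eq]
  constructor
  · rintro ⟨s, ⟨⟨α, hα, β, -, -, rfl⟩, hs⟩, rfl⟩
    have hβ : β = P.wmax j := by simpa [scenario, hij.ne'] using hs
    refine ⟨α - P.wmin i, ⟨by linarith [hα.1], sub_le_sub_right hα.2 _⟩, 0, ⟨le_rfl, le_rfl⟩, ?_⟩
    rw [e, hβ, add_sub_cancel]
  · rintro ⟨α, hα, β, hβ, rfl⟩
    obtain rfl : β = 0 := le_antisymm hβ.2 hβ.1
    have h2 : α ≤ P.wmax i - P.wmin i := hα.2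
    have hm : P.wmin i + α ∈ Set.Icc (P.wmin i) (P.wmax i) := ⟨by linarith [hα.1], by linarith⟩
    refine ⟨_, ⟨⟨_, hm, _, ⟨P.wmin_le_wmax j hj, le_rfl⟩, fun h => absurd h hij.ne, rfl⟩, ?_⟩,
      by rw [e]⟩
    simp [scenario, hij.ne']

theorem Gbar_eq {i j : ℕ} {x r : ℝ} (hij : i < j) (hj : j ≤ P.n)
    (hr : IsLUB {v | ∃ α ∈ Set.Icc 0 (P.taskGbar i j x).A, ∃ β ∈ Set.Icc 0 (P.taskGbar i j x).B,
      (P.taskGbar i j x).value ((P.taskGbar i j x).scen α β) = v} r) : P.Gbar i j x = r := by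
  have hw := P.wmin_le_wmax i (hij.le.trans hj)
  have hw' := P.wmin_le_wmax j hj
  have e : ∀ α β, (P.taskGbar i j x).scen α β =
      P.scenario i j (P.wmin i + α) (P.wmin j + β) := by
    intro α β
    ext t
    change (if i < t ∧ t < j then P.wmax t else P.wmin t) + (if t = i then α else 0) +
      (if t = j then β else 0) = _
    simp only [scenario]
    split_ifs <;> first | omega | (subst_vars; ring1)
  rw [Gbar, ← hr.csSup_eq ⟨_, 0, ⟨le_rfl, sub_nonneg.2 hw⟩, 0, ⟨le_rfl, sub_nonneg.2 hw'⟩, rfl⟩]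
  congr 1
  ext v
  simp only [taskGbar_value hj, Set.mem_image, Set.mem_ofPred_eq]
  constructor
  · rintro ⟨s, ⟨α, hα, β, hβ, -, rfl⟩, rfl⟩
    refine ⟨α - P.wmin i, ⟨by linarith [hα.1], sub_le_sub_right hα.2 _⟩,
      β - P.wmin j, ⟨by linarith [hβ.1], sub_le_sub_right hβ.2 _⟩, ?_⟩
    rw [e, add_sub_cancel, add_sub_cancel]
  · rintro ⟨α, hα, β, hβ, rfl⟩
    have h2 : α ≤ P.wmax i - P.wmin i := hα.2
    have h3 : β ≤ P.wmax j - P.wmin j := hβ.2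
    have hm : P.wmin i + α ∈ Set.Icc (P.wmin i) (P.wmax i) := ⟨by linarith [hα.1], by linarith⟩
    have hm' : P.wmin j + β ∈ Set.Icc (P.wmin j) (P.wmax j) := ⟨by linarith [hβ.1], by linarith⟩
    exact ⟨_, ⟨_, hm, _, hm', fun h => absurd h hij.ne, rfl⟩, by rw [e]⟩

/-! ### Reversal of the six functions -/

theorem scenario_rev {i j : ℕ} (hij : i ≤ j) (hj : j ≤ P.n) {α β : ℝ} (hαβ : i = j → α = β) :
    ∀ t ≤ P.n, P.revScenario (P.scenario i j α β) t =
      P.rev.scenario (P.n - j) (P.n - i) β α t := by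
  intro t ht
  simp only [revScenario, scenario, rev]
  split_ifs <;> first | omega | rfl | skip
  exact hαβ (by omega)

/-- Scenarios of the path and of the reversed path correspond to each other. -/
theorem twoVarying_rev {i j : ℕ} (hij : i ≤ j) (hj : j ≤ P.n) {f f' : (ℕ → ℝ) → ℝ}
    {p p' : (ℕ → ℝ) → Prop} (hf : ∀ s s', (∀ t ≤ P.n, P.revScenario s t = s' t) → f s = f' s')
    (hp : ∀ s s', (∀ t ≤ P.n, P.revScenario s t = s' t) → (p s ↔ p' s')) :
    f '' {s | s ∈ P.twoVarying i j ∧ p s} =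
      f' '' {s | s ∈ P.rev.twoVarying (P.n - j) (P.n - i) ∧ p' s} := by
  have ei : P.n - (P.n - i) = i := by omega
  have ej : P.n - (P.n - j) = j := by omega
  refine image_revScenario ?_ ?_
  · rintro s ⟨⟨α, hα, β, hβ, hαβ, rfl⟩, hs⟩
    have hrev := P.scenario_rev hij hj hαβ
    refine ⟨_, ⟨⟨β, ?_, α, ?_, fun h => (hαβ (by omega)).symm, rfl⟩, (hp _ _ hrev).1 hs⟩,
      hf _ _ hrev⟩
    · simpa only [rev, ej] using hβ
    · simpa only [rev, ei] using hα
  · rintro s ⟨⟨β, hβ, α, hα, hαβ, rfl⟩, hs⟩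
    have hαβ' : i = j → α = β := fun h => (hαβ (by omega)).symm
    have hrev := P.scenario_rev hij hj hαβ'
    refine ⟨_, ⟨⟨α, ?_, β, ?_, hαβ', rfl⟩, (hp _ _ hrev).2 hs⟩, hf _ _ hrev⟩
    · simpa only [rev, ei] using hα
    · simpa only [rev, ej] using hβ

theorem h_sub_minEvac_rev {i : ℕ} (hi : i ≤ P.n) (x : ℝ)
    (h : ∀ t ≤ P.n, P.revScenario s t = s' t) :
    P.h s i x - P.minEvac s (P.pos 0) (P.pos i) =
      P.rev.g s' (P.n - i) (P.pos P.n - x) -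
        P.rev.minEvac s' (P.rev.pos (P.n - i)) (P.rev.pos P.rev.n) := by
  have h' : ∀ t ≤ P.rev.n, s' t = P.revScenario s t := fun t ht => (h t ht).symm
  have ei : P.n - (P.n - i) = i := by omega
  rw [g_congr h' (Nat.sub_le P.n i), minEvac_congr h', g_rev (Nat.sub_le _ _),
    pos_rev (Nat.sub_le _ _), ei, rev_n, pos_rev_n, ← minEvac_rev, pos_zero, sub_zero]

theorem H₁_eq {i : ℕ} (hi : i ≤ P.n) (x : ℝ) :
    P.H₁ i x = P.rev.G₁ (P.n - i) (P.pos P.n - x) := by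
  rw [H₁, G₁]
  congr 1
  simpa using twoVarying_rev (p := fun _ => True) (p' := fun _ => True) le_rfl hi
    (fun s s' h => h_sub_minEvac_rev hi x h) fun _ _ _ => Iff.rfl

theorem H₂_eq {i j : ℕ} (hij : i < j) (hj : j ≤ P.n) (x : ℝ) :
    P.H₂ i j x = P.rev.G₂ (P.n - j) (P.n - i) (P.pos P.n - x) := by
  rw [H₂, G₂]
  congr 1
  have ei : P.n - (P.n - i) = i := by omega
  refine twoVarying_rev hij.le hj (fun s s' h => h_sub_minEvac_rev (hij.le.trans hj) x h)
    fun s s' h => ?_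
  rw [← h _ (Nat.sub_le _ _), revScenario, ei]
  simp only [rev, ei]

theorem Hbar_eq {i j : ℕ} (hij : i < j) (hj : j ≤ P.n) (x : ℝ) :
    P.Hbar i j x = P.rev.Gbar (P.n - j) (P.n - i) (P.pos P.n - x) := by
  rw [Hbar, Gbar]
  congr 1
  have ei : P.n - (P.n - i) = i := by omega
  have ej : P.n - (P.n - j) = j := by omega
  have := twoVarying_rev (P := P) (p := fun _ => True) (p' := fun _ => True) hij.le hj
    (f := fun s => sSup ((fun t => P.h s t x) '' {t | t ≤ P.n ∧ x ≤ P.pos t ∧ P.pos t ≤ P.pos i})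
      - P.minEvac s (P.pos i) (P.pos j))
    (f' := fun s => sSup ((fun t => P.rev.g s t (P.pos P.n - x)) ''
      {t | t ≤ P.rev.n ∧ P.rev.pos (P.n - i) ≤ P.rev.pos t ∧ P.rev.pos t ≤ P.pos P.n - x})
      - P.rev.minEvac s (P.rev.pos (P.n - j)) (P.rev.pos (P.n - i)))
    (fun s s' h => ?_) fun _ _ _ => Iff.rfl
  · simpa using this
  have h' : ∀ t ≤ P.rev.n, s' t = P.revScenario s t := fun t ht => (h t ht).symm
  have himg : (fun t => P.rev.g s' t (P.pos P.n - x)) ''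
      {t | t ≤ P.rev.n ∧ P.rev.pos (P.n - i) ≤ P.rev.pos t ∧ P.rev.pos t ≤ P.pos P.n - x} =
      (fun t => P.h s t x) '' {t | t ≤ P.n ∧ x ≤ P.pos t ∧ P.pos t ≤ P.pos i} := by
    refine image_rev (n := P.n) (fun t ht => ?_) fun t ht => ?_
    · rw [g_congr h' ht, g_rev ht]
    · rw [pos_rev ht, pos_rev (Nat.sub_le _ _), ei]
      constructor <;> rintro ⟨h1, h2⟩ <;> constructor <;> linarith
  rw [himg, minEvac_congr h', pos_rev (Nat.sub_le _ _), pos_rev (Nat.sub_le _ _), ei, ej,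
    minEvac_rev]

end PathNetwork

/-! ### The programs -/

namespace RealRAM

/-- The path, the indices and the point are in memory. -/
structure Loads (P : PathNetwork) (i j : ℕ) (x : ℝ) (σ : State) : Prop where
  n : σ.nreg 0 = P.n
  i : σ.nreg 1 = i
  j : σ.nreg 2 = j
  x : σ.rreg 0 = x
  len : ∀ k < P.n, σ.rarr 0 k = P.len k
  cap : ∀ k < P.n, σ.rarr 1 k = P.cap k
  wmin : ∀ k ≤ P.n, σ.rarr 2 k = P.wmin k
  wmax : ∀ k ≤ P.n, σ.rarr 3 k = P.wmax k

theorem loads_input (P : PathNetwork) (i j : ℕ) (x : ℝ) : Loads P i j x (P.input i j x) := by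
  constructor <;> simp +contextual [PathNetwork.input]

/-- Load the scenario with the largest weights where `b` holds and the smallest ones elsewhere. -/
def fillProg (b : Test) : Prog :=
  .seq (.setN 8 (.const 0)) <| .loop (.nle (.reg 8) (.reg 0)) <|
    .seq (.branch b (.storeR 4 (.reg 8) (.read 3 (.reg 8))) (.storeR 4 (.reg 8) (.read 2 (.reg 8))))
      (.setN 8 (.add (.reg 8) (.const 1)))

open Classical in
theorem fillProg_runs {b : Test} {φ : ℕ → ℕ → ℕ → Prop}
    (hb : ∀ σ : State, b.holds σ ↔ φ (σ.nreg 1) (σ.nreg 2) (σ.nreg 8)) :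
    ∃ C, ∀ {P : PathNetwork} {i j : ℕ} {x : ℝ} {σ : State}, Loads P i j x σ →
      Runs (fillProg b) σ (C * (P.n + 1)) (fun σ' => Loads P i j x σ' ∧
        ∀ k ≤ P.n, σ'.rarr 4 k = if φ i j k then P.wmax k else P.wmin k) := by
  set body : Prog := .seq (.branch b (.storeR 4 (.reg 8) (.read 3 (.reg 8)))
    (.storeR 4 (.reg 8) (.read 2 (.reg 8)))) (.setN 8 (.add (.reg 8) (.const 1))) with hbody
  refine ⟨body.size + 20, ?_⟩
  intro P i j x σ hL
  let I : ℕ → State → Prop := fun t τ => Loads P i j x τ ∧ τ.nreg 8 = t ∧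
    ∀ k < t, τ.rarr 4 k = if φ i j k then P.wmax k else P.wmin k
  have key : Runs (fillProg b) σ (2 + ((P.n + 1 - 0) * (body.size + 3) + 3)) (I (P.n + 1)) := by
    refine (Runs.of_loopFree (Q := I 0) rfl ?_).seq fun σ₁ _ h => ?_
    · obtain ⟨h1, h2, h3, h4, h5, h6, h7, h8⟩ := hL
      exact ⟨⟨by simp [Prog.run, h1], by simp [Prog.run, h2], by simp [Prog.run, h3], h4, h5, h6,
        h7, h8⟩, by simp [Prog.run], fun k hk => by omega⟩
    refine Runs.for_loop (b := .nle (.reg 8) (.reg 0)) (p := body)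
      (T := body.size) (I := I) (N := P.n + 1) (k := 0)
      (fun k τ _ h => by simp only [Test.holds, NExpr.eval, h.1.n, h.2.1]; omega)
      (fun k τ hk h => ?_) (Nat.zero_le _) h
    obtain ⟨⟨h1, h2, h3, h4, h5, h6, h7, h8⟩, h9, h10⟩ := h
    refine Runs.of_loopFree rfl ?_
    have F := body.frame_run rfl τ
    refine ⟨⟨(F.nreg 0 rfl).trans h1, (F.nreg 1 rfl).trans h2, (F.nreg 2 rfl).trans h3,
      (F.rreg 0 rfl).trans h4, by rwa [F.rarr 0 rfl], by rwa [F.rarr 1 rfl],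
      by rwa [F.rarr 2 rfl], by rwa [F.rarr 3 rfl]⟩, ?_, ?_⟩
    · by_cases hc : b.holds τ <;> simp [hbody, Prog.run, hc, h9]
    · have hbτ := hb τ
      rw [h2, h3, h9] at hbτ
      intro t ht
      have g2 := h7 k (by omega)
      have g3 := h8 k (by omega)
      by_cases hc : φ i j k
      · have hc' := hbτ.2 hc
        rcases Nat.lt_succ_iff_lt_or_eq.1 ht with ht | rfl
        · simp only [hbody, Prog.run, if_pos hc', State.setN_rarr, State.putR_rarr, NExpr.eval,
            if_true, h9]
          rw [Function.update_of_ne (by omega), h10 t ht]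
        · simp [hbody, Prog.run, hc', h9, hc, g3]
      · have hc' := mt hbτ.1 hc
        rcases Nat.lt_succ_iff_lt_or_eq.1 ht with ht | rfl
        · simp only [hbody, Prog.run, if_neg hc', State.setN_rarr, State.putR_rarr, NExpr.eval,
            if_true, h9]
          rw [Function.update_of_ne (by omega), h10 t ht]
        · simp [hbody, Prog.run, hc', h9, hc, g2]
  refine key.mono ?_ fun τ _ h => ⟨h.1, fun k hk => h.2.2 k (by omega)⟩
  simp only [Nat.sub_zero]
  generalize body.size = a
  nlinarith

/-- Set the parameters of a task, apart from the range of the second weight. -/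
def taskPre (i' p q hi : NExpr) : Prog :=
  .seq (.setN 33 (.reg 1)) <| .seq (.setN 34 i') <| .seq (.setN 25 p) <| .seq (.setN 26 q) <|
  .seq (.setN 27 (.reg 2)) <| .seq (.setN 28 hi) <| .seq (.setR 22 (.reg 0)) <|
  .setR 12 (.sub (.read 3 (.reg 1)) (.read 2 (.reg 1)))

/-- Program for `G_j` and `G_{i,j}`. -/
def progG : Prog :=
  .seq (fillProg (.and (.nle (.add (.reg 1) (.const 1)) (.reg 8)) (.nle (.reg 8) (.reg 2)))) <|
  .seq (.seq (taskPre (.reg 0) (.reg 2) (.reg 0) (.reg 2)) (.setR 13 (.const 0))) evalProg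

/-- Program for `Ḡ_{i,j}`. -/
def progGbar : Prog :=
  .seq (fillProg (.and (.nle (.add (.reg 1) (.const 1)) (.reg 8))
    (.nle (.add (.reg 8) (.const 1)) (.reg 2)))) <|
  .seq (.seq (taskPre (.reg 2) (.reg 1) (.reg 2) (.reg 0))
    (.setR 13 (.sub (.read 3 (.reg 2)) (.read 2 (.reg 2))))) evalProg

theorem progG_runs : ∃ C, ∀ {P : PathNetwork} {i j : ℕ} {x : ℝ} {σ : State}, i ≤ j → j ≤ P.n →
    x ≤ P.pos P.n → Loads P i j x σ → Runs progG σ (C * (P.n + 1) ^ 2) (fun σ' =>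
      IsLUB {v | ∃ α ∈ Set.Icc 0 (P.taskG i j x).A, ∃ β ∈ Set.Icc 0 (P.taskG i j x).B,
        (P.taskG i j x).value ((P.taskG i j x).scen α β) = v} (σ'.rreg 0)) := by
  obtain ⟨C₁, hC₁⟩ := fillProg_runs
    (b := .and (.nle (.add (.reg 1) (.const 1)) (.reg 8)) (.nle (.reg 8) (.reg 2)))
    (φ := fun i j k => i < k ∧ k ≤ j) fun _ => Iff.rfl
  obtain ⟨C₂, hC₂⟩ := evalProg_runs
  refine ⟨C₁ + C₂ + 30, ?_⟩
  intro P i j x σ hij hj hx hL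
  set pre : Prog := .seq (taskPre (.reg 0) (.reg 2) (.reg 0) (.reg 2)) (.setR 13 (.const 0))
    with hpre
  refine ((hC₁ hL).seq fun σ₁ F₁ ⟨L₁, W₁⟩ => (Runs.of_loopFree (p := pre)
    (Q := FullInput (P.taskG i j x)) rfl ?_).seq fun σ₂ F₂ I₂ =>
      hC₂ (PathNetwork.taskG_valid hij hj hx) I₂).mono ?_ fun _ _ h => h
  · have F := pre.frame_run rfl σ₁
    have w2 := L₁.wmin i (hij.trans hj)
    have w3 := L₁.wmax i (hij.trans hj)
    refine ⟨L₁.n, ?_, ?_, ?_, ?_, ?_, ?_, ?_, ?_, ?_, L₁.len, L₁.cap, fun k hk => ?_⟩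
    · simp [hpre, taskPre, Prog.run, PathNetwork.taskG, L₁.i]
    · simp [hpre, taskPre, Prog.run, PathNetwork.taskG, L₁.n]
    · simp [hpre, taskPre, Prog.run, PathNetwork.taskG, L₁.j]
    · simp [hpre, taskPre, Prog.run, PathNetwork.taskG, L₁.n]
    · simp [hpre, taskPre, Prog.run, PathNetwork.taskG, L₁.j]
    · simp [hpre, taskPre, Prog.run, PathNetwork.taskG, L₁.j]
    · simp [hpre, taskPre, Prog.run, PathNetwork.taskG, L₁.x]
    · simp [hpre, taskPre, Prog.run, PathNetwork.taskG, L₁.i, w2, w3]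
    · simp [hpre, taskPre, Prog.run, PathNetwork.taskG]
    · rw [F.rarr 4 rfl, W₁ k hk]
      simp only [PathNetwork.taskG]
      congr
  · have h1 : P.n + 1 ≤ (P.n + 1) ^ 2 := Nat.le_self_pow two_ne_zero _
    have h2 := Nat.mul_le_mul_left C₁ h1
    simp only [hpre, taskPre, Prog.size, NExpr.cost, RExpr.cost, PathNetwork.taskG]
    generalize (P.n + 1) ^ 2 = S at *
    linarith

theorem progGbar_runs : ∃ C, ∀ {P : PathNetwork} {i j : ℕ} {x : ℝ} {σ : State}, i ≤ j → j ≤ P.n →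
    x ≤ P.pos P.n → Loads P i j x σ → Runs progGbar σ (C * (P.n + 1) ^ 2) (fun σ' =>
      IsLUB {v | ∃ α ∈ Set.Icc 0 (P.taskGbar i j x).A, ∃ β ∈ Set.Icc 0 (P.taskGbar i j x).B,
        (P.taskGbar i j x).value ((P.taskGbar i j x).scen α β) = v} (σ'.rreg 0)) := by
  obtain ⟨C₁, hC₁⟩ := fillProg_runs
    (b := .and (.nle (.add (.reg 1) (.const 1)) (.reg 8)) (.nle (.add (.reg 8) (.const 1)) (.reg 2)))
    (φ := fun i j k => i < k ∧ k < j) fun _ => Iff.rfl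
  obtain ⟨C₂, hC₂⟩ := evalProg_runs
  refine ⟨C₁ + C₂ + 30, ?_⟩
  intro P i j x σ hij hj hx hL
  set pre : Prog := .seq (taskPre (.reg 2) (.reg 1) (.reg 2) (.reg 0))
    (.setR 13 (.sub (.read 3 (.reg 2)) (.read 2 (.reg 2)))) with hpre
  refine ((hC₁ hL).seq fun σ₁ F₁ ⟨L₁, W₁⟩ => (Runs.of_loopFree (p := pre)
    (Q := FullInput (P.taskGbar i j x)) rfl ?_).seq fun σ₂ F₂ I₂ =>
      hC₂ (PathNetwork.taskGbar_valid hij hj hx) I₂).mono ?_ fun _ _ h => h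
  · have F := pre.frame_run rfl σ₁
    have w2 := L₁.wmin i (hij.trans hj)
    have w3 := L₁.wmax i (hij.trans hj)
    have w2' := L₁.wmin j hj
    have w3' := L₁.wmax j hj
    refine ⟨L₁.n, ?_, ?_, ?_, ?_, ?_, ?_, ?_, ?_, ?_, L₁.len, L₁.cap, fun k hk => ?_⟩
    · simp [hpre, taskPre, Prog.run, PathNetwork.taskGbar, L₁.i]
    · simp [hpre, taskPre, Prog.run, PathNetwork.taskGbar, L₁.j]
    · simp [hpre, taskPre, Prog.run, PathNetwork.taskGbar, L₁.i]
    · simp [hpre, taskPre, Prog.run, PathNetwork.taskGbar, L₁.j]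
    · simp [hpre, taskPre, Prog.run, PathNetwork.taskGbar, L₁.j]
    · simp [hpre, taskPre, Prog.run, PathNetwork.taskGbar, L₁.n]
    · simp [hpre, taskPre, Prog.run, PathNetwork.taskGbar, L₁.x]
    · simp [hpre, taskPre, Prog.run, PathNetwork.taskGbar, L₁.i, w2, w3]
    · simp [hpre, taskPre, Prog.run, PathNetwork.taskGbar, L₁.j, w2', w3']
    · rw [F.rarr 4 rfl, W₁ k hk]
      simp only [PathNetwork.taskGbar]
      congr
  · have h1 : P.n + 1 ≤ (P.n + 1) ^ 2 := Nat.le_self_pow two_ne_zero _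
    have h2 := Nat.mul_le_mul_left C₁ h1
    simp only [hpre, taskPre, Prog.size, NExpr.cost, RExpr.cost, PathNetwork.taskGbar]
    generalize (P.n + 1) ^ 2 = S at *
    linarith

/-- Write the reversed path to auxiliary arrays and add up the lengths. -/
def reverseOut : Prog :=
  .seq (.seq (.setN 8 (.const 0)) (.setR 24 (.const 0))) <| .loop (.nle (.reg 8) (.reg 0)) <|
    .seq (.storeR 10 (.reg 8) (.read 0 (.sub (.sub (.reg 0) (.const 1)) (.reg 8)))) <|
    .seq (.storeR 11 (.reg 8) (.read 1 (.sub (.sub (.reg 0) (.const 1)) (.reg 8)))) <|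
    .seq (.storeR 12 (.reg 8) (.read 2 (.sub (.reg 0) (.reg 8)))) <|
    .seq (.storeR 13 (.reg 8) (.read 3 (.sub (.reg 0) (.reg 8)))) <|
    .seq (.branch (.nle (.add (.reg 8) (.const 1)) (.reg 0))
      (.setR 24 (.add (.reg 24) (.read 0 (.reg 8)))) .nop) <|
    .setN 8 (.add (.reg 8) (.const 1))

/-- Copy the reversed path back, and reverse the indices and the point. -/
def reverseBack : Prog :=
  .seq (.setN 8 (.const 0)) <| .seq (.loop (.nle (.reg 8) (.reg 0)) <|
    .seq (.storeR 0 (.reg 8) (.read 10 (.reg 8))) <|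
    .seq (.storeR 1 (.reg 8) (.read 11 (.reg 8))) <|
    .seq (.storeR 2 (.reg 8) (.read 12 (.reg 8))) <|
    .seq (.storeR 3 (.reg 8) (.read 13 (.reg 8))) <|
    .setN 8 (.add (.reg 8) (.const 1))) <|
  .seq (.setN 33 (.sub (.reg 0) (.reg 2))) <| .seq (.setN 2 (.sub (.reg 0) (.reg 1))) <|
  .seq (.setN 1 (.reg 33)) <| .setR 0 (.sub (.reg 24) (.reg 0))

/-- The reversed path is in the auxiliary arrays up to entry `t`. -/
structure Reversed (P : PathNetwork) (t : ℕ) (σ : State) : Prop where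
  len : ∀ k < t, k < P.n → σ.rarr 10 k = P.rev.len k
  cap : ∀ k < t, k < P.n → σ.rarr 11 k = P.rev.cap k
  wmin : ∀ k < t, k ≤ P.n → σ.rarr 12 k = P.rev.wmin k
  wmax : ∀ k < t, k ≤ P.n → σ.rarr 13 k = P.rev.wmax k

theorem reverseOut_runs : ∃ C, ∀ {P : PathNetwork} {i j : ℕ} {x : ℝ} {σ : State},
    Loads P i j x σ → Runs reverseOut σ (C * (P.n + 1)) (fun σ' =>
      Reversed P (P.n + 1) σ' ∧ σ'.rreg 24 = P.pos P.n) := by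
  set body : Prog :=
    .seq (.storeR 10 (.reg 8) (.read 0 (.sub (.sub (.reg 0) (.const 1)) (.reg 8)))) <|
    .seq (.storeR 11 (.reg 8) (.read 1 (.sub (.sub (.reg 0) (.const 1)) (.reg 8)))) <|
    .seq (.storeR 12 (.reg 8) (.read 2 (.sub (.reg 0) (.reg 8)))) <|
    .seq (.storeR 13 (.reg 8) (.read 3 (.sub (.reg 0) (.reg 8)))) <|
    .seq (.branch (.nle (.add (.reg 8) (.const 1)) (.reg 0))
      (.setR 24 (.add (.reg 24) (.read 0 (.reg 8)))) .nop) <|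
    .setN 8 (.add (.reg 8) (.const 1)) with hbody
  refine ⟨body.size + 20, ?_⟩
  intro P i j x σ hL
  -- The loop runs over n + 1 vertices but there are only n lengths, hence the truncation at n. The
  -- entries written for edge n are junk, which `Reversed` does not mention.
  let I : ℕ → State → Prop := fun t τ => Loads P i j x τ ∧ τ.nreg 8 = t ∧
    Reversed P t τ ∧ τ.rreg 24 = P.pos (min t P.n)
  have key : Runs reverseOut σ (4 + ((P.n + 1 - 0) * (body.size + 3) + 3)) (I (P.n + 1)) := by
    refine (Runs.of_loopFree (Q := I 0) rfl ?_).seq fun σ₁ _ h => ?_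
    · obtain ⟨h1, h2, h3, h4, h5, h6, h7, h8⟩ := hL
      exact ⟨⟨by simp [Prog.run, h1], by simp [Prog.run, h2], by simp [Prog.run, h3],
        by simp [Prog.run, h4], h5, h6, h7, h8⟩, by simp [Prog.run],
        ⟨fun k hk => by omega, fun k hk => by omega, fun k hk => by omega, fun k hk => by omega⟩,
        by simp [Prog.run]⟩
    refine Runs.for_loop (b := .nle (.reg 8) (.reg 0)) (p := body)
      (T := body.size) (I := I) (N := P.n + 1) (k := 0)
      (fun k τ _ h => by simp only [Test.holds, NExpr.eval, h.1.n, h.2.1]; omega)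
      (fun k τ hk h => ?_) (Nat.zero_le _) h
    obtain ⟨⟨h1, h2, h3, h4, h5, h6, h7, h8⟩, h9, ⟨r1, r2, r3, r4⟩, h10⟩ := h
    refine Runs.of_loopFree rfl ?_
    have F := body.frame_run rfl τ
    refine ⟨⟨(F.nreg 0 rfl).trans h1, (F.nreg 1 rfl).trans h2, (F.nreg 2 rfl).trans h3,
      (F.rreg 0 rfl).trans h4, by rwa [F.rarr 0 rfl], by rwa [F.rarr 1 rfl],
      by rwa [F.rarr 2 rfl], by rwa [F.rarr 3 rfl]⟩, ?_, ?_, ?_⟩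
    · by_cases hc : k + 1 ≤ P.n <;> simp [hbody, Prog.run, h1, h9, hc]
    · have store : ∀ (f g : ℕ → ℝ) (v : ℝ) (Q : ℕ → Prop), (∀ m < k, Q m → f m = g m) →
          (Q k → v = g k) → ∀ m < k + 1, Q m → Function.update f k v m = g m := by
        intro f g v Q hf hv m hm hQ
        rcases Nat.lt_succ_iff_lt_or_eq.1 hm with hm | rfl
        · rw [Function.update_of_ne (by omega)]; exact hf m hm hQ
        · rw [Function.update_self]; exact hv hQ
      have e : (body.run τ).rarr 10 = Function.update (τ.rarr 10) k (τ.rarr 0 (P.n - 1 - k)) ∧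
          (body.run τ).rarr 11 = Function.update (τ.rarr 11) k (τ.rarr 1 (P.n - 1 - k)) ∧
          (body.run τ).rarr 12 = Function.update (τ.rarr 12) k (τ.rarr 2 (P.n - k)) ∧
          (body.run τ).rarr 13 = Function.update (τ.rarr 13) k (τ.rarr 3 (P.n - k)) := by
        by_cases hc : k + 1 ≤ P.n <;> simp [hbody, Prog.run, h1, h9, hc]
      obtain ⟨e1, e2, e3, e4⟩ := e
      constructor
      · rw [e1]; exact store _ _ _ _ r1 fun h => h5 _ (by omega)
      · rw [e2]; exact store _ _ _ _ r2 fun h => h6 _ (by omega)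
      · rw [e3]; exact store _ _ _ _ r3 fun h => h7 _ (by omega)
      · rw [e4]; exact store _ _ _ _ r4 fun h => h8 _ (by omega)
    · by_cases hc : k + 1 ≤ P.n
      · rw [min_eq_left hc, P.pos_succ, ← h5 k hc]
        rw [min_eq_left (by omega)] at h10
        simp [hbody, Prog.run, h1, h9, hc, h10]
      · rw [min_eq_right (by omega)] at h10 ⊢
        simp [hbody, Prog.run, h1, h9, hc, h10]
  refine key.mono ?_ fun τ _ h => ⟨h.2.2.1, by rw [h.2.2.2, min_eq_right (by omega)]⟩
  simp only [Nat.sub_zero]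
  generalize body.size = a
  nlinarith

theorem reverseBack_runs : ∃ C, ∀ {P : PathNetwork} {i j : ℕ} {x : ℝ} {σ : State},
    σ.nreg 0 = P.n → σ.nreg 1 = i → σ.nreg 2 = j → σ.rreg 0 = x → σ.rreg 24 = P.pos P.n →
    Reversed P (P.n + 1) σ → Runs reverseBack σ (C * (P.n + 1))
      (Loads P.rev (P.n - j) (P.n - i) (P.pos P.n - x)) := by
  set body : Prog :=
    .seq (.storeR 0 (.reg 8) (.read 10 (.reg 8))) <|
    .seq (.storeR 1 (.reg 8) (.read 11 (.reg 8))) <|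
    .seq (.storeR 2 (.reg 8) (.read 12 (.reg 8))) <|
    .seq (.storeR 3 (.reg 8) (.read 13 (.reg 8))) <|
    .setN 8 (.add (.reg 8) (.const 1)) with hbody
  refine ⟨body.size + 40, ?_⟩
  intro P i j x σ hn hi hj hx h24 hR
  let I : ℕ → State → Prop := fun t τ => τ.nreg 0 = P.n ∧ τ.nreg 1 = i ∧ τ.nreg 2 = j ∧
    τ.rreg 0 = x ∧ τ.rreg 24 = P.pos P.n ∧ τ.nreg 8 = t ∧
    τ.rarr 10 = σ.rarr 10 ∧ τ.rarr 11 = σ.rarr 11 ∧ τ.rarr 12 = σ.rarr 12 ∧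
    τ.rarr 13 = σ.rarr 13 ∧ ∀ k < t, τ.rarr 0 k = σ.rarr 10 k ∧ τ.rarr 1 k = σ.rarr 11 k ∧
      τ.rarr 2 k = σ.rarr 12 k ∧ τ.rarr 3 k = σ.rarr 13 k
  have key : Runs reverseBack σ (2 + (((P.n + 1 - 0) * (body.size + 3) + 3) + 14))
      (Loads P.rev (P.n - j) (P.n - i) (P.pos P.n - x)) := by
    refine (Runs.of_loopFree (Q := I 0) rfl ?_).seq fun σ₁ _ h => ?_
    · exact ⟨by simp [Prog.run, hn], by simp [Prog.run, hi], by simp [Prog.run, hj], hx, h24,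
        by simp [Prog.run], rfl, rfl, rfl, rfl, fun k hk => by omega⟩
    refine (Runs.for_loop (b := .nle (.reg 8) (.reg 0)) (p := body)
      (T := body.size) (I := I) (N := P.n + 1) (k := 0)
      (fun k τ _ h => by simp only [Test.holds, NExpr.eval, h.1, h.2.2.2.2.2.1]; omega)
      (fun k τ hk h => ?_) (Nat.zero_le _) h).seq fun σ₂ _ h => ?_
    · obtain ⟨h1, h2, h3, h4, h5, h6, h7, h8, h9, h10, h11⟩ := h
      refine Runs.of_loopFree rfl ?_
      have F := body.frame_run rfl τ
      refine ⟨(F.nreg 0 rfl).trans h1, (F.nreg 1 rfl).trans h2, (F.nreg 2 rfl).trans h3,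
        (F.rreg 0 rfl).trans h4, (F.rreg 24 rfl).trans h5, ?_, by rw [F.rarr 10 rfl, h7],
        by rw [F.rarr 11 rfl, h8], by rw [F.rarr 12 rfl, h9], by rw [F.rarr 13 rfl, h10], ?_⟩
      · simp [hbody, Prog.run, h6]
      · intro m hm
        rcases Nat.lt_succ_iff_lt_or_eq.1 hm with hm | rfl
        · have hne : m ≠ k := hm.ne
          simpa [hbody, Prog.run, h6, hne] using h11 m hm
        · simp [hbody, Prog.run, h6, h7, h8, h9, h10]
    · obtain ⟨h1, h2, h3, h4, h5, h6, h7, h8, h9, h10, h11⟩ := h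
      refine Runs.of_loopFree rfl ⟨?_, ?_, ?_, ?_, fun k hk => ?_, fun k hk => ?_,
        fun k hk => ?_, fun k hk => ?_⟩
      · simp [Prog.run, h1]
      · simp [Prog.run, h1, h3]
      · simp [Prog.run, h1, h2]
      · simp [Prog.run, h4, h5]
      · have hk' : k < P.n := hk
        exact (h11 k (by omega)).1.trans (hR.len k (by omega) hk')
      · have hk' : k < P.n := hk
        exact (h11 k (by omega)).2.1.trans (hR.cap k (by omega) hk')
      · have hk' : k ≤ P.n := hk
        exact (h11 k (by omega)).2.2.1.trans (hR.wmin k (by omega) hk')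
      · have hk' : k ≤ P.n := hk
        exact (h11 k (by omega)).2.2.2.trans (hR.wmax k (by omega) hk')
  refine key.mono ?_ fun _ _ h => h
  simp only [Nat.sub_zero]
  generalize body.size = a
  nlinarith

/-- Reverse the path. -/
def reverseProg : Prog := .seq reverseOut reverseBack

theorem reverseProg_runs : ∃ C, ∀ {P : PathNetwork} {i j : ℕ} {x : ℝ} {σ : State},
    Loads P i j x σ → Runs reverseProg σ (C * (P.n + 1))
      (Loads P.rev (P.n - j) (P.n - i) (P.pos P.n - x)) := by
  obtain ⟨C₁, hC₁⟩ := reverseOut_runs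
  obtain ⟨C₂, hC₂⟩ := reverseBack_runs
  refine ⟨C₁ + C₂, ?_⟩
  intro P i j x σ hL
  rw [add_mul]
  exact (hC₁ hL).seq fun σ₁ F ⟨h1, h2⟩ => hC₂ ((F.nreg 0 rfl).trans hL.n)
    ((F.nreg 1 rfl).trans hL.i) ((F.nreg 2 rfl).trans hL.j) ((F.rreg 0 rfl).trans hL.x) h2 h1

/-- For n ≥ 1 the factor 4 absorbs the passage from (n + 1)² to n². -/
theorem Runs.evaluatesWithin {p : Prog} {σ : State} {v : ℝ} {C n : ℕ} (hn : 1 ≤ n)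
    (h : Runs p σ (C * (n + 1) ^ 2) (fun σ' => σ'.rreg 0 = v)) :
    p.EvaluatesWithin σ v (4 * C * n ^ 2) := by
  obtain ⟨σ', t, h1, h2, h3⟩ := h
  refine ⟨σ', t, h1, h2.trans ?_, h3⟩
  have : (n + 1) ^ 2 ≤ 4 * n ^ 2 := by nlinarith
  calc C * (n + 1) ^ 2 ≤ C * (4 * n ^ 2) := Nat.mul_le_mul_left C this
    _ = 4 * C * n ^ 2 := by ring

/-- Running a program on the reversed path. -/
theorem Runs.reversed {p : Prog} {C : ℕ} {Pre : PathNetwork → ℕ → ℕ → ℝ → Prop}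
    {val : PathNetwork → ℕ → ℕ → ℝ → ℝ}
    (h : ∀ {P : PathNetwork} {i j : ℕ} {x : ℝ} {σ : State}, Pre P i j x → Loads P i j x σ →
      Runs p σ (C * (P.n + 1) ^ 2) (fun σ' => σ'.rreg 0 = val P i j x)) :
    ∃ C', ∀ {P : PathNetwork} {i j : ℕ} {x : ℝ} {σ : State},
      Pre P.rev (P.n - j) (P.n - i) (P.pos P.n - x) → Loads P i j x σ →
      Runs (.seq reverseProg p) σ (C' * (P.n + 1) ^ 2)
        (fun σ' => σ'.rreg 0 = val P.rev (P.n - j) (P.n - i) (P.pos P.n - x)) := by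
  obtain ⟨C₁, hC₁⟩ := reverseProg_runs
  refine ⟨C₁ + C, ?_⟩
  intro P i j x σ hpre hL
  refine ((hC₁ hL).seq fun σ₁ _ L₁ => h hpre L₁).mono ?_ fun _ _ h => h
  have h1 : P.n + 1 ≤ (P.n + 1) ^ 2 := Nat.le_self_pow two_ne_zero _
  rw [add_mul]
  exact Nat.add_le_add_right (Nat.mul_le_mul_left C₁ h1) _

end RealRAM

/-! ### The six programs and their running times -/

open RealRAM PathNetwork

theorem theorem4 :
    (∃ (p : RealRAM.Prog) (C : ℕ), ∀ (P : PathNetwork) (j : ℕ) (x : ℝ),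
      1 ≤ P.n → x ∈ Set.Icc (P.pos 0) (P.pos P.n) → j ≤ P.n → P.pos j ≤ x →
        p.EvaluatesWithin (P.input j j x) (P.G₁ j x) (C * P.n ^ 2)) ∧
    (∃ (p : RealRAM.Prog) (C : ℕ), ∀ (P : PathNetwork) (i j : ℕ) (x : ℝ),
      x ∈ Set.Icc (P.pos 0) (P.pos P.n) → i < j → j ≤ P.n → P.pos j ≤ x →
        p.EvaluatesWithin (P.input i j x) (P.G₂ i j x) (C * P.n ^ 2)) ∧
    (∃ (p : RealRAM.Prog) (C : ℕ), ∀ (P : PathNetwork) (i j : ℕ) (x : ℝ),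
      x ∈ Set.Icc (P.pos 0) (P.pos P.n) → i < j → j ≤ P.n → P.pos j ≤ x →
        p.EvaluatesWithin (P.input i j x) (P.Gbar i j x) (C * P.n ^ 2)) ∧
    (∃ (p : RealRAM.Prog) (C : ℕ), ∀ (P : PathNetwork) (i : ℕ) (x : ℝ),
      1 ≤ P.n → x ∈ Set.Icc (P.pos 0) (P.pos P.n) → i ≤ P.n → x ≤ P.pos i →
        p.EvaluatesWithin (P.input i i x) (P.H₁ i x) (C * P.n ^ 2)) ∧
    (∃ (p : RealRAM.Prog) (C : ℕ), ∀ (P : PathNetwork) (i j : ℕ) (x : ℝ),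
      x ∈ Set.Icc (P.pos 0) (P.pos P.n) → i < j → j ≤ P.n → x ≤ P.pos i →
        p.EvaluatesWithin (P.input i j x) (P.H₂ i j x) (C * P.n ^ 2)) ∧
    (∃ (p : RealRAM.Prog) (C : ℕ), ∀ (P : PathNetwork) (i j : ℕ) (x : ℝ),
      x ∈ Set.Icc (P.pos 0) (P.pos P.n) → i < j → j ≤ P.n → x ≤ P.pos i →
        p.EvaluatesWithin (P.input i j x) (P.Hbar i j x) (C * P.n ^ 2)) := by
  obtain ⟨C, hC⟩ := progG_runs
  obtain ⟨D, hD⟩ := progGbar_runs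
  -- The single index is passed twice, as i = j, so that the statement has the two-index form
  -- required by `Runs.reversed`.
  have g₁ : ∀ {P : PathNetwork} {i j : ℕ} {x : ℝ} {σ : State},
      (i = j ∧ j ≤ P.n ∧ P.pos j ≤ x ∧ x ≤ P.pos P.n) → Loads P i j x σ →
      Runs progG σ (C * (P.n + 1) ^ 2) (fun σ' => σ'.rreg 0 = P.G₁ j x) := by
    rintro P i j x σ ⟨rfl, hj, hx, hxn⟩ hL
    exact (hC le_rfl hj hxn hL).mono le_rfl fun _ _ h => (G₁_eq hj hx h).symm
  have g₂ : ∀ {P : PathNetwork} {i j : ℕ} {x : ℝ} {σ : State},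
      (i < j ∧ j ≤ P.n ∧ P.pos j ≤ x ∧ x ≤ P.pos P.n) → Loads P i j x σ →
      Runs progG σ (C * (P.n + 1) ^ 2) (fun σ' => σ'.rreg 0 = P.G₂ i j x) := by
    rintro P i j x σ ⟨hij, hj, hx, hxn⟩ hL
    exact (hC hij.le hj hxn hL).mono le_rfl fun _ _ h => (G₂_eq hij hj hx h).symm
  have g₃ : ∀ {P : PathNetwork} {i j : ℕ} {x : ℝ} {σ : State},
      (i < j ∧ j ≤ P.n ∧ P.pos j ≤ x ∧ x ≤ P.pos P.n) → Loads P i j x σ →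
      Runs progGbar σ (D * (P.n + 1) ^ 2) (fun σ' => σ'.rreg 0 = P.Gbar i j x) := by
    rintro P i j x σ ⟨hij, hj, -, hxn⟩ hL
    exact (hD hij.le hj hxn hL).mono le_rfl fun _ _ h => (Gbar_eq hij hj h).symm
  obtain ⟨C₁, h₁⟩ := Runs.reversed g₁
  obtain ⟨C₂, h₂⟩ := Runs.reversed g₂
  obtain ⟨C₃, h₃⟩ := Runs.reversed g₃
  have hrev : ∀ {P : PathNetwork} {i : ℕ} {x : ℝ}, x ∈ Set.Icc (P.pos 0) (P.pos P.n) → i ≤ P.n →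
      x ≤ P.pos i → P.rev.pos (P.n - i) ≤ P.pos P.n - x ∧
        P.pos P.n - x ≤ P.rev.pos P.rev.n := by
    intro P i x hx hi hxi
    have h0 := hx.1
    rw [pos_zero] at h0
    rw [pos_rev (Nat.sub_le _ _), Nat.sub_sub_self hi, rev_n, pos_rev_n]
    exact ⟨by linarith, by linarith⟩
  refine ⟨⟨progG, 4 * C, ?_⟩, ⟨progG, 4 * C, ?_⟩, ⟨progGbar, 4 * D, ?_⟩,
    ⟨.seq reverseProg progG, 4 * C₁, ?_⟩, ⟨.seq reverseProg progG, 4 * C₂, ?_⟩,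
    ⟨.seq reverseProg progGbar, 4 * C₃, ?_⟩⟩
  · intro P j x hn hx hj hjx
    exact (g₁ ⟨rfl, hj, hjx, hx.2⟩ (loads_input P j j x)).evaluatesWithin hn
  · intro P i j x hx hij hj hjx
    exact (g₂ ⟨hij, hj, hjx, hx.2⟩ (loads_input P i j x)).evaluatesWithin (by omega)
  · intro P i j x hx hij hj hjx
    exact (g₃ ⟨hij, hj, hjx, hx.2⟩ (loads_input P i j x)).evaluatesWithin (by omega)
  · intro P i x hn hx hi hxi
    rw [H₁_eq hi]
    exact (h₁ ⟨rfl, Nat.sub_le _ _, hrev hx hi hxi⟩ (loads_input P i i x)).evaluatesWithin hn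
  · intro P i j x hx hij hj hxi
    rw [H₂_eq hij hj]
    exact (h₂ ⟨by omega, Nat.sub_le _ _, hrev hx (by omega) hxi⟩
      (loads_input P i j x)).evaluatesWithin (by omega)
  · intro P i j x hx hij hj hxi
    rw [Hbar_eq hij hj]
    exact (h₃ ⟨by omega, Nat.sub_le _ _, hrev hx (by omega) hxi⟩
      (loads_input P i j x)).evaluatesWithin (by omega)
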